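/- Let $M$ and $N$ be smooth manifolds (finite-dimensional, Hausdorff, second countable, without boundary) and let $\Phi\in C^\infty(M,N)$. For a cochain map $f:X^\bullet\to Y^\bullet$ let $\operatorname{Cone}^n(f)=Y^{n-1}\oplus X^n$ with differential $d(\alpha,\beta)=(f(\beta)-d\alpha,\,d\beta)$. Let $H^q_{dR}(\Phi)$ be the $q$-th cohomology of the cone of the pull-back $\Phi^*:\Omega^\bullet(N)\to\Omega^\bullet(M)$ of differential forms. A good cover of a manifold is an open cover all of whose non-empty finite intersections are contractible. For a good cover $\mathcal U=\{U_i\}_{i\in I}$, let $\check C^p(\mathcal U,\mathbb R)$ be the space of families of locally constant functions $f_{i_0\cdots i_p}:U_{i_0}\cap\cdots\cap U_{i_p}\to\mathbb R$, antisymmetric in the indices, with differential $(df)_{i_0\cdots i_{p+1}}=\sum_{k=0}^{p+1}(-1)^k f_{i_0\cdots\widehat{i_k}\cdots i_{p+1}}$ (restricted to $U_{i_0}\cap\cdots\cap U_{i_{p+1}}$). Let $\mathcal U=\{U_i\}_{i\in I}$ and $\mathcal V=\{V_j\}_{j\in J}$ be good covers of $M$ and $N$ and let $r:I\to J$ be a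 map with $\Phi(U_i)\subseteq V_{r(i)}$ for all $i\in I$. Let $\check H^q(\Phi,\mathbb R)$ be the $q$-th cohomology of the cone of the pull-back $\Phi^*:\check C^\bullet(\mathcal V,\mathbb R)\to\check C^\bullet(\mathcal U,\mathbb R)$, $(\Phi^*g)_{i_0\cdots i_p}=g_{r(i_0)\cdots r(i_p)}\circ\Phi$. Then for every $q\ge 0$ there is an isomorphism of real vector spaces $$H^q_{dR}(\Phi)\;\cong\;\check H^q(\Phi,\mathbb R).$$ -/

import Mathlib

open Set TopologicalSpace CategoryTheory
open scoped Manifold ContDiff Topology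

noncomputable section

/-! ### The mapping cone of a cochain map -/

namespace RelCone

universe u v w

variable {R : Type u} [CommRing R]

/-- The module `Y^{n-1}`, which is `0` for `n = 0`. -/
def Pred (Y : CochainComplex (ModuleCat.{w} R) ℕ) : ℕ → Type w
  | 0 => PUnit
  | n + 1 => Y.X n

instance (Y : CochainComplex (ModuleCat.{w} R) ℕ) : ∀ n, AddCommGroup (Pred Y n)
  | 0 => (inferInstance : AddCommGroup PUnit.{w + 1})
  | n + 1 => (inferInstance : AddCommGroup (Y.X n))

instance (Y : CochainComplex (ModuleCat.{w} R) ℕ) : ∀ n, Module R (Pred Y n)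
  | 0 => (inferInstance : Module R PUnit.{w + 1})
  | n + 1 => (inferInstance : Module R (Y.X n))

/-- The differential `Y^{n-1} → Y^n`. -/
def predD (Y : CochainComplex (ModuleCat.{w} R) ℕ) : ∀ n, Pred Y n →ₗ[R] Y.X n
  | 0 => 0
  | n + 1 => (Y.d n (n + 1)).hom

theorem d_predD (Y : CochainComplex (ModuleCat.{w} R) ℕ) (n : ℕ) (a : Pred Y n) :
    (Y.d n (n + 1)).hom (predD Y n a) = 0 := by
  cases n with
  | zero => exact map_zero _
  | succ n =>
    have h := Y.d_comp_d n (n + 1) (n + 2)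
    exact LinearMap.congr_fun (congrArg ModuleCat.Hom.hom h) a

section

variable (X : CochainComplex (ModuleCat.{v} R) ℕ) (Y : CochainComplex (ModuleCat.{w} R) ℕ)
  (f : ∀ n, X.X n →ₗ[R] Y.X n)

/-- The differential `Y^{n-1} ⊕ X^n → Y^n ⊕ X^{n+1}`, `d (α, β) = (f β - d α, d β)`. -/
def coneD (n : ℕ) : (Pred Y n × X.X n) →ₗ[R] (Pred Y (n + 1) × X.X (n + 1)) where
  toFun p := ((f n p.2 - predD Y n p.1 : Y.X n), (X.d n (n + 1)).hom p.2)
  map_add' p q := by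
    refine Prod.ext ?_ (map_add _ _ _)
    change f n (p.2 + q.2) - predD Y n (p.1 + q.1) =
      (f n p.2 - predD Y n p.1) + (f n q.2 - predD Y n q.1)
    rw [map_add, map_add]
    abel
  map_smul' c p := by
    refine Prod.ext ?_ (map_smul _ _ _)
    change f n (c • p.2) - predD Y n (c • p.1) = c • (f n p.2 - predD Y n p.1)
    rw [map_smul, map_smul, smul_sub]

theorem coneD_coneD
    (hf : ∀ n x, f (n + 1) ((X.d n (n + 1)).hom x) = (Y.d n (n + 1)).hom (f n x))
    (n : ℕ) (p : Pred Y n × X.X n) :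
    coneD X Y f (n + 1) (coneD X Y f n p) = 0 := by
  have hX : (X.d (n + 1) (n + 2)).hom ((X.d n (n + 1)).hom p.2) = 0 :=
    LinearMap.congr_fun (congrArg ModuleCat.Hom.hom (X.d_comp_d n (n + 1) (n + 2))) p.2
  refine Prod.ext ?_ hX
  change f (n + 1) ((X.d n (n + 1)).hom p.2) -
    (Y.d n (n + 1)).hom (f n p.2 - predD Y n p.1) = 0
  rw [map_sub, hf, d_predD, sub_zero, sub_self]

/-- The algebraic mapping cone of a cochain map `f : X → Y`:
`Cone^n(f) = Y^{n-1} ⊕ X^n` with `d (α, β) = (f β - d α, d β)`. -/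
def cone
    (hf : ∀ n x, f (n + 1) ((X.d n (n + 1)).hom x) = (Y.d n (n + 1)).hom (f n x)) :
    CochainComplex (ModuleCat.{max v w} R) ℕ :=
  CochainComplex.of (fun n => ModuleCat.of R (Pred Y n × X.X n))
    (fun n => ModuleCat.ofHom (coneD X Y f n))
    (fun n => ModuleCat.hom_ext (LinearMap.ext fun p => coneD_coneD X Y f hf n p))

theorem cone_d
    (hf : ∀ n x, f (n + 1) ((X.d n (n + 1)).hom x) = (Y.d n (n + 1)).hom (f n x)) (n : ℕ) :
    (cone X Y f hf).d n (n + 1) = ModuleCat.ofHom (coneD X Y f n) := by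
  simp only [cone, CochainComplex.of_d]

end

end RelCone

/-! ### Čech cochains with locally constant coefficients -/

namespace Cech

universe u t v w

/-- The intersection `U_{α 0} ∩ ⋯ ∩ U_{α p}`. -/
def inter {M I : Type*} [TopologicalSpace M] (U : I → Opens M) {p : ℕ} (α : Fin (p + 1) → I) :
    Set M :=
  {x | ∀ k, x ∈ U (α k)}

/-- A good cover: an open cover all of whose non-empty finite intersections are contractible. -/
structure IsGoodCover {M I : Type*} [TopologicalSpace M] (U : I → Opens M) : Prop where
  covers : ∀ x, ∃ i, x ∈ U i
  contractible : ∀ (p : ℕ) (α : Fin (p + 1) → I), (inter U α).Nonempty →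
    ContractibleSpace (inter U α)

variable {M : Type v} {I : Type w} [TopologicalSpace M] (U : I → Opens M)

/-- The inclusion of `U_{α 0 ⋯ α p}` into the intersection of a reindexed subfamily. -/
def incl {p q : ℕ} (α : Fin (p + 1) → I) (s : Fin (q + 1) → Fin (p + 1)) :
    C(inter U α, inter U (α ∘ s)) where
  toFun x := ⟨x.1, fun k => x.2 (s k)⟩
  continuous_toFun := by fun_prop

variable (R : Type u) [CommRing R] (A : Type t) [AddCommGroup A] [Module R A]

/-- Čech `p`-cochains: families of locally constant functions
`f_{α 0 ⋯ α p} : U_{α 0 ⋯ α p} → A`, antisymmetric in the indices. (Over an empty intersection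
there is exactly one such function.) -/
def cochains (p : ℕ) :
    Submodule R (∀ α : Fin (p + 1) → I, LocallyConstant (inter U α) A) where
  carrier := {f | ∀ (σ : Equiv.Perm (Fin (p + 1))) (α : Fin (p + 1) → I) (x : inter U α),
    f (α ∘ σ) (incl U α σ x) = (Equiv.Perm.sign σ : ℤ) • f α x}
  add_mem' {f g} hf hg σ α x := by
    simp only [Pi.add_apply, LocallyConstant.coe_add, hf σ α x, hg σ α x, smul_add]
  zero_mem' σ α x := by simp
  smul_mem' c f hf σ α x := by
    simp only [Pi.smul_apply, LocallyConstant.coe_smul, hf σ α x]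
    exact smul_comm _ _ _

/-- The Čech differential
`(d f)_{α 0 ⋯ α (p+1)} = ∑ i, (-1)^i f_{α 0 ⋯ (omit α i) ⋯ α (p+1)}` on all families. -/
def dAux (p : ℕ) :
    (∀ α : Fin (p + 1) → I, LocallyConstant (inter U α) A) →ₗ[R]
      (∀ α : Fin (p + 2) → I, LocallyConstant (inter U α) A) :=
  LinearMap.pi fun α => ∑ i : Fin (p + 2), (-1 : R) ^ (i : ℕ) •
    (LocallyConstant.comapₗ R (incl U α i.succAbove)).comp
      (LinearMap.proj (α ∘ i.succAbove))

theorem dAux_apply (p : ℕ) (f : ∀ α : Fin (p + 1) → I, LocallyConstant (inter U α) A)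
    (α : Fin (p + 2) → I) (x : inter U α) :
    dAux U R A p f α x =
      ∑ i : Fin (p + 2), (-1 : R) ^ (i : ℕ) •
        f (α ∘ i.succAbove) (incl U α i.succAbove x) := by
  simp only [dAux, LinearMap.pi_apply, LinearMap.sum_apply]
  rw [← LocallyConstant.evalₗ_apply R x, map_sum]
  rfl

theorem dAux_dAux (p : ℕ) (f : ∀ α : Fin (p + 1) → I, LocallyConstant (inter U α) A) :
    dAux U R A (p + 1) (dAux U R A p f) = 0 := by
  funext α
  ext x
  simp only [dAux_apply, Finset.smul_sum, smul_smul, Pi.zero_apply, LocallyConstant.coe_zero,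
    ← Finset.sum_product', Finset.univ_product_univ]
  refine Finset.sum_involution
    (fun ij _ => (ij.1.succAbove ij.2, ij.2.predAbove ij.1)) ?_ ?_ (fun _ _ => Finset.mem_univ _) ?_
  · rintro ⟨i, j⟩ -
    have h1 : (α ∘ (i.succAbove j).succAbove) ∘ (j.predAbove i).succAbove =
        (α ∘ i.succAbove) ∘ j.succAbove := by
      funext k
      simp only [Function.comp_apply, Fin.succAbove_succAbove_succAbove_predAbove]
    have h2 : ∀ β γ : Fin (p + 1) → I, ∀ h : β = γ, ∀ (y : inter U β) (z : inter U γ),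
        y.1 = z.1 → f β y = f γ z := by
      rintro β _ rfl y z h
      rw [Subtype.ext h]
    rw [h2 _ _ h1 _ (incl U (α ∘ i.succAbove) j.succAbove (incl U α i.succAbove x)) rfl,
      ← add_smul, ← pow_add, ← pow_add, Fin.neg_one_pow_succAbove_add_predAbove, add_neg_cancel,
      zero_smul]
  · rintro ⟨i, j⟩ - - h
    exact Fin.succAbove_ne _ _ (congrArg Prod.fst h)
  · rintro ⟨i, j⟩ -
    refine Prod.ext (Fin.succAbove_succAbove_predAbove i j) ?_
    exact Fin.predAbove_predAbove_succAbove i j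

/-- For a permutation `σ` of `{0, …, n}` and an index `i`, the permutation induced between the
complements of `i` and `σ i`, with its sign. -/
theorem exists_perm_succAbove {n : ℕ} (σ : Equiv.Perm (Fin (n + 1))) (i : Fin (n + 1)) :
    ∃ τ : Equiv.Perm (Fin n), (∀ k, σ (i.succAbove k) = (σ i).succAbove (τ k)) ∧
      (Equiv.Perm.sign σ : ℤ) = (-1) ^ ((σ i : ℕ)) * (-1) ^ (i : ℕ) * Equiv.Perm.sign τ := by
  set ρ : Equiv.Perm (Fin (n + 1)) := (σ i).cycleRange * σ * i.cycleRange⁻¹ with hρ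
  obtain ⟨⟨q, τ⟩, h⟩ := Equiv.Perm.decomposeFin.symm.surjective ρ
  have hq : q = 0 := by
    have := congrArg (fun e : Equiv.Perm (Fin (n + 1)) => e 0) h
    simpa [hρ, Equiv.Perm.inv_def] using this
  subst hq
  refine ⟨τ, fun k => ?_, ?_⟩
  · have := congrArg (fun e : Equiv.Perm (Fin (n + 1)) => (σ i).cycleRange.symm (e k.succ)) h
    simpa [hρ, Equiv.Perm.inv_def, Fin.cycleRange_symm_succ] using this.symm
  · have hs : σ = (σ i).cycleRange⁻¹ * ρ * i.cycleRange := by rw [hρ]; group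
    conv_lhs => rw [hs, ← h]
    simp [Fin.sign_cycleRange]
    ring

theorem dAux_mem (p : ℕ) {f : ∀ α : Fin (p + 1) → I, LocallyConstant (inter U α) A}
    (hf : f ∈ cochains U R A p) : dAux U R A p f ∈ cochains U R A (p + 1) := by
  intro σ α x
  rw [dAux_apply, dAux_apply, Finset.smul_sum]
  refine Fintype.sum_equiv σ _ _ fun i => ?_
  obtain ⟨τ, hτ, hs⟩ := exists_perm_succAbove σ i
  have h1 : (α ∘ σ) ∘ i.succAbove = (α ∘ (σ i).succAbove) ∘ τ := by
    funext k
    simp only [Function.comp_apply, hτ]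
  have h2 : ∀ β γ : Fin (p + 1) → I, ∀ h : β = γ, ∀ (y : inter U β) (z : inter U γ),
      y.1 = z.1 → f β y = f γ z := by
    rintro β _ rfl y z h
    rw [Subtype.ext h]
  rw [h2 _ _ h1 _ (incl U (α ∘ (σ i).succAbove) τ (incl U α (σ i).succAbove x)) rfl,
    hf τ _ _, hs, ← Int.cast_smul_eq_zsmul R, ← Int.cast_smul_eq_zsmul R, smul_smul, smul_smul]
  congr 1
  push_cast
  have h3 : ((-1 : R) ^ (σ i : ℕ)) * (-1) ^ (σ i : ℕ) = 1 := by
    rw [← mul_pow]; simp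
  linear_combination (-(-1 : R) ^ (i : ℕ) * ((Equiv.Perm.sign τ : ℤ) : R)) * h3

/-- The Čech complex of a cover with coefficients in `A`. -/
def complex : CochainComplex (ModuleCat.{max t v w} R) ℕ :=
  CochainComplex.of (fun p => ModuleCat.of R (cochains U R A p))
    (fun p => ModuleCat.ofHom
      ((dAux U R A p).restrict fun _ hf => dAux_mem U R A p hf))
    (fun p => by
      refine ModuleCat.hom_ext (LinearMap.ext fun f => ?_)
      exact Subtype.ext (dAux_dAux U R A p f.1))

theorem complex_d (p : ℕ) :
    (complex U R A).d p (p + 1) = ModuleCat.ofHom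
      ((dAux U R A p).restrict fun _ hf => dAux_mem U R A p hf) := by
  simp only [complex, CochainComplex.of_d]

variable {N : Type*} {J : Type*} [TopologicalSpace N]
  {U} {V : J → Opens N} (φ : C(M, N)) (r : I → J) (hr : ∀ i, MapsTo φ (U i) (V (r i)))

/-- The map `U_{α 0 ⋯ α p} → V_{r (α 0) ⋯ r (α p)}` induced by `φ`. -/
def interMap {p : ℕ} (α : Fin (p + 1) → I) : C(inter U α, inter V (r ∘ α)) where
  toFun x := ⟨φ x.1, fun k => hr _ (x.2 k)⟩
  continuous_toFun := by fun_prop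

/-- The pull-back of Čech cochains, `(φ^* g)_{α 0 ⋯ α p} = g_{r (α 0) ⋯ r (α p)} ∘ φ`. -/
def pullback (p : ℕ) : cochains V R A p →ₗ[R] cochains U R A p where
  toFun g := ⟨fun α => (g.1 (r ∘ α)).comap (interMap φ r hr α),
    fun σ α x => g.2 σ (r ∘ α) (interMap φ r hr α x)⟩
  map_add' _ _ := rfl
  map_smul' _ _ := rfl

theorem pullback_d (p : ℕ) (g : cochains V R A p) :
    pullback R A φ r hr (p + 1) (((complex V R A).d p (p + 1)).hom g) =
      ((complex U R A).d p (p + 1)).hom (pullback R A φ r hr p g) := by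
  rw [complex_d, complex_d]
  refine Subtype.ext (funext fun α => LocallyConstant.ext fun x => ?_)
  exact (dAux_apply V R A p g.1 (r ∘ α) (interMap φ r hr α x)).trans
    (dAux_apply U R A p (pullback R A φ r hr p g).1 α x).symm

/-- Relative Čech cohomology of `φ` for the covers `U`, `V` and the index map `r`: the cohomology
of the mapping cone of `φ^*`, the pull-back from the Čech complex of `V` to that of `U`. -/
def relCohomology (q : ℕ) : ModuleCat R :=
  (RelCone.cone (complex V R A) (complex U R A) (pullback R A φ r hr)
    (pullback_d R A φ r hr)).homology q

end Cech

/-! ### Differential forms on manifolds -/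

namespace Forms

theorem eventually_inCharts {E M F N : Type*} [TopologicalSpace E] [TopologicalSpace M]
    [TopologicalSpace F] [TopologicalSpace N] {φ : M → N} (hφ : Continuous φ)
    {e : OpenPartialHomeomorph M E} {e' : OpenPartialHomeomorph N F} {y : E}
    (hy : y ∈ e.target) (hy' : φ (e.symm y) ∈ e'.source) :
    ∀ᶠ z in 𝓝 y, z ∈ e.target ∧ φ (e.symm z) ∈ e'.source :=
  (e.open_target.eventually_mem hy).and
    ((hφ.continuousAt.comp (e.continuousAt_symm hy)).eventually_mem
      (e'.open_source.mem_nhds hy'))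

variable (E : Type*) [NormedAddCommGroup E] [NormedSpace ℝ E]
  (M : Type*) [TopologicalSpace M] [ChartedSpace E M]

/-- Families `x ↦ θ x` of alternating `n`-linear forms on the tangent spaces of `M`
(not necessarily continuous in `x`). -/
abbrev FormField (n : ℕ) : Type _ :=
  ∀ x : M, TangentSpace 𝓘(ℝ, E) x [⋀^Fin n]→L[ℝ] ℝ

variable {E M}

/-- The expression of `θ` in the chart `e`, i.e. its pull-back `(e⁻¹)^* θ`; it is meaningful on
`e.target`. -/
def inChart {n : ℕ} (θ : FormField E M n) (e : OpenPartialHomeomorph M E) (y : E) :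
    E [⋀^Fin n]→L[ℝ] ℝ :=
  (θ (e.symm y)).compContinuousLinearMap (mfderiv 𝓘(ℝ, E) 𝓘(ℝ, E) e.symm y)

/-- The exterior derivative: at `x` it is the exterior derivative of the expression of `θ` in the
preferred chart at `x`, pulled back to the tangent space at `x`. -/
def extD {n : ℕ} (θ : FormField E M n) : FormField E M (n + 1) := fun x =>
  (extDeriv (inChart θ (chartAt E x)) (chartAt E x x)).compContinuousLinearMap
    (mfderiv 𝓘(ℝ, E) 𝓘(ℝ, E) (chartAt E x) x)

theorem inChart_add {n : ℕ} (θ η : FormField E M n) (e : OpenPartialHomeomorph M E) :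
    inChart (θ + η) e = inChart θ e + inChart η e := rfl

theorem inChart_smul {n : ℕ} (c : ℝ) (θ : FormField E M n) (e : OpenPartialHomeomorph M E) :
    inChart (c • θ) e = c • inChart θ e := rfl

variable (E M)

/-- Smooth differential `n`-forms on `M`: all their expressions in charts are smooth. -/
def smoothForms (n : ℕ) : Submodule ℝ (FormField E M n) where
  carrier := {θ | ∀ e ∈ atlas E M, ContDiffOn ℝ ∞ (inChart θ e) e.target}
  add_mem' hθ hη e he := (hθ e he).add (hη e he)
  zero_mem' _ _ := contDiffOn_const (c := 0)
  smul_mem' c _ hθ e he := (hθ e he).const_smul c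

variable {E M}
variable {F : Type*} [NormedAddCommGroup F] [NormedSpace ℝ F]
  {N : Type*} [TopologicalSpace N] [ChartedSpace F N]

/-- The pull-back `(φ^* θ) x = θ (φ x) ∘ d φ x`. -/
def pull (φ : M → N) {n : ℕ} (θ : FormField F N n) : FormField E M n := fun x =>
  (θ (φ x)).compContinuousLinearMap (mfderiv 𝓘(ℝ, E) 𝓘(ℝ, F) φ x)

/-- The antisymmetrization of multilinear forms as a continuous linear map. -/
def alternatizationCLM (n : ℕ) :
    ContinuousMultilinearMap ℝ (fun _ : Fin n => E) ℝ →L[ℝ] E [⋀^Fin n]→L[ℝ] ℝ :=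
  LinearMap.mkContinuous
    { toFun := ContinuousMultilinearMap.alternatization
      map_add' := map_add _
      map_smul' := fun c f => by
        ext v
        simp [ContinuousMultilinearMap.alternatization_apply_apply, Finset.mul_sum, mul_left_comm,
          Units.smul_def] }
    (Fintype.card (Equiv.Perm (Fin n)))
    (fun f => ContinuousAlternatingMap.opNorm_le_bound _ (by positivity) fun v => by
      simp only [LinearMap.coe_mk, AddHom.coe_mk,
        ContinuousMultilinearMap.alternatization_apply_apply]
      refine (norm_sum_le _ _).trans ?_
      rw [mul_assoc, ← nsmul_eq_mul]
      refine Finset.sum_le_card_nsmul _ _ _ fun σ _ => ?_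
      have h1 : ‖Equiv.Perm.sign σ • f (v ∘ σ)‖ = ‖f (v ∘ σ)‖ := by
        rcases Int.units_eq_one_or (Equiv.Perm.sign σ) with h | h <;> simp [h]
      rw [h1]
      refine (f.le_opNorm _).trans_eq ?_
      congr 1
      exact Equiv.prod_comp σ (fun i => ‖v i‖))

/-- Smoothness of forms can be checked after forgetting that they are alternating. -/
theorem contDiffAt_of_multilinear {n : ℕ} {g : E → F [⋀^Fin n]→L[ℝ] ℝ} {y : E}
    (h : ContDiffAt ℝ ∞ (fun z => (g z).toContinuousMultilinearMap) y) : ContDiffAt ℝ ∞ g y := by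
  have h1 := ((alternatizationCLM (E := F) n).contDiff.contDiffAt.comp y h).const_smul
    ((Fintype.card (Equiv.Perm (Fin n)) : ℝ)⁻¹)
  refine h1.congr_of_eventuallyEq (Filter.Eventually.of_forall fun z => ?_)
  ext v
  have h2 : ((Fintype.card (Equiv.Perm (Fin n)) : ℝ)) ≠ 0 := by positivity
  have h3 : alternatizationCLM n (g z).toContinuousMultilinearMap v =
      ∑ σ : Equiv.Perm (Fin n), Equiv.Perm.sign σ • (g z) (v ∘ σ) :=
    ContinuousMultilinearMap.alternatization_apply_apply _ _
  have h4 : alternatizationCLM n (g z).toContinuousMultilinearMap v =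
      (Fintype.card (Equiv.Perm (Fin n)) : ℝ) * g z v := by
    rw [h3, ← nsmul_eq_mul, ← Finset.card_univ]
    refine Finset.sum_eq_card_nsmul fun σ _ => ?_
    rw [show (g z) (v ∘ σ) = Equiv.Perm.sign σ • g z v from
      (g z).toAlternatingMap.map_perm v σ, smul_smul, Int.units_mul_self, one_smul]
  change g z v = (Fintype.card (Equiv.Perm (Fin n)) : ℝ)⁻¹ *
    alternatizationCLM n (g z).toContinuousMultilinearMap v
  rw [h4, inv_mul_cancel_left₀ h2]

/-- Pull-backs of smooth forms on vector spaces are smooth. -/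
theorem contDiffAt_compContinuousLinearMap {n : ℕ} {g : E → F [⋀^Fin n]→L[ℝ] ℝ}
    {A : E → E →L[ℝ] F} {y : E} (hg : ContDiffAt ℝ ∞ g y) (hA : ContDiffAt ℝ ∞ A y) :
    ContDiffAt ℝ ∞ (fun z => (g z).compContinuousLinearMap (A z)) y := by
  apply contDiffAt_of_multilinear
  have h1 : ContDiffAt ℝ ∞ (fun z => (g z).toContinuousMultilinearMap) y :=
    (ContinuousAlternatingMap.toContinuousMultilinearMapCLM ℝ :
      (F [⋀^Fin n]→L[ℝ] ℝ) →L[ℝ] _).contDiff.contDiffAt.comp y hg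
  have h2 : ContDiffAt ℝ ∞ (fun z =>
      ContinuousMultilinearMap.compContinuousLinearMapContinuousMultilinear ℝ
        (fun _ : Fin n => E) (fun _ : Fin n => F) ℝ (fun _ => A z)) y :=
    (ContinuousMultilinearMap.contDiff _).contDiffAt.comp y (contDiffAt_pi.2 fun _ => hA)
  exact h2.clm_apply h1

theorem contDiffAt_extDeriv {n : ℕ} {g : E → E [⋀^Fin n]→L[ℝ] ℝ} {y : E}
    (hg : ContDiffAt ℝ ∞ g y) : ContDiffAt ℝ ∞ (extDeriv g) y :=
  ContDiffAt.comp (g := ContinuousAlternatingMap.alternatizeUncurryFinCLM ℝ E ℝ (n := n)) y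
    (ContinuousLinearMap.contDiff _).contDiffAt (hg.fderiv_right (m := ∞) le_rfl)

theorem minSmoothness_two_le : minSmoothness ℝ 2 ≤ (∞ : ℕ∞ω) := by
  rw [minSmoothness_of_isRCLikeNormedField]
  exact WithTop.coe_le_coe.2 (le_top : (2 : ℕ∞) ≤ ⊤)

variable [IsManifold 𝓘(ℝ, E) ∞ M] [IsManifold 𝓘(ℝ, F) ∞ N]

/-- The expression of a smooth map in charts is smooth. -/
theorem contDiffAt_inCharts {φ : M → N} (hφ : ContMDiff 𝓘(ℝ, E) 𝓘(ℝ, F) ∞ φ)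
    {e : OpenPartialHomeomorph M E} (he : e ∈ atlas E M)
    {e' : OpenPartialHomeomorph N F} (he' : e' ∈ atlas F N) {y : E}
    (hy : y ∈ e.target) (hy' : φ (e.symm y) ∈ e'.source) :
    ContDiffAt ℝ ∞ (fun z => e' (φ (e.symm z))) y := by
  have h1 : ContMDiffAt 𝓘(ℝ, E) 𝓘(ℝ, E) ∞ e.symm y :=
    (contMDiffOn_symm_of_mem_maximalAtlas (IsManifold.subset_maximalAtlas (n := ∞) he)).contMDiffAt
      (e.open_target.mem_nhds hy)
  have h2 : ContMDiffAt 𝓘(ℝ, F) 𝓘(ℝ, F) ∞ e' (φ (e.symm y)) :=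
    (contMDiffOn_of_mem_maximalAtlas (IsManifold.subset_maximalAtlas he')).contMDiffAt
      (e'.open_source.mem_nhds hy')
  exact (ContMDiffAt.comp y h2 (ContMDiffAt.comp y hφ.contMDiffAt h1)).contDiffAt

/-- The expression of `φ^* θ` in charts. -/
theorem inChart_pull {φ : M → N} (hφ : ContMDiff 𝓘(ℝ, E) 𝓘(ℝ, F) ∞ φ) {n : ℕ}
    (θ : FormField F N n)
    {e : OpenPartialHomeomorph M E} (he : e ∈ atlas E M)
    {e' : OpenPartialHomeomorph N F} (he' : e' ∈ atlas F N) {y : E}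
    (hy : y ∈ e.target) (hy' : φ (e.symm y) ∈ e'.source) :
    inChart (pull φ θ) e y = (inChart θ e' (e' (φ (e.symm y)))).compContinuousLinearMap
      (fderiv ℝ (fun z => e' (φ (e.symm z))) y) := by
  have h1 : MDifferentiableAt 𝓘(ℝ, E) 𝓘(ℝ, E) e.symm y :=
    ((contMDiffOn_symm_of_mem_maximalAtlas (IsManifold.subset_maximalAtlas (n := ∞) he)).contMDiffAt
      (e.open_target.mem_nhds hy)).mdifferentiableAt (n := ∞) (by simp)
  have h2 : MDifferentiableAt 𝓘(ℝ, F) 𝓘(ℝ, F) e'.symm (e' (φ (e.symm y))) :=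
    ((contMDiffOn_symm_of_mem_maximalAtlas
      (IsManifold.subset_maximalAtlas (n := ∞) he')).contMDiffAt
      (e'.open_target.mem_nhds (e'.map_source hy'))).mdifferentiableAt (n := ∞) (by simp)
  have h3 := (contDiffAt_inCharts hφ he he' hy hy').contMDiffAt.mdifferentiableAt (n := ∞) (by simp)
  have h4 : MDifferentiableAt 𝓘(ℝ, E) 𝓘(ℝ, F) φ (e.symm y) :=
    hφ.contMDiffAt.mdifferentiableAt (n := ∞) (by simp)
  have key : (mfderiv 𝓘(ℝ, E) 𝓘(ℝ, F) φ (e.symm y)).comp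
      (mfderiv 𝓘(ℝ, E) 𝓘(ℝ, E) e.symm y) =
      (mfderiv 𝓘(ℝ, F) 𝓘(ℝ, F) e'.symm (e' (φ (e.symm y)))).comp
        (mfderiv 𝓘(ℝ, E) 𝓘(ℝ, F) (fun z => e' (φ (e.symm z))) y) := by
    refine (mfderiv_comp y h4 h1).symm.trans (Eq.trans ?_ (mfderiv_comp y h2 h3))
    refine Filter.EventuallyEq.mfderiv_eq ?_
    filter_upwards [eventually_inCharts hφ.continuous hy hy'] with z hz
    exact (e'.left_inv hz.2).symm
  have h5 : ∀ (p q : N) (h : p = q) (v : Fin n → F), (θ p : F [⋀^Fin n]→L[ℝ] ℝ) v = θ q v := by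
    rintro p _ rfl v
    rfl
  rw [← mfderiv_eq_fderiv]
  ext v
  refine Eq.trans ?_ (h5 _ _ (e'.left_inv hy').symm _)
  exact congrArg (θ (φ (e.symm y)) : F [⋀^Fin n]→L[ℝ] ℝ)
    (funext fun i => congrArg (fun L : E →L[ℝ] F => L (v i)) key)

theorem pull_mem {φ : M → N} (hφ : ContMDiff 𝓘(ℝ, E) 𝓘(ℝ, F) ∞ φ) {n : ℕ}
    {θ : FormField F N n} (hθ : θ ∈ smoothForms F N n) : pull φ θ ∈ smoothForms E M n := by
  intro e he y hy
  have he' := chart_mem_atlas F (φ (e.symm y))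
  have hy' := mem_chart_source F (φ (e.symm y))
  set e' := chartAt F (φ (e.symm y))
  refine ContDiffAt.contDiffWithinAt ?_
  have hτ := contDiffAt_inCharts hφ he he' hy hy'
  have h1 : ContDiffAt ℝ ∞ (inChart θ e') (e' (φ (e.symm y))) :=
    (hθ e' he').contDiffAt (e'.open_target.mem_nhds (e'.map_source hy'))
  refine (contDiffAt_compContinuousLinearMap (h1.comp y hτ)
    (hτ.fderiv_right (m := ∞) le_rfl)).congr_of_eventuallyEq ?_
  filter_upwards [eventually_inCharts hφ.continuous hy hy'] with z hz
  exact inChart_pull hφ θ he he' hz.1 hz.2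

/-- The change of charts for forms. -/
theorem inChart_change {n : ℕ} (θ : FormField E M n)
    {e : OpenPartialHomeomorph M E} (he : e ∈ atlas E M)
    {e' : OpenPartialHomeomorph M E} (he' : e' ∈ atlas E M) {y : E}
    (hy : y ∈ e.target) (hy' : e.symm y ∈ e'.source) :
    inChart θ e y = (inChart θ e' (e' (e.symm y))).compContinuousLinearMap
      (fderiv ℝ (fun z => e' (e.symm z)) y) := by
  have h : pull (fun x : M => x) θ = θ := by
    funext x
    ext v
    have : mfderiv 𝓘(ℝ, E) 𝓘(ℝ, E) (fun x : M => x) x = ContinuousLinearMap.id ℝ _ := mfderiv_id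
    simp only [pull, this]
    rfl
  have := inChart_pull (φ := fun x : M => x) contMDiff_id θ he he' hy hy'
  rwa [h] at this

/-- In every chart the exterior derivative is the exterior derivative on the vector space. -/
theorem inChart_extD {n : ℕ} {θ : FormField E M n} (hθ : θ ∈ smoothForms E M n)
    {e : OpenPartialHomeomorph M E} (he : e ∈ atlas E M) {y : E} (hy : y ∈ e.target) :
    inChart (extD θ) e y = extDeriv (inChart θ e) y := by
  have he' := chart_mem_atlas E (e.symm y)
  have hy' := mem_chart_source E (e.symm y)
  set e' := chartAt E (e.symm y) with he'_def
  have hτ := contDiffAt_inCharts (φ := fun x : M => x) contMDiff_id he he' hy hy'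
  have h1 : ContDiffAt ℝ ∞ (inChart θ e') (e' (e.symm y)) :=
    (hθ e' he').contDiffAt (e'.open_target.mem_nhds (e'.map_source hy'))
  have h2 : extDeriv (inChart θ e) y =
      (extDeriv (inChart θ e') (e' (e.symm y))).compContinuousLinearMap
        (fderiv ℝ (fun z => e' (e.symm z)) y) := by
    rw [← extDeriv_pullback (f := fun z => e' (e.symm z)) (h1.differentiableAt (by simp)) hτ
      minSmoothness_two_le]
    refine Filter.EventuallyEq.extDeriv_eq ?_
    filter_upwards [eventually_inCharts (φ := fun x : M => x) continuous_id hy hy'] with z hz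
    exact inChart_change θ he he' hz.1 hz.2
  rw [h2]
  have h3 : MDifferentiableAt 𝓘(ℝ, E) 𝓘(ℝ, E) e.symm y :=
    ((contMDiffOn_symm_of_mem_maximalAtlas (IsManifold.subset_maximalAtlas (n := ∞) he)).contMDiffAt
      (e.open_target.mem_nhds hy)).mdifferentiableAt (n := ∞) (by simp)
  have h4 : MDifferentiableAt 𝓘(ℝ, E) 𝓘(ℝ, E) e' (e.symm y) :=
    ((contMDiffOn_of_mem_maximalAtlas (IsManifold.subset_maximalAtlas (n := ∞) he')).contMDiffAt
      (e'.open_source.mem_nhds hy')).mdifferentiableAt (n := ∞) (by simp)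
  have key : fderiv ℝ (fun z => e' (e.symm z)) y =
      (mfderiv 𝓘(ℝ, E) 𝓘(ℝ, E) e' (e.symm y)).comp (mfderiv 𝓘(ℝ, E) 𝓘(ℝ, E) e.symm y) := by
    rw [← mfderiv_eq_fderiv]
    exact mfderiv_comp y h4 h3
  rw [key]
  rfl

theorem extD_mem {n : ℕ} {θ : FormField E M n} (hθ : θ ∈ smoothForms E M n) :
    extD θ ∈ smoothForms E M (n + 1) := by
  intro e he y hy
  refine ContDiffWithinAt.congr_of_mem (f := extDeriv (inChart θ e)) ?_
    (fun z hz => inChart_extD hθ he hz) hy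
  exact (contDiffAt_extDeriv
    ((hθ e he).contDiffAt (e.open_target.mem_nhds hy))).contDiffWithinAt

/-- A form is determined by its expressions in charts. -/
theorem ext_inChart {n : ℕ} {θ η : FormField E M n}
    (h : ∀ e ∈ atlas E M, ∀ y ∈ e.target, inChart θ e y = inChart η e y) : θ = η := by
  funext x
  have he := chart_mem_atlas E x
  have hx := mem_chart_source E x
  set e := chartAt E x
  have h1 := h e he (e x) (e.map_source hx)
  have h3 : MDifferentiableAt 𝓘(ℝ, E) 𝓘(ℝ, E) e.symm (e x) :=
    ((contMDiffOn_symm_of_mem_maximalAtlas (IsManifold.subset_maximalAtlas (n := ∞) he)).contMDiffAt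
      (e.open_target.mem_nhds (e.map_source hx))).mdifferentiableAt (n := ∞) (by simp)
  have h4 : MDifferentiableAt 𝓘(ℝ, E) 𝓘(ℝ, E) e x :=
    ((contMDiffOn_of_mem_maximalAtlas (IsManifold.subset_maximalAtlas (n := ∞) he)).contMDiffAt
      (e.open_source.mem_nhds hx)).mdifferentiableAt (n := ∞) (by simp)
  have key : (mfderiv 𝓘(ℝ, E) 𝓘(ℝ, E) e.symm (e x)).comp (mfderiv 𝓘(ℝ, E) 𝓘(ℝ, E) e x) =
      ContinuousLinearMap.id ℝ E := by
    have h5 : mfderiv 𝓘(ℝ, E) 𝓘(ℝ, E) (e.symm ∘ e) x = ContinuousLinearMap.id ℝ E := by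
      refine Eq.trans (Filter.EventuallyEq.mfderiv_eq (f := fun z : M => z) ?_) mfderiv_id
      filter_upwards [e.open_source.mem_nhds hx] with z hz
      exact e.left_inv hz
    rw [← h5]
    exact (mfderiv_comp x h3 h4).symm
  have h6 : ∀ (ζ : FormField E M n) (p q : M) (h : p = q) (v : Fin n → E),
      (ζ p : E [⋀^Fin n]→L[ℝ] ℝ) v = ζ q v := by
    rintro ζ p _ rfl v
    rfl
  have h7 : ∀ (ζ : FormField E M n) (v : Fin n → E), (ζ x : E [⋀^Fin n]→L[ℝ] ℝ) v =
      inChart ζ e (e x) (fun i => (mfderiv 𝓘(ℝ, E) 𝓘(ℝ, E) e x : E →L[ℝ] E) (v i)) := by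
    intro ζ v
    refine Eq.trans ?_ (h6 ζ _ _ (e.left_inv hx).symm _)
    exact congrArg (ζ x : E [⋀^Fin n]→L[ℝ] ℝ)
      (funext fun i => (congrArg (fun L : E →L[ℝ] E => L (v i)) key).symm)
  ext v
  exact (h7 θ v).trans ((congrArg (fun L : E [⋀^Fin n]→L[ℝ] ℝ => L _) h1).trans (h7 η v).symm)

theorem extD_extD {n : ℕ} {θ : FormField E M n} (hθ : θ ∈ smoothForms E M n) :
    extD (extD θ) = 0 := by
  refine ext_inChart fun e he y hy => ?_
  rw [inChart_extD (extD_mem hθ) he hy]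
  have h1 : inChart (extD θ) e =ᶠ[𝓝 y] extDeriv (inChart θ e) := by
    filter_upwards [e.open_target.mem_nhds hy] with z hz
    exact inChart_extD hθ he hz
  rw [h1.extDeriv_eq, extDeriv_extDeriv_apply
    ((hθ e he).contDiffAt (e.open_target.mem_nhds hy)) minSmoothness_two_le]
  rfl

theorem pull_extD {φ : M → N} (hφ : ContMDiff 𝓘(ℝ, E) 𝓘(ℝ, F) ∞ φ) {n : ℕ}
    {θ : FormField F N n} (hθ : θ ∈ smoothForms F N n) :
    pull φ (extD θ) = (extD (pull φ θ) : FormField E M (n + 1)) := by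
  refine ext_inChart fun e he y hy => ?_
  have he' := chart_mem_atlas F (φ (e.symm y))
  have hy' := mem_chart_source F (φ (e.symm y))
  set e' := chartAt F (φ (e.symm y))
  have hτ := contDiffAt_inCharts hφ he he' hy hy'
  have h1 : ContDiffAt ℝ ∞ (inChart θ e') (e' (φ (e.symm y))) :=
    (hθ e' he').contDiffAt (e'.open_target.mem_nhds (e'.map_source hy'))
  rw [inChart_extD (pull_mem hφ hθ) he hy, inChart_pull hφ _ he he' hy hy',
    inChart_extD hθ he' (e'.map_source hy'),
    ← extDeriv_pullback (f := fun z => e' (φ (e.symm z))) (h1.differentiableAt (by simp)) hτ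
      minSmoothness_two_le]
  refine (Filter.EventuallyEq.extDeriv_eq ?_).symm
  filter_upwards [eventually_inCharts hφ.continuous hy hy'] with z hz
  exact inChart_pull hφ θ he he' hz.1 hz.2

variable (E M)

/-- The exterior derivative `Ω^n(M) → Ω^{n+1}(M)`. -/
def d (n : ℕ) : smoothForms E M n →ₗ[ℝ] smoothForms E M (n + 1) where
  toFun θ := ⟨extD θ.1, extD_mem θ.2⟩
  map_add' θ η := Subtype.ext <| ext_inChart fun e he y hy => by
    have h1 := ((θ.2 e he).contDiffAt (e.open_target.mem_nhds hy)).differentiableAt (by simp)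
    have h2 := ((η.2 e he).contDiffAt (e.open_target.mem_nhds hy)).differentiableAt (by simp)
    rw [inChart_extD (θ + η).2 he hy]
    refine Eq.trans (extDeriv_add h1 h2) ?_
    rw [← inChart_extD θ.2 he hy, ← inChart_extD η.2 he hy]
    rfl
  map_smul' c θ := Subtype.ext <| ext_inChart fun e he y hy => by
    rw [inChart_extD (c • θ).2 he hy]
    refine Eq.trans (extDeriv_smul c (inChart θ.1 e)) ?_
    rw [← inChart_extD θ.2 he hy]
    rfl

/-- The de Rham complex of `M`. -/
def complex : CochainComplex (ModuleCat ℝ) ℕ :=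
  CochainComplex.of (fun n => ModuleCat.of ℝ (smoothForms E M n))
    (fun n => ModuleCat.ofHom (d E M n))
    (fun n => by
      refine ModuleCat.hom_ext (LinearMap.ext fun θ => ?_)
      exact Subtype.ext (extD_extD θ.2))

theorem complex_d (n : ℕ) : (complex E M).d n (n + 1) = ModuleCat.ofHom (d E M n) := by
  simp only [complex, CochainComplex.of_d]

variable {E M}

/-- The pull-back `φ^* : Ω^n(N) → Ω^n(M)` along a smooth map. -/
def pullback (φ : C^∞⟮𝓘(ℝ, E), M; 𝓘(ℝ, F), N⟯) (n : ℕ) :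
    smoothForms F N n →ₗ[ℝ] smoothForms E M n where
  toFun θ := ⟨pull φ θ.1, pull_mem φ.contMDiff θ.2⟩
  map_add' _ _ := rfl
  map_smul' _ _ := rfl

theorem pullback_d (φ : C^∞⟮𝓘(ℝ, E), M; 𝓘(ℝ, F), N⟯) (n : ℕ) (θ : smoothForms F N n) :
    pullback φ (n + 1) (((complex F N).d n (n + 1)).hom θ) =
      ((complex E M).d n (n + 1)).hom (pullback φ n θ) := by
  rw [complex_d, complex_d]
  exact Subtype.ext (pull_extD φ.contMDiff θ.2)

/-- Relative de Rham cohomology `H_dR^q(φ)`: the cohomology of the mapping cone of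
`φ^* : Ω(N) → Ω(M)`. -/
def relCohomology (φ : C^∞⟮𝓘(ℝ, E), M; 𝓘(ℝ, F), N⟯) (q : ℕ) : ModuleCat ℝ :=
  (RelCone.cone (complex F N) (complex E M) (pullback φ) (pullback_d φ)).homology q

end Forms

end

noncomputable section

/-! ### Subquotients and the cohomology of mapping cones -/

/-! Both relative cohomologies are compared with the cone of a third map, between Čech–de Rham
double complexes. The entry `cechForms E U p q` consists of the antisymmetric families of `q`-forms
on the `(p+1)`-fold intersections of `U`. The total complex contains the de Rham complex, through
restriction to the members of the cover (column `p = 0`), and the Čech complex, through locally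
constant functions (row `q = 0`).

Both inclusions are quasi-isomorphisms. The augmented rows are exact for every open cover, since a
partition of unity gives a contracting homotopy (`exists_cechD_eq`, `exists_cechRestr_eq`). The
augmented columns are exact for a good cover, by the Poincaré lemma on the contractible
intersections (`exists_derD_eq`, `exists_cechConst_eq`). The staircase argument
`exists_sub_totD_eq_zero` turns exactness in one direction into a quasi-isomorphism
(`augmentationQuasiIso`); exchanging the directions gives the other one.

The index map `r` yields a morphism of double complexes `cechPull`, which commutes strictly with
both inclusions. A five-lemma chase (`RelCone.nonempty_cone_homology_equiv`) then identifies the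
cohomology of the cone of either pull-back, on forms or on Čech cochains, with that of the cone of
`cechPull` on total complexes.

The analytic core is the Poincaré lemma `exists_extD_eq`. Contractibility is only topological, so
the contraction is first replaced by a smooth one (`exists_smooth_contraction`), by smoothing a
continuous map one chart at a time (`exists_contMDiff_eqOn`). Integration over the time variable
then gives a primitive (`extDeriv_fibreIntegral`).

Two encodings avoid dependent types. A form on an open set `W` is a family on all of `M` that is
smooth at the points of `W` and zero elsewhere, so restriction is the cut-off `restr`. A total
complex lives in the full product of the `A p q`, and `totDeg m` cuts out total degree `m - 1`; the
shift by one makes room for degree `-1`, which the cone needs. -/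

theorem nonempty_subquotient_equiv {R : Type*} [CommRing R] {B B' : Type*}
    [AddCommGroup B] [Module R B] [AddCommGroup B'] [Module R B']
    (K S : Submodule R B) (K' S' : Submodule R B') (g : B →ₗ[R] B')
    (hK : ∀ x ∈ K, g x ∈ K') (hS : ∀ x ∈ K, g x ∈ S' ↔ x ∈ S)
    (hsurj : ∀ z ∈ K', ∃ x ∈ K, z - g x ∈ S') :
    Nonempty ((K ⧸ S.comap K.subtype) ≃ₗ[R] (K' ⧸ S'.comap K'.subtype)) := by
  -- First isomorphism theorem for the composite of `g` with the projection: `hS` computes its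
  -- kernel and `hsurj` makes it onto.
  let h : K →ₗ[R] (K' ⧸ S'.comap K'.subtype) :=
    (S'.comap K'.subtype).mkQ.comp (g.restrict hK)
  have hker : LinearMap.ker h = S.comap K.subtype := by
    ext x
    simp only [h, LinearMap.mem_ker, LinearMap.comp_apply, Submodule.mkQ_apply,
      Submodule.Quotient.mk_eq_zero, Submodule.mem_comap, Submodule.subtype_apply,
      LinearMap.coe_restrict_apply]
    exact hS x x.2
  have hs : Function.Surjective h := by
    intro z
    obtain ⟨z, rfl⟩ := Submodule.mkQ_surjective _ z
    obtain ⟨x, hx, hz⟩ := hsurj z z.2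
    refine ⟨⟨x, hx⟩, ?_⟩
    rw [← sub_eq_zero, ← neg_eq_zero, neg_sub, LinearMap.comp_apply, ← map_sub,
      Submodule.mkQ_apply, Submodule.Quotient.mk_eq_zero]
    exact hz
  exact ⟨(Submodule.quotEquivOfEq _ _ hker.symm).trans (h.quotKerEquivOfSurjective hs)⟩

namespace RelCone

universe u v w

variable {R : Type u} [CommRing R]

/-- The cohomology of a cochain complex is the quotient of cocycles by coboundaries. -/
theorem nonempty_homology_equiv (X : CochainComplex (ModuleCat.{v} R) ℕ) (q : ℕ) :
    Nonempty (X.homology q ≃ₗ[R] (LinearMap.ker (X.d q (q + 1)).hom ⧸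
      (LinearMap.range (predD X q)).comap (LinearMap.ker (X.d q (q + 1)).hom).subtype)) := by
  have key : ∀ i, (ComplexShape.up ℕ).prev q = i →
      LinearMap.range (X.d i q).hom = LinearMap.range (predD X q) →
      Nonempty (X.homology q ≃ₗ[R] (LinearMap.ker (X.d q (q + 1)).hom ⧸
        (LinearMap.range (predD X q)).comap (LinearMap.ker (X.d q (q + 1)).hom).subtype)) := by
    intro i hi h
    let S := X.sc' i q (q + 1)
    have e1 : X.homology q ≅ S.homology :=
      ShortComplex.homologyMapIso (X.isoSc' i q (q + 1) hi (by simp))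
    refine ⟨(e1 ≪≫ S.moduleCatHomologyIso).toLinearEquiv.trans
      (Submodule.quotEquivOfEq _ _ ?_)⟩
    ext x
    rw [← h]
    constructor
    · rintro ⟨y, rfl⟩
      exact ⟨y, rfl⟩
    · rintro ⟨y, hy⟩
      exact ⟨y, Subtype.ext hy⟩
  cases q with
  | zero =>
    -- By convention `0` is its own predecessor. The differential from `0` to `0` is zero because
    -- the shape has no such arrow, and it agrees with `predD X 0 = 0`.
    refine key 0 (by simp) ?_
    rw [X.shape 0 0 (by simp)]
    simp [predD]
  | succ q => exact key q (by simp) rfl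

variable {Z : Type*} [AddCommGroup Z] [Module R Z]

/-- A quasi-isomorphism from the cochain complex `X` to the complex with differential `D` on `Z`
whose elements of degree `m - 1` are those of `T m`. -/
structure QuasiIsoTo (X : CochainComplex (ModuleCat.{v} R) ℕ) (D : Z →ₗ[R] Z)
    (T : ℕ → Submodule R Z) where
  toFun : ∀ m, Pred X m →ₗ[R] Z
  mem : ∀ m x, toFun m x ∈ T m
  comm : ∀ m x, D (toFun m x) = toFun (m + 1) (predD X m x)
  inj : ∀ m (x : Pred X (m + 1)), predD X (m + 1) x = 0 → ∀ w ∈ T m,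
    D w = toFun (m + 1) x → ∃ y, predD X m y = x
  surj : ∀ m, ∀ z ∈ T (m + 1), D z = 0 →
    ∃ x : Pred X (m + 1), predD X (m + 1) x = 0 ∧ ∃ w ∈ T m, z - toFun (m + 1) x = D w

section cone

variable {ZX ZY : Type*} [AddCommGroup ZX] [Module R ZX] [AddCommGroup ZY] [Module R ZY]
  (DX : ZX →ₗ[R] ZX) (DY : ZY →ₗ[R] ZY) (TX : ℕ → Submodule R ZX) (TY : ℕ → Submodule R ZY)
  (G : ZX →ₗ[R] ZY)

/-- The differential of the mapping cone of `G`. -/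
def totalConeD : ZY × ZX →ₗ[R] ZY × ZX :=
  (G.comp (LinearMap.snd R ZY ZX) - DY.comp (LinearMap.fst R ZY ZX)).prod
    (DX.comp (LinearMap.snd R ZY ZX))

/-- The cohomology of the mapping cone of `G` in degree `q`. -/
abbrev TotalConeCohomology (q : ℕ) : Type _ :=
  ((LinearMap.ker (totalConeD DX DY G) ⊓ (TY q).prod (TX (q + 1)) : Submodule R (ZY × ZX)) ⧸
    -- Since `T m` holds degree `m - 1`, cone degree `q` is `TY q × TX (q + 1)` and the degree below
    -- is `TY (q - 1) × TX q`. For `q = 0` the truncated subtraction gives `TY 0 × TX 0`, which is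
    -- zero once `TX 0` and `TY 0` are.
    (((TY (q - 1)).prod (TX q)).map (totalConeD DX DY G)).comap
      (LinearMap.ker (totalConeD DX DY G) ⊓ (TY q).prod (TX (q + 1))).subtype)

variable {DX DY TX TY G}

/-- The five lemma for cones, by an element chase. Because `hcompat` holds strictly, the pair `(gY,
gX)` is itself a cochain map of cones. The two chases use the injectivity and surjectivity in
cohomology of `gX` and `gY` to correct cochains in the `X` and `Y` components in turn. -/
theorem nonempty_cone_homology_equiv
    {X : CochainComplex (ModuleCat.{v} R) ℕ} {Y : CochainComplex (ModuleCat.{w} R) ℕ}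
    (f : ∀ n, X.X n →ₗ[R] Y.X n)
    (hf : ∀ n x, f (n + 1) ((X.d n (n + 1)).hom x) = (Y.d n (n + 1)).hom (f n x))
    (gX : QuasiIsoTo X DX TX) (gY : QuasiIsoTo Y DY TY)
    (hX0 : TX 0 = ⊥) (hY0 : TY 0 = ⊥)
    (hG : ∀ x, G (DX x) = DY (G x)) (hGT : ∀ m, ∀ x ∈ TX m, G x ∈ TY m)
    (hcompat : ∀ n x, G (gX.toFun (n + 1) x) = gY.toFun (n + 1) (f n x)) (q : ℕ) :
    Nonempty ((cone X Y f hf).homology q ≃ₗ[R] TotalConeCohomology DX DY TX TY G q) := by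
  let S : Submodule R (Pred Y q × X.X q) := LinearMap.range (predD (cone X Y f hf) q)
  obtain ⟨e⟩ : Nonempty ((cone X Y f hf).homology q ≃ₗ[R]
      (LinearMap.ker (coneD X Y f q) ⧸ S.comap (LinearMap.ker (coneD X Y f q)).subtype)) := by
    have h := nonempty_homology_equiv (cone X Y f hf) q
    rw [cone_d] at h
    exact h
  let fp : ∀ n, Pred X (n + 1) →ₗ[R] Pred Y (n + 1) := f
  have hfp : ∀ n x, predD Y (n + 1) (fp n x) = fp (n + 1) (predD X (n + 1) x) :=
    fun n x => (hf n x).symm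
  have hcp : ∀ n x, G (gX.toFun (n + 1) x) = gY.toFun (n + 1) (fp n x) := hcompat
  let gX' : X.X q →ₗ[R] ZX := gX.toFun (q + 1)
  let g : (Pred Y q × X.X q) →ₗ[R] ZY × ZX :=
    ((gY.toFun q).comp (LinearMap.fst _ _ _)).prod
      (gX'.comp (LinearMap.snd _ _ _))
  have hgX : ∀ b : X.X q, DX (gX.toFun (q + 1) b) = gX.toFun (q + 2) ((X.d q (q + 1)).hom b) :=
    fun b => gX.comm (q + 1) b
  have hgY : ∀ a, DY (gY.toFun q a) = gY.toFun (q + 1) (predD Y q a) := gY.comm q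
  obtain ⟨e'⟩ := nonempty_subquotient_equiv (LinearMap.ker (coneD X Y f q)) S
    (LinearMap.ker (totalConeD DX DY G) ⊓ (TY q).prod (TX (q + 1)))
    (((TY (q - 1)).prod (TX q)).map (totalConeD DX DY G)) g
    (by
      rintro ⟨a, b⟩ hab
      rw [LinearMap.mem_ker] at hab
      have h1 : f q b - predD Y q a = 0 := congrArg Prod.fst hab
      have h2 : (X.d q (q + 1)).hom b = 0 := congrArg Prod.snd hab
      refine ⟨?_, gY.mem q a, gX.mem (q + 1) b⟩
      refine Prod.ext ?_ ?_
      · change G (gX.toFun (q + 1) b) - DY (gY.toFun q a) = 0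
        refine (congrArg₂ (· - ·) (hcompat q b) (hgY a)).trans ?_
        refine (map_sub (gY.toFun (q + 1)) _ _).symm.trans ?_
        exact (congrArg (gY.toFun (q + 1)) h1).trans (map_zero _)
      · change DX (gX.toFun (q + 1) b) = 0
        exact (hgX b).trans ((congrArg _ h2).trans (map_zero _)))
    (by
      rintro ⟨a, b⟩ hab
      rw [LinearMap.mem_ker] at hab
      have h1 : f q b - predD Y q a = 0 := congrArg Prod.fst hab
      have h2 : (X.d q (q + 1)).hom b = 0 := congrArg Prod.snd hab
      cases q with
      | zero =>
        constructor
        · rintro ⟨⟨u, v⟩, ⟨hu, hv⟩, huv⟩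
          have hv0 : v = 0 := by simpa [hX0] using hv
          have h3 : DX v = gX.toFun 1 b := congrArg Prod.snd huv
          -- `y` lies in the zero module `Pred X 0`, so this says that `b = 0`.
          obtain ⟨y, hy⟩ := gX.inj 0 b h2 v hv h3
          refine ⟨0, ?_⟩
          refine (map_zero (predD (cone X Y f hf) 0)).trans ?_
          refine Prod.ext (Subsingleton.elim (α := PUnit) _ _) ?_
          exact (map_zero (predD X 0)).symm.trans
            ((congrArg (predD X 0) (Subsingleton.elim (α := PUnit) _ _)).trans hy)
        · rintro ⟨c, hc⟩
          have : (a, b) = 0 := hc.symm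
          rw [this, map_zero]
          exact Submodule.zero_mem _
      | succ k =>
        constructor
        · rintro ⟨⟨u, v⟩, ⟨hu, hv⟩, huv⟩
          have hu : u ∈ TY k := hu
          have hv : v ∈ TX (k + 1) := hv
          have h3 : DX v = gX.toFun (k + 2) b := congrArg Prod.snd huv
          have h4 : G v - DY u = gY.toFun (k + 1) a := congrArg Prod.fst huv
          obtain ⟨y, hy⟩ := gX.inj (k + 1) b h2 v hv h3
          -- The primitive `y` of `b` is only determined up to a cocycle, and its image may differ
          -- from `v` by a nontrivial class. Subtracting the cocycle `x` representing that class
          -- makes the difference a coboundary `DX t`.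
          obtain ⟨x, hx, t, ht, htx⟩ := gX.surj k (gX.toFun (k + 1) y - v)
            (Submodule.sub_mem _ (gX.mem _ _) hv) (by
              rw [map_sub, gX.comm, h3, hy, sub_self])
          have hy' : predD X (k + 1) (y - x) = b := by rw [map_sub, hy, hx, sub_zero]
          have hv' : v = gX.toFun (k + 1) (y - x) - DX t := by
            rw [map_sub, ← htx]; abel
          -- Substituting `v = gX (y - x) - DX t` into `G v - DY u = gY a` shows that `gY (a - f (y
          -- - x))` is the coboundary of `-(G t + u)`. Hence `a - f (y - x) = d c`, and `(-c, y -
          -- x)` is a primitive of `(a, b)` in the cone.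
          obtain ⟨c, hc⟩ := gY.inj k (a - fp k (y - x))
            (by
              rw [map_sub, sub_eq_zero, hfp, hy']
              exact (sub_eq_zero.1 h1).symm)
            (-(G t + u)) (Submodule.neg_mem _ (Submodule.add_mem _ (hGT _ _ ht) hu)) (by
              rw [map_sub (gY.toFun (k + 1)), ← h4, ← hcp, hv', map_sub G, hG, map_neg, map_add]
              abel)
          refine ⟨(-c, y - x), ?_⟩
          change ((cone X Y f hf).d k (k + 1)).hom (-c, y - x) = (a, b)
          rw [cone_d]
          refine Prod.ext ?_ hy'
          let pc : Pred Y (k + 1) := predD Y k (-c)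
          have hpc : pc = -(a - fp k (y - x)) := (map_neg _ _).trans (congrArg Neg.neg hc)
          change fp k (y - x) - pc = a
          rw [hpc]
          abel
        · rintro ⟨⟨c, y⟩, hcy⟩
          change ((cone X Y f hf).d k (k + 1)).hom (c, y) = (a, b) at hcy
          rw [cone_d] at hcy
          have h3 : f k y - predD Y k c = a := congrArg Prod.fst hcy
          have h4 : (X.d k (k + 1)).hom y = b := congrArg Prod.snd hcy
          refine ⟨(gY.toFun k c, gX.toFun (k + 1) y), ⟨gY.mem _ _, gX.mem _ _⟩, ?_⟩
          refine Prod.ext ?_ ?_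
          · change G (gX.toFun (k + 1) y) - DY (gY.toFun k c) = gY.toFun (k + 1) a
            refine (congrArg₂ (· - ·) (hcompat k y) (gY.comm k c)).trans ?_
            exact (map_sub (gY.toFun (k + 1)) _ _).symm.trans (congrArg _ h3)
          · change DX (gX.toFun (k + 1) y) = gX.toFun (k + 2) b
            exact (gX.comm (k + 1) y).trans (congrArg (gX.toFun (k + 2)) h4))
    (by
      rintro ⟨u, v⟩ ⟨huv, hu, hv⟩
      have hu : u ∈ TY q := hu
      have hv : v ∈ TX (q + 1) := hv
      have h1 : G v - DY u = 0 := congrArg Prod.fst huv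
      have h2 : DX v = 0 := congrArg Prod.snd huv
      obtain ⟨b, hb, w, hw, hvw⟩ := gX.surj q v hv h2
      -- From `v = gX b + DX w` and `G v = DY u` one gets `gY (f b) = DY (u - G w)`, so `f b` is a
      -- coboundary already in `Y`.
      obtain ⟨a, ha⟩ := gY.inj q (f q b) (by
          refine (hf q b).symm.trans ?_
          have hb' : (X.d q (q + 1)).hom b = 0 := hb
          rw [hb', map_zero])
        (u - G w) (Submodule.sub_mem _ hu (hGT _ _ hw)) (by
          rw [map_sub, ← sub_eq_zero.1 h1, ← hG, ← hvw, ← map_sub, sub_sub_cancel, hcompat])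
      cases q with
      | zero =>
        have hu0 : u = 0 := by simpa [hY0] using hu
        have hw0 : w = 0 := by simpa [hX0] using hw
        refine ⟨(a, b), ?_, ?_⟩
        · rw [LinearMap.mem_ker]
          exact Prod.ext (sub_eq_zero.2 ha.symm) hb
        · have : (u, v) - g (a, b) = 0 := by
            refine Prod.ext ?_ ?_
            · change u - gY.toFun 0 a = 0
              rw [hu0, show a = 0 from Subsingleton.elim (α := PUnit) _ _, map_zero, sub_zero]
            · change v - gX.toFun 1 b = 0
              rw [hvw, hw0, map_zero]
          rw [this]
          exact Submodule.zero_mem _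
      | succ k =>
        -- The remaining error `u - G w - gY a` is a cocycle. Its class is represented by `a'`,
        -- which can be added to `a` without changing `d a = f b`.
        obtain ⟨a', ha', t, ht, hta⟩ := gY.surj k (u - G w - gY.toFun (k + 1) a)
          (Submodule.sub_mem _ (Submodule.sub_mem _ hu (hGT _ _ hw)) (gY.mem _ _)) (by
            rw [map_sub, gY.comm, ha, map_sub, ← sub_eq_zero.1 h1, ← hG, ← hvw, ← map_sub,
              sub_sub_cancel, hcompat, sub_self])
        refine ⟨(a + a', b), ?_, ⟨(-t, w), ⟨Submodule.neg_mem _ ht, hw⟩, ?_⟩⟩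
        · rw [LinearMap.mem_ker]
          refine Prod.ext ?_ hb
          change f (k + 1) b - predD Y (k + 1) (a + a') = 0
          rw [map_add, ha, ha', add_zero]
          exact sub_self _
        · refine Prod.ext ?_ hvw.symm
          change G w - DY (-t) = u - gY.toFun (k + 1) (a + a')
          rw [map_neg, ← hta, map_add]
          abel)
  exact ⟨e.trans e'⟩

end cone

end RelCone

/-! ### Total complexes of double complexes -/

namespace DoubleComplex

open RelCone

universe v w

variable {R : Type*} [CommRing R] {A : ℕ → ℕ → Type w} [∀ p q, AddCommGroup (A p q)]
  [∀ p q, Module R (A p q)]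
  (δ : ∀ p q, A p q →ₗ[R] A (p + 1) q) (d : ∀ p q, A p q →ₗ[R] A p (q + 1))

/-- The extension of `δ` to the product of all `A p q`. -/
def horD : (∀ p q, A p q) →ₗ[R] (∀ p q, A p q) where
  toFun x p q := match p with
    | 0 => 0
    | p + 1 => δ p q (x p q)
  map_add' x y := by
    funext p q
    cases p with
    | zero => exact (add_zero _).symm
    | succ p => exact map_add _ _ _
  map_smul' c x := by
    funext p q
    cases p with
    | zero => exact (smul_zero c).symm
    | succ p => exact map_smul _ _ _

/-- The extension of `d` to the product of all `A p q`. -/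
def verD : (∀ p q, A p q) →ₗ[R] (∀ p q, A p q) where
  toFun x p q := match q with
    | 0 => 0
    | q + 1 => d p q (x p q)
  map_add' x y := by
    funext p q
    cases q with
    | zero => exact (add_zero _).symm
    | succ p => exact map_add _ _ _
  map_smul' c x := by
    funext p q
    cases q with
    | zero => exact (smul_zero c).symm
    | succ p => exact map_smul _ _ _

/-- The total differential. -/
def totD : (∀ p q, A p q) →ₗ[R] (∀ p q, A p q) := horD δ + verD d

variable (R A) in
/-- The elements of total degree `m - 1`. -/
def totDeg (m : ℕ) : Submodule R (∀ p q, A p q) where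
  carrier := {x | ∀ p q, p + q + 1 ≠ m → x p q = 0}
  add_mem' {x y} hx hy p q h := by
    change x p q + y p q = 0
    rw [hx p q h, hy p q h, add_zero]
  zero_mem' _ _ _ := rfl
  smul_mem' c x hx p q h := by
    change c • x p q = 0
    rw [hx p q h, smul_zero]

theorem totDeg_zero : totDeg R A 0 = ⊥ := by
  rw [eq_bot_iff]
  intro x hx
  rw [Submodule.mem_bot]
  funext p q
  exact hx p q (by omega)

@[simp] theorem horD_zero (x : ∀ p q, A p q) (q : ℕ) : horD δ x 0 q = 0 := rfl

@[simp] theorem horD_succ (x : ∀ p q, A p q) (p q : ℕ) :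
    horD δ x (p + 1) q = δ p q (x p q) := rfl

@[simp] theorem verD_zero (x : ∀ p q, A p q) (p : ℕ) : verD d x p 0 = 0 := rfl

@[simp] theorem verD_succ (x : ∀ p q, A p q) (p q : ℕ) :
    verD d x p (q + 1) = d p q (x p q) := rfl

theorem totD_apply (x : ∀ p q, A p q) (p q : ℕ) : totD δ d x p q = horD δ x p q + verD d x p q :=
  rfl

theorem totD_mem {m : ℕ} {x : ∀ p q, A p q} (hx : x ∈ totDeg R A m) :
    totD δ d x ∈ totDeg R A (m + 1) := by
  intro p q h
  have h1 : horD δ x p q = 0 := by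
    cases p with
    | zero => rfl
    | succ p => rw [horD_succ, hx p q (by omega), map_zero]
  have h2 : verD d x p q = 0 := by
    cases q with
    | zero => rfl
    | succ q => rw [verD_succ, hx p q (by omega), map_zero]
  rw [totD_apply, h1, h2, add_zero]

variable {δ d}

theorem totD_totD (hδδ : ∀ p q x, δ (p + 1) q (δ p q x) = 0)
    (hdd : ∀ p q x, d p (q + 1) (d p q x) = 0)
    (hδd : ∀ p q x, δ p (q + 1) (d p q x) + d (p + 1) q (δ p q x) = 0) (x : ∀ p q, A p q) :
    totD δ d (totD δ d x) = 0 := by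
  have h1 : horD δ (horD δ x) = 0 := by
    funext p q
    rcases p with _ | _ | p
    · rfl
    · exact map_zero (δ 0 q)
    · exact hδδ _ _ _
  have h2 : verD d (verD d x) = 0 := by
    funext p q
    rcases q with _ | _ | q
    · rfl
    · exact map_zero (d p 0)
    · exact hdd _ _ _
  have h3 : horD δ (verD d x) + verD d (horD δ x) = 0 := by
    funext p q
    rcases p with _ | p <;> rcases q with _ | q
    · exact add_zero _
    · exact (zero_add _).trans (map_zero (d 0 q))
    · exact (add_zero _).trans (map_zero (δ p 0))
    · exact hδd _ _ _
  have : totD δ d (totD δ d x) = horD δ (horD δ x) + verD d (verD d x) +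
      (horD δ (verD d x) + verD d (horD δ x)) := by
    simp only [totD, LinearMap.add_apply, map_add]
    abel
  rw [this, h1, h2, h3, add_zero, add_zero]

/-- If the rows are exact, every element whose differential is concentrated in the first column
is cohomologous to an element of the first column. -/
theorem exists_sub_totD_eq_zero
    (hδδ : ∀ p q x, δ (p + 1) q (δ p q x) = 0)
    (hdd : ∀ p q x, d p (q + 1) (d p q x) = 0)
    (hδd : ∀ p q x, δ p (q + 1) (d p q x) + d (p + 1) q (δ p q x) = 0)
    (hex : ∀ p q x, δ (p + 1) q x = 0 → ∃ y, δ p q y = x) (m k : ℕ) (z : ∀ p q, A p q)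
    (hz : z ∈ totDeg R A (m + 1)) (hk : ∀ p q, k < p → z p q = 0)
    (hD : ∀ p q, totD δ d z (p + 1) q = 0) :
    ∃ w ∈ totDeg R A m, ∀ p q, (z - totD δ d w) (p + 1) q = 0 := by
  -- Staircase induction on a bound `k` for the columns met by `z`: each step clears the rightmost
  -- column.
  induction k generalizing z with
  | zero =>
    refine ⟨0, Submodule.zero_mem _, fun p q => ?_⟩
    rw [map_zero, sub_zero, hk _ _ (Nat.succ_pos p)]
  | succ k ih =>
    have h1 : ∀ q, δ (k + 1) q (z (k + 1) q) = 0 := by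
      intro q
      have h2 := hD (k + 1) q
      rw [totD_apply, horD_succ] at h2
      have h3 : verD d z (k + 2) q = 0 := by
        cases q with
        | zero => rfl
        | succ q => rw [verD_succ, hk _ _ (by omega), map_zero]
      rwa [h3, add_zero] at h2
    -- The preimage of zero is chosen to be zero, so that the resulting `w` stays in a single total
    -- degree.
    have h4 : ∀ q, ∃ y, δ k q y = z (k + 1) q ∧ (z (k + 1) q = 0 → y = 0) := by
      intro q
      by_cases h0 : z (k + 1) q = 0
      · exact ⟨0, by rw [h0, map_zero], fun _ => rfl⟩
      · obtain ⟨y, hy⟩ := hex k q _ (h1 q)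
        exact ⟨y, hy, fun h => absurd h h0⟩
    choose y hy hy0 using h4
    let w : ∀ p q, A p q := Pi.single (M := fun p => ∀ q, A p q) k y
    have hwk : w k = y := Pi.single_eq_same (M := fun p => ∀ q, A p q) k y
    have hwne : ∀ p, p ≠ k → w p = 0 := fun p hp =>
      Pi.single_eq_of_ne (M := fun p => ∀ q, A p q) hp y
    have hw : w ∈ totDeg R A m := by
      intro p q hpq
      by_cases hp : p = k
      · subst hp
        rw [hwk]
        exact hy0 q (hz _ _ (by omega))
      · rw [hwne p hp]
        rfl
    -- `w` sits in column `k`. Thus `δ w` cancels column `k + 1` of `z`, and `d w` changes only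
    -- column `k`.
    obtain ⟨w', hw', hww'⟩ := ih (z - totD δ d w)
      (Submodule.sub_mem _ hz (totD_mem δ d hw)) (by
        intro p q hp
        obtain ⟨p, rfl⟩ : ∃ p', p = p' + 1 := ⟨p - 1, by omega⟩
        change z (p + 1) q - totD δ d w (p + 1) q = 0
        have hv : verD d w (p + 1) q = 0 := by
          cases q with
          | zero => rfl
          | succ q => rw [verD_succ, hwne _ (by omega)]; exact map_zero _
        rw [totD_apply, horD_succ, hv, add_zero]
        by_cases hpk : p = k
        · subst hpk
          rw [hwk, hy, sub_self]
        · rw [hwne p hpk, hk _ _ (by omega), zero_sub, neg_eq_zero]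
          exact map_zero _) (by
        intro p q
        rw [map_sub, totD_totD hδδ hdd hδd, sub_zero]
        exact hD p q)
    refine ⟨w + w', Submodule.add_mem _ hw hw', fun p q => ?_⟩
    rw [map_add, ← sub_sub]
    exact hww' p q

/-- The inclusion of the first column, shifted by one. -/
def augmentation {X : CochainComplex (ModuleCat.{v} R) ℕ} (ε : ∀ q, X.X q →ₗ[R] A 0 q) :
    ∀ m, Pred X m →ₗ[R] (∀ p q, A p q)
  | 0 => 0
  | m + 1 => ((LinearMap.single R (fun p => ∀ q, A p q) 0).comp
      (LinearMap.single R (fun q => A 0 q) m)).comp (ε m)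

section augmentation

variable {X : CochainComplex (ModuleCat.{v} R) ℕ} (ε : ∀ q, X.X q →ₗ[R] A 0 q)

theorem augmentation_same (m : ℕ) (x : Pred X (m + 1)) : augmentation ε (m + 1) x 0 m = ε m x := by
  change Pi.single (M := fun p => ∀ q, A p q) 0 (Pi.single m (ε m x)) 0 m = _
  rw [Pi.single_eq_same, Pi.single_eq_same]

theorem augmentation_of_ne (m : ℕ) (x : Pred X (m + 1)) {q : ℕ} (h : q ≠ m) :
    augmentation ε (m + 1) x 0 q = 0 := by
  change Pi.single (M := fun p => ∀ q, A p q) 0 (Pi.single m (ε m x)) 0 q = _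
  rw [Pi.single_eq_same, Pi.single_eq_of_ne h]

theorem augmentation_succ (m : ℕ) (x : Pred X (m + 1)) (p q : ℕ) :
    augmentation ε (m + 1) x (p + 1) q = 0 := by
  change Pi.single (M := fun p => ∀ q, A p q) 0 (Pi.single m (ε m x)) (p + 1) q = _
  rw [Pi.single_eq_of_ne (Nat.succ_ne_zero p)]
  rfl

theorem augmentation_unique (m : ℕ) (x : Pred X (m + 1)) (z : ∀ p q, A p q)
    (hz : z ∈ totDeg R A (m + 1))
    (h0 : z 0 m = ε m x) (h1 : ∀ p q, z (p + 1) q = 0) : z = augmentation ε (m + 1) x := by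
  funext p q
  rcases p with _ | p
  · by_cases h : q = m
    · subst h
      rw [h0, augmentation_same]
    · rw [augmentation_of_ne ε m x h, hz _ _ (by omega)]
  · rw [h1, augmentation_succ]

theorem augmentation_mem (m : ℕ) (x : Pred X m) : augmentation ε m x ∈ totDeg R A m := by
  cases m with
  | zero => exact Submodule.zero_mem _
  | succ m =>
    intro p q h
    rcases p with _ | p
    · exact augmentation_of_ne ε m x (by omega)
    · exact augmentation_succ ε m x p q

/-- If the rows of a double complex, augmented by `ε`, are exact, then `ε` is a quasi-isomorphism
to the total complex. -/
def augmentationQuasiIso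
    (hδδ : ∀ p q x, δ (p + 1) q (δ p q x) = 0)
    (hdd : ∀ p q x, d p (q + 1) (d p q x) = 0)
    (hδd : ∀ p q x, δ p (q + 1) (d p q x) + d (p + 1) q (δ p q x) = 0)
    (hex : ∀ p q x, δ (p + 1) q x = 0 → ∃ y, δ p q y = x)
    (hεd : ∀ q x, ε (q + 1) ((X.d q (q + 1)).hom x) = d 0 q (ε q x))
    (hδε : ∀ q x, δ 0 q (ε q x) = 0) (hε : ∀ q, Function.Injective (ε q))
    (hex0 : ∀ q x, δ 0 q x = 0 → ∃ b, ε q b = x) :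
    QuasiIsoTo X (totD δ d) (totDeg R A) where
  toFun := augmentation ε
  mem := augmentation_mem ε
  comm := by
    intro m x
    cases m with
    | zero =>
      refine (map_zero _).trans (Eq.symm ?_)
      exact map_zero _
    | succ m =>
      refine augmentation_unique ε (m + 1) ((X.d m (m + 1)).hom x) _
        (totD_mem δ d (augmentation_mem ε _ _)) ?_ ?_
      · rw [totD_apply, horD_zero, verD_succ, zero_add, augmentation_same]
        exact (hεd m x).symm
      · intro p q
        rw [totD_apply, horD_succ]
        have h1 : verD d (augmentation ε (m + 1) x) (p + 1) q = 0 := by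
          cases q with
          | zero => rfl
          | succ q => rw [verD_succ, augmentation_succ, map_zero]
        rw [h1, add_zero]
        rcases p with _ | p
        · by_cases h : q = m
          · subst h
            rw [augmentation_same]
            exact hδε _ _
          · rw [augmentation_of_ne ε m x h, map_zero]
        · rw [augmentation_succ, map_zero]
  inj := by
    intro m x hx w hw hDw
    cases m with
    | zero =>
      rw [totDeg_zero, Submodule.mem_bot] at hw
      rw [hw, map_zero] at hDw
      have h1 : ε 0 x = 0 := by
        rw [← augmentation_same ε 0 x, ← hDw]
        rfl
      refine ⟨0, ?_⟩
      have h2 : x = (0 : X.X 0) := hε 0 (h1.trans (map_zero _).symm)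
      rw [h2]
      exact map_zero _
    | succ m =>
      -- The primitive is moved into column `0` without changing its differential. Its only possible
      -- nonzero entry there is `δ`-closed, hence equal to some `ε b`; injectivity of `ε` turns `d
      -- (ε b) = ε x` into `d b = x`.
      obtain ⟨w', hw', hww'⟩ := exists_sub_totD_eq_zero hδδ hdd hδd hex m (m + 1) w hw
        (fun p q hp => hw p q (by omega)) (by
          intro p q
          rw [hDw]
          exact augmentation_succ ε (m + 1) x p q)
      set u := w - totD δ d w' with hu
      have hDu : totD δ d u = augmentation ε (m + 2) x := by
        rw [hu, map_sub, totD_totD hδδ hdd hδd, sub_zero, hDw]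
      have h1 : δ 0 m (u 0 m) = 0 := by
        have h2 : totD δ d u 1 m = 0 := by
          rw [hDu]
          exact augmentation_succ ε (m + 1) x 0 m
        rw [totD_apply, horD_succ] at h2
        have h3 : verD d u 1 m = 0 := by
          cases m with
          | zero => rfl
          | succ m => rw [verD_succ, hww', map_zero]
        rwa [h3, add_zero] at h2
      obtain ⟨b, hb⟩ := hex0 m _ h1
      refine ⟨b, hε (m + 1) ?_⟩
      refine (hεd m b).trans ?_
      rw [hb]
      have h4 : totD δ d u 0 (m + 1) = ε (m + 1) x := by
        rw [hDu]
        exact augmentation_same ε (m + 1) x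
      rwa [totD_apply, horD_zero, verD_succ, zero_add] at h4
  surj := by
    intro m z hz hDz
    -- Here the cocycle itself is moved into column `0`. Its entry is `δ`-closed and `d`-closed, so
    -- it comes from a cocycle `b` of `X`.
    obtain ⟨w, hw, hzw⟩ := exists_sub_totD_eq_zero hδδ hdd hδd hex m (m + 1) z hz
        (fun p q hp => hz p q (by omega)) (by
          intro p q
          rw [hDz]
          rfl)
    set u := z - totD δ d w with hu
    have hu' : u ∈ totDeg R A (m + 1) := Submodule.sub_mem _ hz (totD_mem δ d hw)
    have hDu : totD δ d u = 0 := by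
      rw [hu, map_sub, totD_totD hδδ hdd hδd, sub_zero, hDz]
    have h1 : δ 0 m (u 0 m) = 0 := by
      have h2 : totD δ d u 1 m = 0 := by
        rw [hDu]
        rfl
      rw [totD_apply, horD_succ] at h2
      have h3 : verD d u 1 m = 0 := by
        cases m with
        | zero => rfl
        | succ m => rw [verD_succ, hzw, map_zero]
      rwa [h3, add_zero] at h2
    obtain ⟨b, hb⟩ := hex0 m _ h1
    refine ⟨b, hε (m + 1) ?_, w, hw, ?_⟩
    · rw [map_zero]
      refine (hεd m b).trans ?_
      have h4 : totD δ d u 0 (m + 1) = 0 := by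
        rw [hDu]
        rfl
      rwa [totD_apply, horD_zero, verD_succ, zero_add, ← hb] at h4
    · rw [← augmentation_unique ε m b u hu' hb.symm hzw, hu, sub_sub_cancel]

end augmentation

/-! ### Exchange of rows and columns. -/

section swap

variable (R A) in
/-- Exchanging the two directions of a double complex. -/
def swap : (∀ q p, A p q) ≃ₗ[R] (∀ p q, A p q) where
  toFun x p q := x q p
  invFun x q p := x p q
  map_add' _ _ := rfl
  map_smul' _ _ := rfl

/-- Any sign is part of `d`, so the total differential is a plain sum of the two differentials and
is symmetric in them. -/
theorem swap_totD (x : ∀ q p, A p q) :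
    swap R A (totD (A := fun q p => A p q) (fun q p => d p q) (fun q p => δ p q) x) =
      totD δ d (swap R A x) := by
  funext p q
  change horD (A := fun q p => A p q) (fun q p => d p q) x q p +
    verD (A := fun q p => A p q) (fun q p => δ p q) x q p = totD δ d (swap R A x) p q
  rw [totD_apply, add_comm]
  congr 1

theorem swap_mem {m : ℕ} {x : ∀ q p, A p q} :
    swap R A x ∈ totDeg R A m ↔ x ∈ totDeg R (fun q p => A p q) m := by
  constructor
  · intro h q p hqp
    exact h p q (by omega)
  · intro h p q hpq
    exact h q p (by omega)

/-- A quasi-isomorphism to the total complex of the double complex with exchanged directions. -/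
def ofSwap {X : CochainComplex (ModuleCat.{v} R) ℕ}
    (g : QuasiIsoTo X (totD (A := fun q p => A p q) (fun q p => d p q) (fun q p => δ p q))
      (totDeg R (fun q p => A p q))) :
    QuasiIsoTo X (totD δ d) (totDeg R A) where
  toFun m := (swap R A).toLinearMap.comp (g.toFun m)
  mem m x := swap_mem.2 (g.mem m x)
  comm m x := by
    change totD δ d (swap R A (g.toFun m x)) = swap R A _
    rw [← swap_totD, g.comm]
    rfl
  inj m x hx w hw h := by
    refine g.inj m x hx ((swap R A).symm w) ?_ ?_
    · rw [← swap_mem, LinearEquiv.apply_symm_apply]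
      exact hw
    · apply (swap R A).injective
      rw [swap_totD, LinearEquiv.apply_symm_apply, h]
      rfl
  surj m z hz h := by
    obtain ⟨x, hx, w, hw, hxw⟩ := g.surj m ((swap R A).symm z)
      (by
        rw [← swap_mem, LinearEquiv.apply_symm_apply]
        exact hz)
      (by
        apply (swap R A).injective
        rw [swap_totD, LinearEquiv.apply_symm_apply, h, map_zero])
    refine ⟨x, hx, swap R A w, swap_mem.2 hw, ?_⟩
    rw [← swap_totD, ← hxw, map_sub, LinearEquiv.apply_symm_apply]
    rfl

end swap

end DoubleComplex

/-! ### Forms that are smooth near a point -/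

namespace Forms

variable {E : Type*} [NormedAddCommGroup E] [NormedSpace ℝ E]
  {M : Type*} [TopologicalSpace M] [ChartedSpace E M]
  {F : Type*} [NormedAddCommGroup F] [NormedSpace ℝ F]
  {N : Type*} [TopologicalSpace N] [ChartedSpace F N]

/-- The expression of `θ` in the preferred chart at `x` is smooth at `x`. -/
def SmoothFormAt {n : ℕ} (θ : FormField E M n) (x : M) : Prop :=
  ContDiffAt ℝ ∞ (inChart θ (chartAt E x)) (chartAt E x x)

theorem inChart_eventuallyEq {n : ℕ} {θ η : FormField E M n} {x : M} (h : ∀ᶠ z in 𝓝 x, θ z = η z)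
    {e : OpenPartialHomeomorph M E} (hx : x ∈ e.source) :
    inChart θ e =ᶠ[𝓝 (e x)] inChart η e := by
  have h1 := e.tendsto_symm hx
  filter_upwards [h1.eventually h] with y hy
  simp only [inChart, hy]

theorem SmoothFormAt.congr {n : ℕ} {θ η : FormField E M n} {x : M} (hθ : SmoothFormAt θ x)
    (h : ∀ᶠ z in 𝓝 x, η z = θ z) : SmoothFormAt η x :=
  ContDiffAt.congr_of_eventuallyEq hθ (inChart_eventuallyEq h (mem_chart_source E x))

theorem extD_congr {n : ℕ} {θ η : FormField E M n} {x : M} (h : ∀ᶠ z in 𝓝 x, θ z = η z) :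
    extD θ x = extD η x := by
  simp only [extD, (inChart_eventuallyEq h (mem_chart_source E x)).extDeriv_eq]

theorem SmoothFormAt.add {n : ℕ} {θ η : FormField E M n} {x : M} (hθ : SmoothFormAt θ x)
    (hη : SmoothFormAt η x) : SmoothFormAt (θ + η) x :=
  ContDiffAt.add hθ hη

theorem SmoothFormAt.const_smul {n : ℕ} {θ : FormField E M n} {x : M} (hθ : SmoothFormAt θ x)
    (c : ℝ) : SmoothFormAt (c • θ) x :=
  ContDiffAt.const_smul c hθ

theorem smoothFormAt_zero {n : ℕ} (x : M) : SmoothFormAt (0 : FormField E M n) x :=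
  contDiffAt_const (c := 0)

theorem SmoothFormAt.sum {n : ℕ} {ι : Type*} {s : Finset ι} {θ : ι → FormField E M n} {x : M}
    (h : ∀ i ∈ s, SmoothFormAt (θ i) x) : SmoothFormAt (∑ i ∈ s, θ i) x := by
  classical
  induction s using Finset.induction_on with
  | empty => exact smoothFormAt_zero x
  | insert i s hi ih =>
    rw [Finset.sum_insert hi]
    exact (h i (Finset.mem_insert_self i s)).add
      (ih fun j hj => h j (Finset.mem_insert_of_mem hj))

variable [IsManifold 𝓘(ℝ, E) ∞ M] [IsManifold 𝓘(ℝ, F) ∞ N]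

/-- Two chart expressions differ by the pull-back along the smooth transition map, so smoothness at
a point does not depend on the chart. -/
theorem contDiffAt_inChart_of_chart {n : ℕ} {θ : FormField E M n}
    {e : OpenPartialHomeomorph M E} (he : e ∈ atlas E M)
    {e' : OpenPartialHomeomorph M E} (he' : e' ∈ atlas E M) {y : E}
    (hy : y ∈ e.target) (hy' : e.symm y ∈ e'.source)
    (h : ContDiffAt ℝ ∞ (inChart θ e') (e' (e.symm y))) : ContDiffAt ℝ ∞ (inChart θ e) y := by
  have hτ := contDiffAt_inCharts (φ := fun x : M => x) contMDiff_id he he' hy hy'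
  refine (contDiffAt_compContinuousLinearMap (h.comp y hτ)
    (hτ.fderiv_right (m := ∞) le_rfl)).congr_of_eventuallyEq ?_
  filter_upwards [eventually_inCharts (φ := fun x : M => x) continuous_id hy hy'] with z hz
  exact inChart_change θ he he' hz.1 hz.2

theorem SmoothFormAt.contDiffAt {n : ℕ} {θ : FormField E M n}
    {e : OpenPartialHomeomorph M E} (he : e ∈ atlas E M) {y : E} (hy : y ∈ e.target)
    (h : SmoothFormAt θ (e.symm y)) : ContDiffAt ℝ ∞ (inChart θ e) y :=
  contDiffAt_inChart_of_chart he (chart_mem_atlas E _) hy (mem_chart_source E _) h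

theorem mem_smoothForms_iff {n : ℕ} {θ : FormField E M n} :
    θ ∈ smoothForms E M n ↔ ∀ x, SmoothFormAt θ x := by
  constructor
  · intro h x
    exact (h _ (chart_mem_atlas E x)).contDiffAt
      ((chartAt E x).open_target.mem_nhds ((chartAt E x).map_source (mem_chart_source E x)))
  · intro h e he y hy
    exact ((h (e.symm y)).contDiffAt he hy).contDiffWithinAt

/-- Pointwise version of `inChart_extD`, needed for forms that are smooth only on an open subset.
The exterior derivative commutes with pull-back along the transition map to the preferred chart. -/
theorem inChart_extD_of_smoothFormAt {n : ℕ} {θ : FormField E M n}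
    {e : OpenPartialHomeomorph M E} (he : e ∈ atlas E M) {y : E} (hy : y ∈ e.target)
    (hθ : SmoothFormAt θ (e.symm y)) :
    inChart (extD θ) e y = extDeriv (inChart θ e) y := by
  have he' := chart_mem_atlas E (e.symm y)
  have hy' := mem_chart_source E (e.symm y)
  have h1 : ContDiffAt ℝ ∞ (inChart θ (chartAt E (e.symm y))) (chartAt E (e.symm y) (e.symm y)) :=
    hθ
  set e' := chartAt E (e.symm y) with he'_def
  have hτ := contDiffAt_inCharts (φ := fun x : M => x) contMDiff_id he he' hy hy'
  have h2 : extDeriv (inChart θ e) y =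
      (extDeriv (inChart θ e') (e' (e.symm y))).compContinuousLinearMap
        (fderiv ℝ (fun z => e' (e.symm z)) y) := by
    rw [← extDeriv_pullback (f := fun z => e' (e.symm z)) (h1.differentiableAt (by simp)) hτ
      minSmoothness_two_le]
    refine Filter.EventuallyEq.extDeriv_eq ?_
    filter_upwards [eventually_inCharts (φ := fun x : M => x) continuous_id hy hy'] with z hz
    exact inChart_change θ he he' hz.1 hz.2
  rw [h2]
  have h3 : MDifferentiableAt 𝓘(ℝ, E) 𝓘(ℝ, E) e.symm y :=
    ((contMDiffOn_symm_of_mem_maximalAtlas (IsManifold.subset_maximalAtlas (n := ∞) he)).contMDiffAt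
      (e.open_target.mem_nhds hy)).mdifferentiableAt (n := ∞) (by simp)
  have h4 : MDifferentiableAt 𝓘(ℝ, E) 𝓘(ℝ, E) e' (e.symm y) :=
    ((contMDiffOn_of_mem_maximalAtlas (IsManifold.subset_maximalAtlas (n := ∞) he')).contMDiffAt
      (e'.open_source.mem_nhds hy')).mdifferentiableAt (n := ∞) (by simp)
  have key : fderiv ℝ (fun z => e' (e.symm z)) y =
      (mfderiv 𝓘(ℝ, E) 𝓘(ℝ, E) e' (e.symm y)).comp (mfderiv 𝓘(ℝ, E) 𝓘(ℝ, E) e.symm y) := by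
    rw [← mfderiv_eq_fderiv]
    exact mfderiv_comp y h4 h3
  rw [key]
  rfl

theorem inChart_extD_eventuallyEq {n : ℕ} {θ : FormField E M n} {x : M}
    (hθ : ∀ᶠ z in 𝓝 x, SmoothFormAt θ z)
    {e : OpenPartialHomeomorph M E} (he : e ∈ atlas E M) (hx : x ∈ e.source) :
    inChart (extD θ) e =ᶠ[𝓝 (e x)] extDeriv (inChart θ e) := by
  filter_upwards [(e.tendsto_symm hx).eventually hθ,
    e.open_target.mem_nhds (e.map_source hx)] with y hy hy'
  exact inChart_extD_of_smoothFormAt he hy' hy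

/-- Smoothness is required near `x`: the chart expression of `extD θ` has to be identified with
`extDeriv` on a whole neighbourhood. -/
theorem SmoothFormAt.extD {n : ℕ} {θ : FormField E M n} {x : M}
    (hθ : ∀ᶠ z in 𝓝 x, SmoothFormAt θ z) : SmoothFormAt (extD θ) x :=
  (contDiffAt_extDeriv hθ.self_of_nhds).congr_of_eventuallyEq
    (inChart_extD_eventuallyEq hθ (chart_mem_atlas E x) (mem_chart_source E x))

/-- The value of a form at a point is determined by its expression in a chart. -/
theorem eq_of_inChart_eq {n : ℕ} {θ η : FormField E M n} {x : M}
    {e : OpenPartialHomeomorph M E} (he : e ∈ atlas E M) (hx : x ∈ e.source)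
    (h1 : inChart θ e (e x) = inChart η e (e x)) : θ x = η x := by
  have h3 : MDifferentiableAt 𝓘(ℝ, E) 𝓘(ℝ, E) e.symm (e x) :=
    ((contMDiffOn_symm_of_mem_maximalAtlas (IsManifold.subset_maximalAtlas (n := ∞) he)).contMDiffAt
      (e.open_target.mem_nhds (e.map_source hx))).mdifferentiableAt (n := ∞) (by simp)
  have h4 : MDifferentiableAt 𝓘(ℝ, E) 𝓘(ℝ, E) e x :=
    ((contMDiffOn_of_mem_maximalAtlas (IsManifold.subset_maximalAtlas (n := ∞) he)).contMDiffAt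
      (e.open_source.mem_nhds hx)).mdifferentiableAt (n := ∞) (by simp)
  have key : (mfderiv 𝓘(ℝ, E) 𝓘(ℝ, E) e.symm (e x)).comp (mfderiv 𝓘(ℝ, E) 𝓘(ℝ, E) e x) =
      ContinuousLinearMap.id ℝ E := by
    have h5 : mfderiv 𝓘(ℝ, E) 𝓘(ℝ, E) (e.symm ∘ e) x = ContinuousLinearMap.id ℝ E := by
      refine Eq.trans (Filter.EventuallyEq.mfderiv_eq (f := fun z : M => z) ?_) mfderiv_id
      filter_upwards [e.open_source.mem_nhds hx] with z hz
      exact e.left_inv hz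
    rw [← h5]
    exact (mfderiv_comp x h3 h4).symm
  have h6 : ∀ (ζ : FormField E M n) (p q : M) (h : p = q) (v : Fin n → E),
      (ζ p : E [⋀^Fin n]→L[ℝ] ℝ) v = ζ q v := by
    rintro ζ p _ rfl v
    rfl
  have h7 : ∀ (ζ : FormField E M n) (v : Fin n → E), (ζ x : E [⋀^Fin n]→L[ℝ] ℝ) v =
      inChart ζ e (e x) (fun i => (mfderiv 𝓘(ℝ, E) 𝓘(ℝ, E) e x : E →L[ℝ] E) (v i)) := by
    intro ζ v
    refine Eq.trans ?_ (h6 ζ _ _ (e.left_inv hx).symm _)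
    exact congrArg (ζ x : E [⋀^Fin n]→L[ℝ] ℝ)
      (funext fun i => (congrArg (fun L : E →L[ℝ] E => L (v i)) key).symm)
  ext v
  exact (h7 θ v).trans ((congrArg (fun L : E [⋀^Fin n]→L[ℝ] ℝ => L _) h1).trans (h7 η v).symm)

theorem extD_extD_of_smoothFormAt {n : ℕ} {θ : FormField E M n} {x : M}
    (hθ : ∀ᶠ z in 𝓝 x, SmoothFormAt θ z) : extD (extD θ) x = 0 := by
  have he := chart_mem_atlas E x
  have hx := mem_chart_source E x
  have hs : SmoothFormAt (Forms.extD θ) ((chartAt E x).symm (chartAt E x x)) := by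
    rw [(chartAt E x).left_inv hx]
    exact SmoothFormAt.extD hθ
  refine eq_of_inChart_eq (η := (0 : FormField E M (n + 2))) he hx ?_
  rw [inChart_extD_of_smoothFormAt he ((chartAt E x).map_source hx) hs,
    (inChart_extD_eventuallyEq hθ he hx).extDeriv_eq, extDeriv_extDeriv_apply
    hθ.self_of_nhds minSmoothness_two_le]
  rfl

omit [IsManifold 𝓘(ℝ, E) ∞ M] in
theorem extD_add_of_smoothFormAt {n : ℕ} {θ η : FormField E M n} {x : M}
    (hθ : SmoothFormAt θ x) (hη : SmoothFormAt η x) : extD (θ + η) x = extD θ x + extD η x := by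
  have h1 := ContDiffAt.differentiableAt hθ (by simp)
  have h2 := ContDiffAt.differentiableAt hη (by simp)
  simp only [Forms.extD, inChart_add, extDeriv_add h1 h2]
  rfl

omit [IsManifold 𝓘(ℝ, E) ∞ M] in
theorem extD_const_smul {n : ℕ} (c : ℝ) (θ : FormField E M n) (x : M) :
    extD (c • θ) x = c • extD θ x := by
  simp only [Forms.extD, inChart_smul, extDeriv_smul]
  rfl

omit [IsManifold 𝓘(ℝ, E) ∞ M] in
theorem extD_zero {n : ℕ} (x : M) : extD (0 : FormField E M n) x = 0 := by
  have := extD_const_smul (0 : ℝ) (0 : FormField E M n) x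
  rwa [zero_smul, zero_smul] at this

omit [IsManifold 𝓘(ℝ, E) ∞ M] in
theorem extD_sum_of_smoothFormAt {n : ℕ} {ι : Type*} {s : Finset ι} {θ : ι → FormField E M n}
    {x : M} (h : ∀ i ∈ s, SmoothFormAt (θ i) x) :
    extD (∑ i ∈ s, θ i) x = ∑ i ∈ s, extD (θ i) x := by
  classical
  induction s using Finset.induction_on with
  | empty => exact extD_zero x
  | insert i s hi ih =>
    rw [Finset.sum_insert hi, Finset.sum_insert hi, extD_add_of_smoothFormAt
      (h i (Finset.mem_insert_self i s))
      (SmoothFormAt.sum fun j hj => h j (Finset.mem_insert_of_mem hj)),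
      ih fun j hj => h j (Finset.mem_insert_of_mem hj)]

/-! ### Local properties of the pull-back -/

section pull

variable {φ : M → N}

theorem contDiffAt_inCharts_of_contMDiffAt
    {e : OpenPartialHomeomorph M E} (he : e ∈ atlas E M)
    {e' : OpenPartialHomeomorph N F} (he' : e' ∈ atlas F N) {y : E}
    (hy : y ∈ e.target) (hy' : φ (e.symm y) ∈ e'.source)
    (hφ : ContMDiffAt 𝓘(ℝ, E) 𝓘(ℝ, F) ∞ φ (e.symm y)) :
    ContDiffAt ℝ ∞ (fun z => e' (φ (e.symm z))) y := by
  have h1 : ContMDiffAt 𝓘(ℝ, E) 𝓘(ℝ, E) ∞ e.symm y :=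
    (contMDiffOn_symm_of_mem_maximalAtlas (IsManifold.subset_maximalAtlas (n := ∞) he)).contMDiffAt
      (e.open_target.mem_nhds hy)
  have h2 : ContMDiffAt 𝓘(ℝ, F) 𝓘(ℝ, F) ∞ e' (φ (e.symm y)) :=
    (contMDiffOn_of_mem_maximalAtlas (IsManifold.subset_maximalAtlas he')).contMDiffAt
      (e'.open_source.mem_nhds hy')
  exact (ContMDiffAt.comp y h2 (ContMDiffAt.comp y hφ h1)).contDiffAt

theorem inChart_pull_of_contMDiffAt {n : ℕ} (θ : FormField F N n)
    {e : OpenPartialHomeomorph M E} (he : e ∈ atlas E M)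
    {e' : OpenPartialHomeomorph N F} (he' : e' ∈ atlas F N) {y : E}
    (hy : y ∈ e.target) (hy' : φ (e.symm y) ∈ e'.source)
    (hφ : ContMDiffAt 𝓘(ℝ, E) 𝓘(ℝ, F) ∞ φ (e.symm y)) :
    inChart (pull φ θ) e y = (inChart θ e' (e' (φ (e.symm y)))).compContinuousLinearMap
      (fderiv ℝ (fun z => e' (φ (e.symm z))) y) := by
  have h1 : MDifferentiableAt 𝓘(ℝ, E) 𝓘(ℝ, E) e.symm y :=
    ((contMDiffOn_symm_of_mem_maximalAtlas (IsManifold.subset_maximalAtlas (n := ∞) he)).contMDiffAt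
      (e.open_target.mem_nhds hy)).mdifferentiableAt (n := ∞) (by simp)
  have h2 : MDifferentiableAt 𝓘(ℝ, F) 𝓘(ℝ, F) e'.symm (e' (φ (e.symm y))) :=
    ((contMDiffOn_symm_of_mem_maximalAtlas
      (IsManifold.subset_maximalAtlas (n := ∞) he')).contMDiffAt
      (e'.open_target.mem_nhds (e'.map_source hy'))).mdifferentiableAt (n := ∞) (by simp)
  have h3 := (contDiffAt_inCharts_of_contMDiffAt he he' hy hy' hφ).contMDiffAt.mdifferentiableAt
    (n := ∞) (by simp)
  have h4 : MDifferentiableAt 𝓘(ℝ, E) 𝓘(ℝ, F) φ (e.symm y) :=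
    hφ.mdifferentiableAt (n := ∞) (by simp)
  have key : (mfderiv 𝓘(ℝ, E) 𝓘(ℝ, F) φ (e.symm y)).comp
      (mfderiv 𝓘(ℝ, E) 𝓘(ℝ, E) e.symm y) =
      (mfderiv 𝓘(ℝ, F) 𝓘(ℝ, F) e'.symm (e' (φ (e.symm y)))).comp
        (mfderiv 𝓘(ℝ, E) 𝓘(ℝ, F) (fun z => e' (φ (e.symm z))) y) := by
    refine (mfderiv_comp y h4 h1).symm.trans (Eq.trans ?_ (mfderiv_comp y h2 h3))
    refine Filter.EventuallyEq.mfderiv_eq ?_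
    have h5 : ContinuousAt (fun z => φ (e.symm z)) y :=
      ContinuousAt.comp (g := φ) hφ.continuousAt (e.continuousAt_symm hy)
    filter_upwards [h5.eventually_mem (e'.open_source.mem_nhds hy')] with z hz
    exact (e'.left_inv hz).symm
  have h5 : ∀ (p q : N) (h : p = q) (v : Fin n → F), (θ p : F [⋀^Fin n]→L[ℝ] ℝ) v = θ q v := by
    rintro p _ rfl v
    rfl
  rw [← mfderiv_eq_fderiv]
  ext v
  refine Eq.trans ?_ (h5 _ _ (e'.left_inv hy').symm _)
  exact congrArg (θ (φ (e.symm y)) : F [⋀^Fin n]→L[ℝ] ℝ)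
    (funext fun i => congrArg (fun L : E →L[ℝ] F => L (v i)) key)

theorem inChart_pull_eventuallyEq {n : ℕ} (θ : FormField F N n) {x : M}
    (hφ : ∀ᶠ z in 𝓝 x, ContMDiffAt 𝓘(ℝ, E) 𝓘(ℝ, F) ∞ φ z)
    {e : OpenPartialHomeomorph M E} (he : e ∈ atlas E M)
    {e' : OpenPartialHomeomorph N F} (he' : e' ∈ atlas F N)
    (hx : x ∈ e.source) (hx' : φ x ∈ e'.source) :
    inChart (pull φ θ) e =ᶠ[𝓝 (e x)] fun y =>
      (inChart θ e' (e' (φ (e.symm y)))).compContinuousLinearMap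
        (fderiv ℝ (fun z => e' (φ (e.symm z))) y) := by
  have h1 : ∀ᶠ z in 𝓝 x, φ z ∈ e'.source :=
    hφ.self_of_nhds.continuousAt.eventually_mem (e'.open_source.mem_nhds hx')
  filter_upwards [(e.tendsto_symm hx).eventually (hφ.and h1),
    e.open_target.mem_nhds (e.map_source hx)] with y hy hy'
  exact inChart_pull_of_contMDiffAt θ he he' hy' hy.2 hy.1

theorem SmoothFormAt.pull {n : ℕ} {θ : FormField F N n} {x : M}
    (hφ : ∀ᶠ z in 𝓝 x, ContMDiffAt 𝓘(ℝ, E) 𝓘(ℝ, F) ∞ φ z) (hθ : SmoothFormAt θ (φ x)) :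
    SmoothFormAt (pull φ θ : FormField E M n) x := by
  have he := chart_mem_atlas E x
  have hx := mem_chart_source E x
  have he' := chart_mem_atlas F (φ x)
  have hx' := mem_chart_source F (φ x)
  have hs := (chartAt E x).left_inv hx
  have hτ := contDiffAt_inCharts_of_contMDiffAt (φ := φ) he he' ((chartAt E x).map_source hx)
    (by rwa [hs]) (by rw [hs]; exact hφ.self_of_nhds)
  refine (contDiffAt_compContinuousLinearMap (ContDiffAt.comp (g := inChart θ (chartAt F (φ x)))
    _ ?_ hτ) (hτ.fderiv_right (m := ∞) le_rfl)).congr_of_eventuallyEq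
      (inChart_pull_eventuallyEq θ hφ he he' hx hx')
  rw [hs]
  exact hθ

/-- In charts this is the naturality of `extDeriv` on vector spaces, `extDeriv_pullback`, applied to
the chart expression of `φ`. -/
theorem pull_extD_of_contMDiffAt {n : ℕ} {θ : FormField F N n} {x : M}
    (hφ : ∀ᶠ z in 𝓝 x, ContMDiffAt 𝓘(ℝ, E) 𝓘(ℝ, F) ∞ φ z) (hθ : SmoothFormAt θ (φ x)) :
    (pull φ (extD θ) : FormField E M (n + 1)) x = extD (pull φ θ : FormField E M n) x := by
  have he := chart_mem_atlas E x
  have hx := mem_chart_source E x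
  have he' := chart_mem_atlas F (φ x)
  have hx' := mem_chart_source F (φ x)
  have hs := (chartAt E x).left_inv hx
  have hs' := (chartAt F (φ x)).left_inv hx'
  have hy := (chartAt E x).map_source hx
  have hy' : φ ((chartAt E x).symm (chartAt E x x)) ∈ (chartAt F (φ x)).source := by rwa [hs]
  have hφ' : ContMDiffAt 𝓘(ℝ, E) 𝓘(ℝ, F) ∞ φ ((chartAt E x).symm (chartAt E x x)) := by
    rw [hs]; exact hφ.self_of_nhds
  have hτ := contDiffAt_inCharts_of_contMDiffAt (φ := φ) he he' hy hy' hφ'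
  have h1 : ContDiffAt ℝ ∞ (inChart θ (chartAt F (φ x)))
      (chartAt F (φ x) (φ ((chartAt E x).symm (chartAt E x x)))) := by
    rw [hs]
    exact hθ
  have hp : SmoothFormAt (Forms.pull φ θ : FormField E M n)
      ((chartAt E x).symm (chartAt E x x)) := by
    rw [hs]
    exact SmoothFormAt.pull hφ hθ
  refine eq_of_inChart_eq he hx ?_
  rw [inChart_extD_of_smoothFormAt he hy hp,
    inChart_pull_of_contMDiffAt _ he he' hy hy' hφ',
    inChart_extD_of_smoothFormAt he' ((chartAt F (φ x)).map_source hy') (by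
      rw [hs, hs']
      exact hθ),
    ← extDeriv_pullback (f := fun z => chartAt F (φ x) (φ ((chartAt E x).symm z)))
      (h1.differentiableAt (by simp)) hτ minSmoothness_two_le]
  exact (inChart_pull_eventuallyEq θ hφ he he' hx hx').extDeriv_eq.symm

end pull

/-! ### Products with functions -/

/-- The product of a form with a function. -/
def mulForm {n : ℕ} (ρ : M → ℝ) (θ : FormField E M n) : FormField E M n := fun x => ρ x • θ x

theorem SmoothFormAt.mulForm {n : ℕ} {ρ : M → ℝ} {θ : FormField E M n} {x : M}
    (hρ : ContMDiffAt 𝓘(ℝ, E) 𝓘(ℝ, ℝ) ∞ ρ x) (hθ : SmoothFormAt θ x) :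
    SmoothFormAt (mulForm ρ θ) x := by
  have hx := mem_chart_source E x
  have h1 : ContMDiffAt 𝓘(ℝ, E) 𝓘(ℝ, E) ∞ (chartAt E x).symm (chartAt E x x) :=
    (contMDiffOn_symm_of_mem_maximalAtlas
      (IsManifold.subset_maximalAtlas (n := ∞) (chart_mem_atlas E x))).contMDiffAt
      ((chartAt E x).open_target.mem_nhds ((chartAt E x).map_source hx))
  have h2 : ContDiffAt ℝ ∞ (ρ ∘ (chartAt E x).symm) (chartAt E x x) := by
    refine ContMDiffAt.contDiffAt (ContMDiffAt.comp _ ?_ h1)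
    rwa [(chartAt E x).left_inv hx]
  exact ContDiffAt.smul h2 hθ

end Forms

/-! ### Integrals depending on a parameter and the homotopy formula -/

section ParametricIntegral

universe u

variable {E : Type u} [NormedAddCommGroup E] [NormedSpace ℝ E]

/-- Differentiation under the integral sign. The dominating function is a constant, because `[0, 1]`
is compact and the partial derivative is continuous. -/
theorem hasFDerivAt_parametric_integral {G : Type*} [NormedAddCommGroup G] [NormedSpace ℝ G]
    {O : Set E} (hO : IsOpen O) {f : E × ℝ → G} (hf : ContDiffOn ℝ ∞ f (O ×ˢ univ)) {y : E}
    (hy : y ∈ O) :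
    HasFDerivAt (fun z => ∫ t in (0 : ℝ)..1, f (z, t))
      (∫ t in (0 : ℝ)..1, (fderiv ℝ f (y, t)).comp (ContinuousLinearMap.inl ℝ E ℝ)) y := by
  have hO' : IsOpen (O ×ˢ (univ : Set ℝ)) := hO.prod isOpen_univ
  have hat : ∀ z ∈ O, ∀ t : ℝ, ContDiffAt ℝ ∞ f (z, t) := fun z hz t =>
    hf.contDiffAt (hO'.mem_nhds ⟨hz, mem_univ t⟩)
  have hslice : ∀ z ∈ O, Continuous fun t : ℝ => f (z, t) := fun z hz =>
    continuous_iff_continuousAt.2 fun t =>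
      ContinuousAt.comp (g := f) (hat z hz t).continuousAt (by fun_prop)
  have hf' : ContDiffOn ℝ ∞ (fun p => (fderiv ℝ f p).comp (ContinuousLinearMap.inl ℝ E ℝ))
      (O ×ˢ univ) := fun p hp =>
    (((hat p.1 hp.1 p.2).fderiv_right (m := ∞) le_rfl).clm_comp
      contDiffAt_const).contDiffWithinAt
  have hat' : ∀ z ∈ O, ∀ t : ℝ, ContinuousAt
      (fun p => (fderiv ℝ f p).comp (ContinuousLinearMap.inl ℝ E ℝ)) (z, t) := fun z hz t =>
    (hf'.contDiffAt (hO'.mem_nhds ⟨hz, mem_univ t⟩)).continuousAt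
  have hslice' : Continuous fun t : ℝ =>
      (fderiv ℝ f (y, t)).comp (ContinuousLinearMap.inl ℝ E ℝ) :=
    continuous_iff_continuousAt.2 fun t =>
      ContinuousAt.comp (f := fun t : ℝ => (y, t))
        (g := fun p => (fderiv ℝ f p).comp (ContinuousLinearMap.inl ℝ E ℝ)) (hat' y hy t)
        (by fun_prop)
  obtain ⟨C, hC⟩ := (isCompact_Icc (a := (0 : ℝ)) (b := 1)).exists_bound_of_continuousOn
    hslice'.continuousOn
  -- Tube lemma: the bound `C` over `{y} × [0, 1]` becomes `C + 1` over a neighbourhood of `y`,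
  -- uniformly in `t`.
  have hev : ∀ᶠ z in 𝓝 y, ∀ t ∈ Icc (0 : ℝ) 1,
      ‖(fderiv ℝ f (z, t)).comp (ContinuousLinearMap.inl ℝ E ℝ)‖ < C + 1 := by
    refine isCompact_Icc.eventually_forall_of_forall_eventually fun t ht => ?_
    exact (hat' y hy t).norm.eventually_lt_const (lt_of_le_of_lt (hC t ht) (by linarith))
  obtain ⟨s, hs, hsO⟩ := (hev.and (hO.mem_nhds hy)).exists_mem
  refine intervalIntegral.hasFDerivAt_integral_of_dominated_of_fderiv_le
    (F := fun z t => f (z, t))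
    (F' := fun z t => (fderiv ℝ f (z, t)).comp (ContinuousLinearMap.inl ℝ E ℝ))
    (bound := fun _ => C + 1) hs ?_ ?_ ?_ ?_ ?_ ?_
  · filter_upwards [hO.mem_nhds hy] with z hz
    exact (hslice z hz).aestronglyMeasurable
  · exact (hslice y hy).intervalIntegrable _ _
  · exact hslice'.aestronglyMeasurable
  · refine Filter.Eventually.of_forall fun t ht z hz => ((hsO z hz).1 t ?_).le
    rw [uIoc_of_le zero_le_one] at ht
    exact ⟨ht.1.le, ht.2⟩
  · exact intervalIntegrable_const
  · refine Filter.Eventually.of_forall fun t _ z hz => ?_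
    have h1 := ((hat z (hsO z hz).2 t).differentiableAt (by simp)).hasFDerivAt
    have h2 : HasFDerivAt (fun z : E => (z, t)) (ContinuousLinearMap.inl ℝ E ℝ) z :=
      hasFDerivAt_prodMk_left z t
    exact h1.comp z h2

/-- The derivative is again a parametric integral, now with values in `E →L[ℝ] G`, so induction on
the order applies. `G` shares the universe of `E` so that this change of target stays within the
induction hypothesis. -/
theorem contDiffOn_parametric_integral {O : Set E} (hO : IsOpen O) {G : Type u}
    [NormedAddCommGroup G] [NormedSpace ℝ G] {f : E × ℝ → G}
    (hf : ContDiffOn ℝ ∞ f (O ×ˢ univ)) :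
    ContDiffOn ℝ ∞ (fun z => ∫ t in (0 : ℝ)..1, f (z, t)) O := by
  rw [contDiffOn_infty]
  intro k
  induction k generalizing G with
  | zero =>
    exact contDiffOn_zero.2 fun z hz =>
      (hasFDerivAt_parametric_integral hO hf hz).continuousAt.continuousWithinAt
  | succ k ih =>
    rw [Nat.cast_add, Nat.cast_one, contDiffOn_succ_iff_fderiv_of_isOpen hO]
    refine ⟨fun z hz =>
      (hasFDerivAt_parametric_integral hO hf hz).differentiableAt.differentiableWithinAt,
      fun h => absurd h (by simp), ?_⟩
    have hf' : ContDiffOn ℝ ∞ (fun p => (fderiv ℝ f p).comp (ContinuousLinearMap.inl ℝ E ℝ))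
        (O ×ˢ univ) := fun p hp =>
      (((hf.contDiffAt ((hO.prod isOpen_univ).mem_nhds hp)).fderiv_right
        (m := ∞) le_rfl).clm_comp contDiffAt_const).contDiffWithinAt
    exact (ih hf').congr fun z hz => (hasFDerivAt_parametric_integral hO hf hz).fderiv

/-- Contraction of a form on `E × ℝ` with the unit vector of `ℝ`, restricted to `E`. -/
def contractTime (E : Type*) [NormedAddCommGroup E] [NormedSpace ℝ E] (n : ℕ) :
    ((E × ℝ) [⋀^Fin (n + 1)]→L[ℝ] ℝ) →L[ℝ] (E [⋀^Fin n]→L[ℝ] ℝ) :=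
  (ContinuousAlternatingMap.compContinuousLinearMapCLM (ContinuousLinearMap.inl ℝ E ℝ)).comp
    ((ContinuousLinearMap.apply ℝ ((E × ℝ) [⋀^Fin n]→L[ℝ] ℝ) ((0, 1) : E × ℝ)).comp
      (ContinuousAlternatingMap.curryLeftLI (𝕜 := ℝ) (E := E × ℝ) (F := ℝ)
        (n := n)).toContinuousLinearMap)

theorem contractTime_apply {n : ℕ} (η : (E × ℝ) [⋀^Fin (n + 1)]→L[ℝ] ℝ) (v : Fin n → E) :
    contractTime E n η v = η (Fin.cons ((0, 1) : E × ℝ) fun i => (v i, 0)) := rfl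

/-- The fibre integral over `[0, 1]` of a form on `E × ℝ`. -/
def fibreIntegral {n : ℕ} (θ : E × ℝ → (E × ℝ) [⋀^Fin (n + 1)]→L[ℝ] ℝ) (y : E) :
    E [⋀^Fin n]→L[ℝ] ℝ :=
  ∫ t in (0 : ℝ)..1, contractTime E n (θ (y, t))

theorem contDiffOn_fibreIntegral {n : ℕ} {O : Set E} (hO : IsOpen O)
    {θ : E × ℝ → (E × ℝ) [⋀^Fin (n + 1)]→L[ℝ] ℝ} (hθ : ContDiffOn ℝ ∞ θ (O ×ˢ univ)) :
    ContDiffOn ℝ ∞ (fibreIntegral θ) O :=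
  contDiffOn_parametric_integral hO ((contractTime E n).contDiff.comp_contDiffOn hθ)

/-- The homotopy formula `d K θ + K d θ = i₁^* θ - i₀^* θ` for closed `θ`. Closedness converts the
alternating sum of derivatives along `E` into a time derivative, which integrates to the difference
of the end values. -/
theorem extDeriv_fibreIntegral {n : ℕ} {O : Set E} (hO : IsOpen O)
    {θ : E × ℝ → (E × ℝ) [⋀^Fin (n + 1)]→L[ℝ] ℝ} (hθ : ContDiffOn ℝ ∞ θ (O ×ˢ univ))
    (hd : ∀ p ∈ O ×ˢ (univ : Set ℝ), extDeriv θ p = 0) {y : E} (hy : y ∈ O) (v : Fin (n + 1) → E) :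
    extDeriv (fibreIntegral θ) y v =
      θ (y, 1) (fun i => (v i, 0)) - θ (y, 0) (fun i => (v i, 0)) := by
  have hO' : IsOpen (O ×ˢ (univ : Set ℝ)) := hO.prod isOpen_univ
  have hmem : ∀ t : ℝ, (y, t) ∈ O ×ˢ (univ : Set ℝ) := fun t => ⟨hy, mem_univ t⟩
  have hat : ∀ t : ℝ, ContDiffAt ℝ ∞ θ (y, t) := fun t =>
    hθ.contDiffAt (hO'.mem_nhds (hmem t))
  have hev : ∀ {m : ℕ} (η : E × ℝ → (E × ℝ) [⋀^Fin m]→L[ℝ] ℝ) (_ : ContDiffOn ℝ ∞ η (O ×ˢ univ))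
      (w : Fin m → E × ℝ), ContDiffOn ℝ ∞ (fun p => η p w) (O ×ˢ univ) := fun η hη w =>
    (ContinuousAlternatingMap.apply ℝ (E × ℝ) ℝ w).contDiff.comp_contDiffOn hη
  have hcont : ∀ (g : E × ℝ → ℝ), ContDiffOn ℝ ∞ g (O ×ˢ univ) → ∀ u : E × ℝ,
      Continuous fun t : ℝ => fderiv ℝ g (y, t) u := fun g hg u =>
    continuous_iff_continuousAt.2 fun t => by
      have h1 := ((hg.contDiffAt (hO'.mem_nhds (hmem t))).fderiv_right
        (m := ∞) le_rfl).continuousAt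
      exact ContinuousAt.clm_apply (ContinuousAt.comp (g := fderiv ℝ g)
        (f := fun t : ℝ => (y, t)) h1 (by fun_prop)) continuousAt_const
  -- the derivative of the fibre integral
  have h1 : ∀ i : Fin (n + 1), fderiv ℝ (fun z => fibreIntegral θ z (i.removeNth v)) y (v i) =
      ∫ t in (0 : ℝ)..1, fderiv ℝ (fun p => θ p
        (Fin.cons ((0, 1) : E × ℝ) fun j => (i.removeNth v j, 0))) (y, t) (v i, 0) := by
    intro i
    have hg := hev θ hθ (Fin.cons ((0, 1) : E × ℝ) fun j => (i.removeNth v j, 0))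
    have h2 := hasFDerivAt_parametric_integral hO hg hy
    have h3 : (fun z => fibreIntegral θ z (i.removeNth v)) =ᶠ[𝓝 y] fun z =>
        ∫ t in (0 : ℝ)..1, θ (z, t) (Fin.cons ((0, 1) : E × ℝ) fun j => (i.removeNth v j, 0)) := by
      filter_upwards [hO.mem_nhds hy] with z hz
      have hint : IntervalIntegrable (fun t => contractTime E n (θ (z, t)))
          MeasureTheory.volume 0 1 := by
        refine (continuous_iff_continuousAt.2 fun t => ?_).intervalIntegrable _ _
        refine (contractTime E n).continuous.continuousAt.comp ?_
        exact ContinuousAt.comp (g := θ) (f := fun t : ℝ => (z, t))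
          (hθ.contDiffAt (hO'.mem_nhds ⟨hz, mem_univ t⟩)).continuousAt (by fun_prop)
      exact ((ContinuousAlternatingMap.apply ℝ E ℝ
        (i.removeNth v)).intervalIntegral_comp_comm hint).symm
    rw [h3.fderiv_eq, h2.fderiv, ContinuousLinearMap.intervalIntegral_apply]
    · rfl
    · refine (continuous_iff_continuousAt.2 fun t => ?_).intervalIntegrable _ _
      have h4 := ((hg.contDiffAt (hO'.mem_nhds (hmem t))).fderiv_right
        (m := ∞) le_rfl).continuousAt
      exact ContinuousAt.clm_comp (ContinuousAt.comp (g := fderiv ℝ _)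
        (f := fun t : ℝ => (y, t)) h4 (by fun_prop)) continuousAt_const
  have hdiff : DifferentiableAt ℝ (fibreIntegral θ) y :=
    ((contDiffOn_fibreIntegral hO hθ).contDiffAt (hO.mem_nhds hy)).differentiableAt (by simp)
  -- closedness of `θ`
  have h5 : ∀ t : ℝ, ∑ i : Fin (n + 1), (-1 : ℝ) ^ (i : ℕ) • fderiv ℝ (fun p => θ p
        (Fin.cons ((0, 1) : E × ℝ) fun j => (i.removeNth v j, 0))) (y, t) (v i, 0) =
      fderiv ℝ (fun p => θ p fun i => (v i, 0)) (y, t) (0, 1) := by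
    intro t
    -- Evaluate `d θ = 0` on the time direction followed by `v`. The term omitting the time
    -- direction is the time derivative; in the others the position shift by one contributes a minus
    -- sign.
    have h6 := congrArg (fun L => L (Fin.cons ((0, 1) : E × ℝ) fun i => (v i, 0)))
      (hd (y, t) ⟨hy, mem_univ t⟩)
    simp only [extDeriv_apply ((hat t).differentiableAt (by simp))] at h6
    simp only [← Int.cast_smul_eq_zsmul ℝ, Int.cast_pow, Int.cast_neg, Int.cast_one] at h6
    rw [Fin.sum_univ_succ] at h6
    have h7 : ∀ i : Fin (n + 1), (i.succ).removeNth
        (Fin.cons ((0, 1) : E × ℝ) (fun i => (v i, 0)) : Fin (n + 2) → E × ℝ) =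
        Fin.cons ((0, 1) : E × ℝ) fun j => (i.removeNth v j, 0) := by
      intro i
      funext j
      refine Fin.cases ?_ (fun j => ?_) j
      · rfl
      · simp [Fin.removeNth]
    have h8 : (0 : Fin (n + 2)).removeNth
        (Fin.cons ((0, 1) : E × ℝ) (fun i => (v i, 0)) : Fin (n + 2) → E × ℝ) =
        fun i => (v i, 0) := by
      funext j
      simp [Fin.removeNth]
    simp only [h7, h8, Fin.cons_zero, Fin.cons_succ, Fin.val_zero, pow_zero, one_smul,
      Fin.val_succ, pow_succ, mul_neg, mul_one, neg_smul, Finset.sum_neg_distrib] at h6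
    exact (sub_eq_zero.1 ((sub_eq_add_neg _ _).trans h6)).symm
  rw [extDeriv_apply hdiff]
  simp only [h1, ← Int.cast_smul_eq_zsmul ℝ, Int.cast_pow, Int.cast_neg, Int.cast_one]
  have h9 : ∀ i : Fin (n + 1), (-1 : ℝ) ^ (i : ℕ) • ∫ t in (0 : ℝ)..1, fderiv ℝ (fun p => θ p
        (Fin.cons ((0, 1) : E × ℝ) fun j => (i.removeNth v j, 0))) (y, t) (v i, 0) =
      ∫ t in (0 : ℝ)..1, (-1 : ℝ) ^ (i : ℕ) • fderiv ℝ (fun p => θ p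
        (Fin.cons ((0, 1) : E × ℝ) fun j => (i.removeNth v j, 0))) (y, t) (v i, 0) :=
    fun i => (intervalIntegral.integral_smul _ _).symm
  have h11 : ∀ i : Fin (n + 1), IntervalIntegrable (fun t => (-1 : ℝ) ^ (i : ℕ) •
      fderiv ℝ (fun p => θ p (Fin.cons ((0, 1) : E × ℝ) fun j => (i.removeNth v j, 0)))
        (y, t) (v i, 0)) MeasureTheory.volume 0 1 := fun i =>
    (Continuous.const_smul (hcont _ (hev θ hθ _) _) ((-1 : ℝ) ^ (i : ℕ))).intervalIntegrable 0 1
  rw [Finset.sum_congr rfl fun i _ => h9 i,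
    ← intervalIntegral.integral_finsetSum fun i _ => h11 i]
  simp only [h5]
  refine intervalIntegral.integral_eq_sub_of_hasDerivAt (f := fun t => θ (y, t) fun i => (v i, 0))
    (fun t _ => ?_) ((hcont _ (hev θ hθ _) _).intervalIntegrable _ _)
  have h10 := (((hev θ hθ fun i => (v i, 0)).contDiffAt
    (hO'.mem_nhds (hmem t))).differentiableAt (by simp)).hasFDerivAt
  exact h10.comp_hasDerivAt t ((hasDerivAt_const t y).prodMk (hasDerivAt_id t))

end ParametricIntegral

/-! ### Smooth approximation of continuous maps between manifolds -/

section SmoothApproximation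

open Filter

variable {EX : Type*} [NormedAddCommGroup EX] [NormedSpace ℝ EX] [FiniteDimensional ℝ EX]
  {HX : Type*} [TopologicalSpace HX] {I : ModelWithCorners ℝ EX HX}
  {X : Type*} [TopologicalSpace X] [ChartedSpace HX X] [IsManifold I ∞ X]
  [T2Space X] [SigmaCompactSpace X]
  {E : Type*} [NormedAddCommGroup E] [NormedSpace ℝ E]
  {Y : Type*} [TopologicalSpace Y] [ChartedSpace E Y] [IsManifold 𝓘(ℝ, E) ∞ Y]

/-- A continuous map can be made smooth where a bump function `ρ` is `1`, without changing it
outside of the support of `ρ`, keeping it smooth where it was smooth, and keeping a locally finite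
family of conditions `f (K i) ⊆ S i`. -/
theorem exists_smooth_modification {f : X → Y} (hf : Continuous f) {ρ : X → ℝ}
    (hρ : ContMDiff I 𝓘(ℝ, ℝ) ∞ ρ) (hc : HasCompactSupport ρ) (h01 : ∀ x, ρ x ∈ Icc (0 : ℝ) 1)
    {e : OpenPartialHomeomorph Y E} (he : e ∈ atlas E Y)
    (hfe : ∀ x ∈ tsupport ρ, f x ∈ e.source)
    {ι : Type*} {K : ι → Set X} (hK : ∀ i, IsClosed (K i)) (hlf : LocallyFinite K)
    {S : ι → Set Y} (hS : ∀ i, IsOpen (S i)) (hKS : ∀ i, MapsTo f (K i) (S i)) :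
    ∃ g : X → Y, Continuous g ∧ (∀ i, MapsTo g (K i) (S i)) ∧ (∀ x ∉ tsupport ρ, g x = f x) ∧
      (∀ x, ContMDiffAt I 𝓘(ℝ, E) ∞ f x → ContMDiffAt I 𝓘(ℝ, E) ∞ g x) ∧
      ∀ x, ρ =ᶠ[𝓝 x] 1 → ContMDiffAt I 𝓘(ℝ, E) ∞ g x := by
  classical
  have hef : ∀ x ∈ tsupport ρ, ContinuousAt (fun x => e (f x)) x := fun x hx =>
    ContinuousAt.comp (g := e) (e.continuousAt (hfe x hx)) hf.continuousAt
  -- All constraints are open conditions on the pair (point, chart value). Near `x` only finitely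
  -- many of them matter, by local finiteness, and those with `x ∉ K i` are vacuous near `x`.
  have h1 : ∀ x ∈ tsupport ρ, ∀ᶠ p : X × E in 𝓝 (x, e (f x)),
      p.2 ∈ e.target ∧ ∀ i, p.1 ∈ K i → e.symm p.2 ∈ S i := by
    intro x hx
    have hcs : ContinuousAt (fun p : X × E => e.symm p.2) (x, e (f x)) :=
      ContinuousAt.comp (g := e.symm) (e.continuousAt_symm (e.map_source (hfe x hx)))
        continuousAt_snd
    obtain ⟨t, ht, hfin⟩ := hlf x
    refine (continuousAt_snd.eventually_mem
      (e.open_target.mem_nhds (e.map_source (hfe x hx)))).and ?_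
    have h2 : ∀ᶠ p : X × E in 𝓝 (x, e (f x)), ∀ i ∈ {i | (K i ∩ t).Nonempty},
        p.1 ∈ K i → e.symm p.2 ∈ S i := by
      rw [eventually_all_finite hfin]
      intro i _
      by_cases hi : x ∈ K i
      · have h3 : e.symm (e (f x)) ∈ S i := by
          rw [e.left_inv (hfe x hx)]
          exact hKS i hi
        filter_upwards [hcs.eventually_mem ((hS i).mem_nhds h3)] with p hp _
        exact hp
      · filter_upwards [continuousAt_fst.eventually_mem ((hK i).isOpen_compl.mem_nhds
          (show ((x, e (f x)) : X × E).1 ∈ (K i)ᶜ from hi))] with p hp hp'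
        exact absurd hp' hp
    filter_upwards [h2, continuousAt_fst.eventually_mem ht] with p hp hpt i hi
    exact hp i ⟨p.1, hi, hpt⟩ hi
  -- Compactness of the support makes the admissible perturbation size uniform.
  obtain ⟨ε, hε, hε0⟩ : ∃ ε : ℝ, (∀ x ∈ tsupport ρ, ∀ z, dist z (e (f x)) < ε →
      z ∈ e.target ∧ ∀ i, x ∈ K i → e.symm z ∈ S i) ∧ 0 < ε := by
    have h2 : ∀ᶠ ε in 𝓝 (0 : ℝ), ∀ x ∈ tsupport ρ, x ∈ tsupport ρ → ∀ z, dist z (e (f x)) < ε →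
        z ∈ e.target ∧ ∀ i, x ∈ K i → e.symm z ∈ S i := by
      refine IsCompact.eventually_forall_of_forall_eventually hc fun x hx => ?_
      have h3 := h1 x hx
      rw [nhds_prod_eq, eventually_prod_iff] at h3
      obtain ⟨pa, ha, pb, hb, hab⟩ := h3
      obtain ⟨r, hr, hrb⟩ := Metric.eventually_nhds_iff_ball.1 hb
      have h4 : ∀ᶠ x' in 𝓝 x, dist (e (f x')) (e (f x)) < r / 2 :=
        (hef x hx).eventually (Metric.ball_mem_nhds _ (half_pos hr))
      rw [nhds_prod_eq]
      filter_upwards [(eventually_lt_nhds (half_pos hr)).prod_mk (ha.and h4)]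
        with p hp _ z hz
      refine hab hp.2.1 (hrb z ?_)
      have := dist_triangle z (e (f p.2)) (e (f x))
      rw [Metric.mem_ball]
      linarith [hp.1, hp.2.2]
    obtain ⟨ε, h3, h4⟩ := ((h2.filter_mono nhdsWithin_le_nhds).and
      (self_mem_nhdsWithin : ∀ᶠ ε in 𝓝[>] (0 : ℝ), ε ∈ Ioi (0 : ℝ))).exists
    exact ⟨ε, fun x hx => h3 x hx hx, h4⟩
  -- A smooth map into the vector space, `ε`-close to `e ∘ f` on the support and unconstrained
  -- elsewhere. The constraint sets are convex and constants satisfy them locally, so a partition of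
  -- unity applies.
  obtain ⟨s, hs⟩ := exists_contMDiffMap_forall_mem_convex_of_local_const (n := ⊤) I
    (t := fun x => if x ∈ tsupport ρ then Metric.ball (e (f x)) ε else univ)
    (fun x => by
      split_ifs
      · exact convex_ball _ _
      · exact convex_univ)
    (fun x => by
      by_cases hx : x ∈ tsupport ρ
      · refine ⟨e (f x), ?_⟩
        filter_upwards [(hef x hx).eventually (Metric.ball_mem_nhds _ hε0)] with y hy
        split_ifs
        · rw [Metric.mem_ball, dist_comm]
          exact hy
        · exact mem_univ _
      · refine ⟨0, ?_⟩
        filter_upwards [(isClosed_tsupport ρ).isOpen_compl.mem_nhds hx] with y hy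
        rw [if_neg hy]
        exact mem_univ _)
  have hs' : ∀ x ∈ tsupport ρ, dist (s x) (e (f x)) < ε := fun x hx => by
    have := hs x
    rwa [if_pos hx] at this
  -- Interpolation in the chart: equal to `e ∘ f` where `ρ = 0` and to the smooth `s` where `ρ = 1`.
  -- It is never farther than `s` from `e ∘ f`.
  set a : X → E := fun x => e (f x) + ρ x • (s x - e (f x)) with ha
  have hax : ∀ x ∈ tsupport ρ, a x ∈ e.target ∧ ∀ i, x ∈ K i → e.symm (a x) ∈ S i := by
    intro x hx
    refine hε x hx _ (lt_of_le_of_lt ?_ (hs' x hx))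
    rw [ha, dist_eq_norm, dist_eq_norm, add_sub_cancel_left, norm_smul, Real.norm_eq_abs,
      abs_of_nonneg (h01 x).1]
    exact mul_le_of_le_one_left (norm_nonneg _) (h01 x).2
  let g : X → Y := fun x => if x ∈ tsupport ρ then e.symm (a x) else f x
  have hg_out : ∀ x ∉ tsupport ρ, g x = f x := fun x hx => if_neg hx
  have hg_in : ∀ x ∈ tsupport ρ, g =ᶠ[𝓝 x] fun x => e.symm (a x) := by
    intro x hx
    filter_upwards [hf.continuousAt.eventually_mem (e.open_source.mem_nhds (hfe x hx))] with y hy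
    by_cases hyρ : y ∈ tsupport ρ
    · exact if_pos hyρ
    · rw [hg_out y hyρ]
      simp only [ha, image_eq_zero_of_notMem_tsupport hyρ, zero_smul, add_zero]
      exact (e.left_inv hy).symm
  have hg_out' : ∀ x ∉ tsupport ρ, g =ᶠ[𝓝 x] f := by
    intro x hx
    filter_upwards [(isClosed_tsupport ρ).isOpen_compl.mem_nhds hx] with y hy
    exact hg_out y hy
  have hsymm : ∀ z ∈ e.target, ContMDiffAt 𝓘(ℝ, E) 𝓘(ℝ, E) ∞ e.symm z := fun z hz =>
    (contMDiffOn_symm_of_mem_maximalAtlas (IsManifold.subset_maximalAtlas (n := ∞) he)).contMDiffAt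
      (e.open_target.mem_nhds hz)
  have hchart : ∀ z ∈ e.source, ContMDiffAt 𝓘(ℝ, E) 𝓘(ℝ, E) ∞ e z := fun z hz =>
    (contMDiffOn_of_mem_maximalAtlas (IsManifold.subset_maximalAtlas (n := ∞) he)).contMDiffAt
      (e.open_source.mem_nhds hz)
  refine ⟨g, ?_, ?_, hg_out, ?_, ?_⟩
  · rw [continuous_iff_continuousAt]
    intro x
    by_cases hx : x ∈ tsupport ρ
    · refine ContinuousAt.congr ?_ (hg_in x hx).symm
      refine ContinuousAt.comp (g := e.symm) (e.continuousAt_symm (hax x hx).1) ?_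
      exact (hef x hx).add (hρ.continuous.continuousAt.smul
        (s.contMDiff.continuous.continuousAt.sub (hef x hx)))
    · exact hf.continuousAt.congr (hg_out' x hx).symm
  · intro i x hx
    by_cases hxρ : x ∈ tsupport ρ
    · rw [show g x = e.symm (a x) from if_pos hxρ]
      exact (hax x hxρ).2 i hx
    · rw [hg_out x hxρ]
      exact hKS i hx
  · intro x hfx
    by_cases hx : x ∈ tsupport ρ
    · refine ContMDiffAt.congr_of_eventuallyEq ?_ (hg_in x hx)
      refine ContMDiffAt.comp x (g := e.symm) (hsymm _ (hax x hx).1) ?_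
      have h2 : ContMDiffAt I 𝓘(ℝ, E) ∞ (fun x => e (f x)) x :=
        ContMDiffAt.comp x (g := e) (hchart _ (hfe x hx)) hfx
      exact h2.add (hρ.contMDiffAt.smul (s.contMDiff.contMDiffAt.sub h2))
    · exact hfx.congr_of_eventuallyEq (hg_out' x hx)
  · intro x hx1
    have hx : x ∈ tsupport ρ := subset_tsupport ρ (by
      rw [Function.mem_support, hx1.self_of_nhds]
      exact one_ne_zero)
    have h2 : g =ᶠ[𝓝 x] fun x => e.symm (s x) := by
      filter_upwards [hg_in x hx, hx1] with y hy hy1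
      rw [hy]
      simp only [ha, hy1, Pi.one_apply, one_smul, add_sub_cancel]
    refine ContMDiffAt.congr_of_eventuallyEq ?_ h2
    exact ContMDiffAt.comp x (g := e.symm) (hsymm _ (hε x hx _ (hs' x hx)).1)
      s.contMDiff.contMDiffAt

/-- A continuous map between manifolds which is smooth on a neighbourhood `O` of a closed set `A`
agrees on `A` with a smooth map with values in any given open set containing the values of `f`. -/
theorem exists_contMDiff_eqOn {f : X → Y} (hf : Continuous f) {O A : Set X} (hO : IsOpen O)
    (hA : IsClosed A) (hAO : A ⊆ O) (hfO : ∀ x ∈ O, ContMDiffAt I 𝓘(ℝ, E) ∞ f x)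
    {V : Set Y} (hV : IsOpen V) (hfV : ∀ x, f x ∈ V) :
    ∃ g : X → Y, ContMDiff I 𝓘(ℝ, E) ∞ g ∧ EqOn g f A ∧ ∀ x, g x ∈ V := by
  classical
  -- The bumps cover the part where smoothness is not known. Their supports avoid `A`, so values
  -- there never change, and `f` maps each support into a single chart.
  obtain ⟨ι, b, hb⟩ := SmoothBumpCovering.exists_isSubordinate I hO.isClosed_compl
    (U := fun x => Aᶜ ∩ f ⁻¹' (chartAt E (f x)).source) (fun x hx => Filter.inter_mem
      (hA.isOpen_compl.mem_nhds fun h => hx (hAO h))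
      (hf.continuousAt.preimage_mem_nhds ((chartAt E (f x)).open_source.mem_nhds
        (mem_chart_source E (f x)))))
  have hlf : LocallyFinite fun i => tsupport (b i) := b.locallyFinite.closure
  have hcount : Countable ι := by
    rw [← countable_univ_iff]
    exact b.locallyFinite.countable_univ fun i => (b i).nonempty_support
  let _ : Encodable ι := Encodable.ofCountable ι
  -- The constraints for all indices are carried through every modification, so that each later
  -- modification still takes place in its own chart and inside `V`.
  let S : ι → Set Y := fun i => (chartAt E (f (b.c i))).source ∩ V
  have hSo : ∀ i, IsOpen (S i) := fun i => (chartAt E (f (b.c i))).open_source.inter hV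
  let State : Type _ := {h : X → Y // Continuous h ∧ (∀ i, MapsTo h (tsupport (b i)) (S i)) ∧
    ∀ x, h x ∈ V}
  have hstep : ∀ (h : State) (i : ι), ∃ g : State, (∀ x ∉ tsupport (b i), g.1 x = h.1 x) ∧
      (∀ x, ContMDiffAt I 𝓘(ℝ, E) ∞ h.1 x → ContMDiffAt I 𝓘(ℝ, E) ∞ g.1 x) ∧
      ∀ x, b i =ᶠ[𝓝 x] 1 → ContMDiffAt I 𝓘(ℝ, E) ∞ g.1 x := by
    intro h i
    obtain ⟨g, h1, h2, h3, h4, h5⟩ := exists_smooth_modification (I := I) h.2.1 (b i).contMDiff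
      (b i).hasCompactSupport (fun x => (b i).mem_Icc) (chart_mem_atlas E (f (b.c i)))
      (fun x hx => (h.2.2.1 i hx).1) (fun i => isClosed_tsupport (b i)) hlf
      hSo h.2.2.1
    refine ⟨⟨g, h1, h2, fun x => ?_⟩, h3, h4, h5⟩
    by_cases hx : x ∈ tsupport (b i)
    · exact (h2 i hx).2
    · rw [h3 x hx]
      exact h.2.2.2 x
  choose step hstep1 hstep2 hstep3 using hstep
  -- The bumps are treated one at a time; `decode₂` ensures that `i` is treated exactly at stage
  -- `encode i`.
  let s : ℕ → State := fun n => Nat.rec ⟨f, hf, fun i x hx => ⟨(hb i hx).2, hfV x⟩, hfV⟩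
    (fun n h => (Encodable.decode₂ ι n).elim h (step h)) n
  have hs0 : (s 0).1 = f := rfl
  have hs_succ : ∀ n, s (n + 1) = (Encodable.decode₂ ι n).elim (s n) (step (s n)) :=
    fun n => rfl
  have hsmooth : ∀ n m, n ≤ m → ∀ x, ContMDiffAt I 𝓘(ℝ, E) ∞ (s n).1 x →
      ContMDiffAt I 𝓘(ℝ, E) ∞ (s m).1 x := by
    intro n m hnm x hx
    induction m, hnm using Nat.le_induction with
    | base => exact hx
    | succ m _ ih =>
      rw [hs_succ]
      cases hd : Encodable.decode₂ ι m with
      | none => exact ih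
      | some i => exact hstep2 _ _ _ ih
  -- Only finitely many supports meet a small neighbourhood, so the sequence is eventually
  -- stationary there and has a well-defined limit.
  have hloc : ∀ x, ∃ n, ∃ t ∈ 𝓝 x, ∀ m, n ≤ m → ∀ y ∈ t, (s m).1 y = (s n).1 y := by
    intro x
    obtain ⟨t, ht, hfin⟩ := hlf x
    obtain ⟨B, hB⟩ := (hfin.image Encodable.encode).bddAbove
    refine ⟨B + 1, t, ht, fun m hm y hy => ?_⟩
    induction m, hm using Nat.le_induction with
    | base => rfl
    | succ m hm ih =>
      rw [← ih, hs_succ]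
      cases hd : Encodable.decode₂ ι m with
      | none => rfl
      | some i =>
        refine hstep1 _ _ _ fun hyi => ?_
        have h1 := hB ⟨i, ⟨y, hyi, hy⟩, rfl⟩
        rw [Encodable.decode₂_eq_some.1 hd] at h1
        omega
  choose B t ht hBt using hloc
  refine ⟨fun x => (s (B x)).1 x, fun x => ?_, fun x hx => ?_, fun x => (s (B x)).2.2.2 x⟩
  · have hev : ∀ m, B x ≤ m → (fun x => (s (B x)).1 x) =ᶠ[𝓝 x] (s m).1 := by
      intro m hm
      filter_upwards [ht x] with y hy
      have h1 := hBt y (max (B x) (B y)) (le_max_right _ _) y (mem_of_mem_nhds (ht y))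
      have h2 := hBt x (max (B x) (B y)) (le_max_left _ _) y hy
      rw [← h1, h2, hBt x m hm y hy]
    by_cases hx : x ∈ O
    · exact (hsmooth 0 (B x) (Nat.zero_le _) x (hfO x hx)).congr_of_eventuallyEq (hev _ le_rfl)
    -- Outside `O` some bump equals `1` near `x`. The map becomes smooth at `x` once that bump has
    -- been treated, and later stages preserve this.
    · refine ContMDiffAt.congr_of_eventuallyEq ?_ (hev _ (le_max_left (B x)
        (Encodable.encode (b.ind x hx) + 1)))
      refine hsmooth _ _ (le_max_right _ _) x ?_
      rw [hs_succ, Encodable.decode₂_encode]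
      exact hstep3 _ _ _ (b.eventuallyEq_one x hx)
  · have h1 : ∀ n, (s n).1 x = f x := by
      intro n
      induction n with
      | zero => rfl
      | succ n ih =>
        rw [hs_succ]
        cases hd : Encodable.decode₂ ι n with
        | none => exact ih
        | some i => exact (hstep1 _ _ _ fun hxi => (hb i hxi).1 hx).trans ih
    exact h1 _

end SmoothApproximation

/-! ### The Poincaré lemma for contractible open sets -/

namespace Forms

section VectorSpace

variable {E : Type*} [NormedAddCommGroup E] [NormedSpace ℝ E]

theorem inChart_refl {n : ℕ} (θ : FormField E E n) :
    inChart θ (OpenPartialHomeomorph.refl E) = θ := by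
  funext y
  have h : mfderiv 𝓘(ℝ, E) 𝓘(ℝ, E) (OpenPartialHomeomorph.refl E).symm y =
      ContinuousLinearMap.id ℝ E := mfderiv_id
  ext v
  simp only [inChart, h]
  rfl

theorem smoothFormAt_iff_contDiffAt {n : ℕ} {θ : E → E [⋀^Fin n]→L[ℝ] ℝ} {y : E} :
    SmoothFormAt (E := E) (M := E) θ y ↔ ContDiffAt ℝ ∞ θ y := by
  unfold SmoothFormAt
  rw [chartAt_self_eq]
  exact iff_of_eq (congrArg (fun g => ContDiffAt ℝ ∞ g y) (inChart_refl (E := E) θ))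

theorem extD_eq_extDeriv {n : ℕ} (θ : E → E [⋀^Fin n]→L[ℝ] ℝ) (y : E) :
    extD (E := E) (M := E) θ y = extDeriv θ y := by
  have h : mfderiv 𝓘(ℝ, E) 𝓘(ℝ, E) (OpenPartialHomeomorph.refl E) y =
      ContinuousLinearMap.id ℝ E := mfderiv_id
  have h' : inChart (E := E) (M := E) θ (OpenPartialHomeomorph.refl E) = θ := inChart_refl _
  ext v
  simp only [extD, chartAt_self_eq, h, h']
  rfl

end VectorSpace

variable {E : Type*} [NormedAddCommGroup E] [NormedSpace ℝ E]
  {M : Type*} [TopologicalSpace M] [ChartedSpace E M]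

variable (E) in
/-- The forms which vanish outside of `W` and are smooth at the points of `W`. For open `W` these
are the smooth forms on `W`, extended by zero. -/
def formsOn (W : Set M) (n : ℕ) : Submodule ℝ (FormField E M n) where
  carrier := {θ | (∀ x ∈ W, SmoothFormAt θ x) ∧ ∀ x ∉ W, θ x = 0}
  add_mem' {θ η} hθ hη := ⟨fun x hx => (hθ.1 x hx).add (hη.1 x hx), fun x hx => by
    rw [Pi.add_apply, hθ.2 x hx, hη.2 x hx, add_zero]⟩
  zero_mem' := ⟨fun x _ => smoothFormAt_zero x, fun _ _ => rfl⟩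
  smul_mem' c θ hθ := ⟨fun x hx => (hθ.1 x hx).const_smul c, fun x hx => by
    rw [Pi.smul_apply, hθ.2 x hx, smul_zero]⟩

variable [FiniteDimensional ℝ E] [IsManifold 𝓘(ℝ, E) ∞ M] [T2Space M] [SecondCountableTopology M]

/-- A contractible open set has a smooth contraction. -/
theorem exists_smooth_contraction {W : Set M} (hW : IsOpen W) [ContractibleSpace W] :
    ∃ (G : M × ℝ → M) (p : M),
      (∀ x ∈ W, ∀ t, ContMDiffAt (𝓘(ℝ, E).prod 𝓘(ℝ, ℝ)) 𝓘(ℝ, E) ∞ G (x, t)) ∧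
      (∀ x ∈ W, ∀ t, G (x, t) ∈ W) ∧ (∀ x ∈ W, G (x, 1) = x) ∧ ∀ x ∈ W, G (x, 0) = p := by
  classical
  obtain ⟨p, ⟨H⟩⟩ := id_nullhomotopic W
  let X : Opens (M × ℝ) := ⟨W ×ˢ univ, hW.prod isOpen_univ⟩
  have : LocallyCompactSpace E := inferInstance
  have : LocallyCompactSpace M := ChartedSpace.locallyCompactSpace E M
  have : LocallyCompactSpace X := X.2.locallyCompactSpace
  -- Time is reversed and slowed down at the ends: `τ = 1` for `t ≤ 1/3` and `τ = 0` for `t ≥ 2/3`.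
  -- Thus the homotopy is constant near `t = 0` and the projection near `t = 1`, both smooth;
  -- letting `t` range over all of `ℝ` avoids boundary points.
  let τ : X → unitInterval := fun x => projIcc 0 1 zero_le_one (2 - 3 * x.1.2)
  have hτ : Continuous τ := continuous_projIcc.comp (by fun_prop)
  let f : X → M := fun x => H (τ x, ⟨x.1.1, x.2.1⟩)
  have hf : Continuous f := by
    refine continuous_subtype_val.comp (H.continuous.comp (hτ.prodMk ?_))
    exact Continuous.subtype_mk (by fun_prop) _
  have hf0 : ∀ x : X, x.1.2 < 1 / 3 → f x = p := by
    intro x hx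
    have h1 : τ x = 1 := projIcc_of_right_le _ (by linarith)
    change ((H (τ x, _) : W) : M) = p
    rw [h1, H.apply_one]
    rfl
  have hf1 : ∀ x : X, 2 / 3 < x.1.2 → f x = x.1.1 := by
    intro x hx
    have h1 : τ x = 0 := projIcc_of_le_left _ (by linarith)
    change ((H (τ x, _) : W) : M) = x.1.1
    rw [h1, H.apply_zero]
    rfl
  have hs : Continuous fun x : X => x.1.2 := by fun_prop
  have hO0 : IsOpen {x : X | x.1.2 < 1 / 3} := isOpen_lt hs continuous_const
  have hO1 : IsOpen {x : X | 2 / 3 < x.1.2} := isOpen_lt continuous_const hs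
  -- Smoothing relative to the slices `t = 0` and `t = 1`, with values kept in `W`.
  obtain ⟨g, hg, hgA, hgW⟩ := exists_contMDiff_eqOn (I := 𝓘(ℝ, E).prod 𝓘(ℝ, ℝ)) (E := E) hf
    (hO0.union hO1) (A := {x : X | x.1.2 = 0} ∪ {x : X | x.1.2 = 1})
    ((isClosed_eq hs continuous_const).union (isClosed_eq hs continuous_const))
    (by
      rintro x (hx | hx)
      · left
        rw [mem_ofPred_eq] at hx ⊢
        rw [hx]; norm_num
      · right
        rw [mem_ofPred_eq] at hx ⊢
        rw [hx]; norm_num)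
    (by
      rintro x (hx | hx)
      · refine ContMDiffAt.congr_of_eventuallyEq (contMDiffAt_const (c := (p : M))) ?_
        filter_upwards [hO0.mem_nhds hx] with y hy using hf0 y hy
      · refine ContMDiffAt.congr_of_eventuallyEq (f := fun x : X => x.1.1) ?_ ?_
        · exact contMDiffAt_subtype_iff.2 contMDiffAt_fst
        · filter_upwards [hO1.mem_nhds hx] with y hy using hf1 y hy)
    hW (fun x => (H (τ x, ⟨x.1.1, x.2.1⟩)).2)
  -- The value outside `W × ℝ` is arbitrary.
  let G : M × ℝ → M := fun z => if h : z ∈ X then g ⟨z, h⟩ else z.1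
  have hGg : ∀ z : X, G z = g z := fun z => dif_pos z.2
  have hX : ∀ x ∈ W, ∀ t : ℝ, (x, t) ∈ X := fun x hx t => ⟨hx, mem_univ t⟩
  refine ⟨G, p, fun x hx t => ?_, fun x hx t => ?_, fun x hx => ?_, fun x hx => ?_⟩
  · refine (contMDiffAt_subtype_iff (U := X) (x := ⟨(x, t), hX x hx t⟩)).1 ?_
    have : (fun z : X => G z) = g := funext hGg
    rw [this]
    exact hg _
  · rw [hGg ⟨(x, t), hX x hx t⟩]
    exact hgW _
  · rw [hGg ⟨(x, 1), hX x hx 1⟩, hgA (Or.inr rfl)]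
    exact hf1 _ (by norm_num)
  · rw [hGg ⟨(x, 0), hX x hx 0⟩, hgA (Or.inl rfl)]
    exact hf0 _ (by norm_num)

/-! ### The homotopy operator and its expression in charts. -/

section Poincare

omit [FiniteDimensional ℝ E] [T2Space M] [SecondCountableTopology M]

/-- The map `(y, t) ↦ G (e⁻¹ y, t)`. -/
def timeChart (e : OpenPartialHomeomorph M E) (G : M × ℝ → M) : E × ℝ → M :=
  fun z => G (e.symm z.1, z.2)

variable {G : M × ℝ → M} {e : OpenPartialHomeomorph M E}

theorem contMDiffAt_symm_prod (he : e ∈ atlas E M) {y : E} (hy : y ∈ e.target) (t : ℝ) :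
    ContMDiffAt 𝓘(ℝ, E × ℝ) (𝓘(ℝ, E).prod 𝓘(ℝ, ℝ)) ∞
      (fun z : E × ℝ => (e.symm z.1, z.2)) (y, t) := by
  have h1 : ContMDiffAt 𝓘(ℝ, E) 𝓘(ℝ, E) ∞ e.symm y :=
    (contMDiffOn_symm_of_mem_maximalAtlas (IsManifold.subset_maximalAtlas (n := ∞) he)).contMDiffAt
      (e.open_target.mem_nhds hy)
  refine ContMDiffAt.prodMk ?_ ?_
  · exact ContMDiffAt.comp (y, t) (g := e.symm) (f := fun z : E × ℝ => z.1) h1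
      contDiff_fst.contMDiff.contMDiffAt
  · exact contDiff_snd.contMDiff.contMDiffAt

theorem contMDiffAt_timeChart (he : e ∈ atlas E M) {y : E} (hy : y ∈ e.target) {t : ℝ}
    (hG : ContMDiffAt (𝓘(ℝ, E).prod 𝓘(ℝ, ℝ)) 𝓘(ℝ, E) ∞ G (e.symm y, t)) :
    ContMDiffAt 𝓘(ℝ, E × ℝ) 𝓘(ℝ, E) ∞ (timeChart e G) (y, t) :=
  ContMDiffAt.comp (y, t) (g := G) (f := fun z : E × ℝ => (e.symm z.1, z.2)) hG
    (contMDiffAt_symm_prod he hy t)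

theorem mfderiv_timeChart (he : e ∈ atlas E M) {y : E} (hy : y ∈ e.target) {t : ℝ}
    (hG : ContMDiffAt (𝓘(ℝ, E).prod 𝓘(ℝ, ℝ)) 𝓘(ℝ, E) ∞ G (e.symm y, t)) (v : E) (s : ℝ) :
    (mfderiv 𝓘(ℝ, E × ℝ) 𝓘(ℝ, E) (timeChart e G) (y, t) : E × ℝ →L[ℝ] E) (v, s) =
      (mfderiv (𝓘(ℝ, E).prod 𝓘(ℝ, ℝ)) 𝓘(ℝ, E) G (e.symm y, t) : E × ℝ →L[ℝ] E)
        ((mfderiv 𝓘(ℝ, E) 𝓘(ℝ, E) e.symm y : E →L[ℝ] E) v, s) := by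
  have h1 : MDifferentiableAt 𝓘(ℝ, E) 𝓘(ℝ, E) e.symm y :=
    ((contMDiffOn_symm_of_mem_maximalAtlas (IsManifold.subset_maximalAtlas (n := ∞) he)).contMDiffAt
      (e.open_target.mem_nhds hy)).mdifferentiableAt (n := ∞) (by simp)
  have hf : MDifferentiableAt 𝓘(ℝ, E × ℝ) 𝓘(ℝ, E) (fun z : E × ℝ => z.1) (y, t) :=
    contDiff_fst.contMDiff.contMDiffAt.mdifferentiableAt (n := ∞) (by simp)
  have hs : MDifferentiableAt 𝓘(ℝ, E × ℝ) 𝓘(ℝ, ℝ) (fun z : E × ℝ => z.2) (y, t) :=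
    contDiff_snd.contMDiff.contMDiffAt.mdifferentiableAt (n := ∞) (by simp)
  have h2 := mfderiv_comp (y, t) (g := G) (f := fun z : E × ℝ => (e.symm z.1, z.2))
    (hG.mdifferentiableAt (n := ∞) (by simp))
    ((contMDiffAt_symm_prod he hy t).mdifferentiableAt (n := ∞) (by simp))
  have h3 := mfderiv_prodMk (I := 𝓘(ℝ, E × ℝ)) (I' := 𝓘(ℝ, E)) (I'' := 𝓘(ℝ, ℝ))
    (f := fun z : E × ℝ => e.symm z.1) (g := fun z : E × ℝ => z.2) (x := (y, t))
    (MDifferentiableAt.comp (y, t) (g := e.symm) h1 hf) hs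
  have h4 := mfderiv_comp (y, t) (g := e.symm) (f := fun z : E × ℝ => z.1) h1 hf
  have h5 : mfderiv 𝓘(ℝ, E × ℝ) 𝓘(ℝ, E) (fun z : E × ℝ => z.1) (y, t) =
      ContinuousLinearMap.fst ℝ E ℝ := by
    rw [mfderiv_eq_fderiv]
    exact fderiv_fst
  have h6 : mfderiv 𝓘(ℝ, E × ℝ) 𝓘(ℝ, ℝ) (fun z : E × ℝ => z.2) (y, t) =
      ContinuousLinearMap.snd ℝ E ℝ := by
    rw [mfderiv_eq_fderiv]
    exact fderiv_snd
  have h7 : mfderiv 𝓘(ℝ, E × ℝ) 𝓘(ℝ, E) (fun z : E × ℝ => e.symm z.1) (y, t) =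
      (mfderiv 𝓘(ℝ, E) 𝓘(ℝ, E) e.symm y : E →L[ℝ] E).comp (ContinuousLinearMap.fst ℝ E ℝ) := by
    refine h4.trans ?_
    rw [h5]
    rfl
  rw [h7, h6] at h3
  refine (congrArg (fun L : E × ℝ →L[ℝ] E => L (v, s)) h2).trans ?_
  exact congrArg (mfderiv (𝓘(ℝ, E).prod 𝓘(ℝ, ℝ)) 𝓘(ℝ, E) G (e.symm y, t) : E × ℝ →L[ℝ] E)
    (congrArg (fun L : E × ℝ →L[ℝ] E × ℝ => L (v, s)) h3)

theorem mfderiv_symm_comp_mfderiv (he : e ∈ atlas E M) {y : E} (hy : y ∈ e.target) :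
    (mfderiv 𝓘(ℝ, E) 𝓘(ℝ, E) e.symm y : E →L[ℝ] E).comp
      (mfderiv 𝓘(ℝ, E) 𝓘(ℝ, E) e (e.symm y) : E →L[ℝ] E) = ContinuousLinearMap.id ℝ E := by
  have hx := e.map_target hy
  have h3 : MDifferentiableAt 𝓘(ℝ, E) 𝓘(ℝ, E) e.symm (e (e.symm y)) := by
    rw [e.right_inv hy]
    exact ((contMDiffOn_symm_of_mem_maximalAtlas
      (IsManifold.subset_maximalAtlas (n := ∞) he)).contMDiffAt
      (e.open_target.mem_nhds hy)).mdifferentiableAt (n := ∞) (by simp)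
  have h4 : MDifferentiableAt 𝓘(ℝ, E) 𝓘(ℝ, E) e (e.symm y) :=
    ((contMDiffOn_of_mem_maximalAtlas (IsManifold.subset_maximalAtlas (n := ∞) he)).contMDiffAt
      (e.open_source.mem_nhds hx)).mdifferentiableAt (n := ∞) (by simp)
  have h5 : mfderiv 𝓘(ℝ, E) 𝓘(ℝ, E) (e.symm ∘ e) (e.symm y) = ContinuousLinearMap.id ℝ E := by
    refine Eq.trans (Filter.EventuallyEq.mfderiv_eq (f := fun z : M => z) ?_) mfderiv_id
    filter_upwards [e.open_source.mem_nhds hx] with z hz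
    exact e.left_inv hz
  have h6 := (mfderiv_comp (e.symm y) h3 h4).symm.trans h5
  rw [e.right_inv hy] at h6
  exact h6

/-- The integrand of the homotopy operator. -/
def homotopyIntegrand (G : M × ℝ → M) {n : ℕ} (θ : FormField E M (n + 1)) (x : M) (t : ℝ) :
    E [⋀^Fin n]→L[ℝ] ℝ :=
  contractTime E n ((θ (G (x, t)) : E [⋀^Fin (n + 1)]→L[ℝ] ℝ).compContinuousLinearMap
    (mfderiv (𝓘(ℝ, E).prod 𝓘(ℝ, ℝ)) 𝓘(ℝ, E) G (x, t) : E × ℝ →L[ℝ] E))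

/-- The integral over `[0, 1]` defining the homotopy operator. -/
def homotopyIntegral (G : M × ℝ → M) {n : ℕ} (θ : FormField E M (n + 1)) (x : M) :
    E [⋀^Fin n]→L[ℝ] ℝ :=
  ∫ t in (0 : ℝ)..1, homotopyIntegrand G θ x t

open Classical in
/-- The homotopy operator of a smooth homotopy `G` on `W`. -/
def homotopyOperator (W : Set M) (G : M × ℝ → M) {n : ℕ} (θ : FormField E M (n + 1)) :
    FormField E M n := fun x =>
  if x ∈ W then homotopyIntegral (E := E) G θ x else 0

/-- The pull-back of a form along `timeChart`. -/
def pullTimeChart (e : OpenPartialHomeomorph M E) (G : M × ℝ → M) {n : ℕ} (θ : FormField E M n) :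
    E × ℝ → (E × ℝ) [⋀^Fin n]→L[ℝ] ℝ :=
  pull (E := E × ℝ) (M := E × ℝ) (timeChart e G) θ

theorem pullTimeChart_apply (he : e ∈ atlas E M) {y : E} (hy : y ∈ e.target) {t : ℝ}
    (hG : ContMDiffAt (𝓘(ℝ, E).prod 𝓘(ℝ, ℝ)) 𝓘(ℝ, E) ∞ G (e.symm y, t)) {n : ℕ}
    (θ : FormField E M n) (v : Fin n → E × ℝ) :
    pullTimeChart e G θ (y, t) v =
      (θ (G (e.symm y, t)) : E [⋀^Fin n]→L[ℝ] ℝ) (fun i =>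
        (mfderiv (𝓘(ℝ, E).prod 𝓘(ℝ, ℝ)) 𝓘(ℝ, E) G (e.symm y, t) : E × ℝ →L[ℝ] E)
        ((mfderiv 𝓘(ℝ, E) 𝓘(ℝ, E) e.symm y : E →L[ℝ] E) (v i).1, (v i).2)) :=
  congrArg (θ (G (e.symm y, t)) : E [⋀^Fin n]→L[ℝ] ℝ)
    (funext fun i => mfderiv_timeChart he hy hG (v i).1 (v i).2)

/-- The chart acts only on the space variable, so contraction with the time direction commutes with
pulling back along the chart. -/
theorem contractTime_pullTimeChart (he : e ∈ atlas E M) {y : E} (hy : y ∈ e.target) {t : ℝ}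
    (hG : ContMDiffAt (𝓘(ℝ, E).prod 𝓘(ℝ, ℝ)) 𝓘(ℝ, E) ∞ G (e.symm y, t)) {n : ℕ}
    (θ : FormField E M (n + 1)) :
    contractTime E n (pullTimeChart e G θ (y, t)) =
      (homotopyIntegrand G θ (e.symm y) t).compContinuousLinearMap
        (mfderiv 𝓘(ℝ, E) 𝓘(ℝ, E) e.symm y : E →L[ℝ] E) := by
  ext v
  rw [contractTime_apply, pullTimeChart_apply he hy hG]
  refine congrArg (θ (G (e.symm y, t)) : E [⋀^Fin (n + 1)]→L[ℝ] ℝ) (funext fun i => ?_)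
  refine congrArg (mfderiv (𝓘(ℝ, E).prod 𝓘(ℝ, ℝ)) 𝓘(ℝ, E) G (e.symm y, t) : E × ℝ →L[ℝ] E) ?_
  refine Fin.cases ?_ (fun j => ?_) i
  · exact Prod.ext (map_zero _) rfl
  · rfl

/-- The operator is defined pointwise without charts. Pull-back along the chart is a continuous
linear map on forms at a point, so it passes under the time integral. -/
theorem inChart_homotopyOperator {W : Set M} (he : e ∈ atlas E M) {y : E} (hy : y ∈ e.target)
    (hyW : e.symm y ∈ W)
    (hG : ∀ t, ContMDiffAt (𝓘(ℝ, E).prod 𝓘(ℝ, ℝ)) 𝓘(ℝ, E) ∞ G (e.symm y, t)) {n : ℕ}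
    {θ : FormField E M (n + 1)} (hθ : Continuous fun t => pullTimeChart e G θ (y, t)) :
    inChart (homotopyOperator W G θ) e y = fibreIntegral (pullTimeChart e G θ) y := by
  have h1 : homotopyOperator W G θ (e.symm y) = homotopyIntegral G θ (e.symm y) := if_pos hyW
  let D : E →L[ℝ] E := mfderiv 𝓘(ℝ, E) 𝓘(ℝ, E) e.symm y
  -- Undoing the derivative of the chart transfers continuity in `t`, known for the chart
  -- expression, to the integrand itself.
  have h2 : ∀ t, homotopyIntegrand G θ (e.symm y) t =
      (contractTime E n (pullTimeChart e G θ (y, t))).compContinuousLinearMap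
        (mfderiv 𝓘(ℝ, E) 𝓘(ℝ, E) e (e.symm y) : E →L[ℝ] E) := by
    intro t
    rw [contractTime_pullTimeChart he hy (hG t)]
    ext v
    exact congrArg (homotopyIntegrand G θ (e.symm y) t) (funext fun i =>
      (congrArg (fun L : E →L[ℝ] E => L (v i)) (mfderiv_symm_comp_mfderiv he hy)).symm)
  have h3 : Continuous fun t => homotopyIntegrand G θ (e.symm y) t := by
    simp only [h2]
    exact (ContinuousAlternatingMap.compContinuousLinearMapCLM
      (mfderiv 𝓘(ℝ, E) 𝓘(ℝ, E) e (e.symm y) : E →L[ℝ] E)).continuous.comp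
      ((contractTime E n).continuous.comp hθ)
  rw [inChart, h1]
  have h4 : IntervalIntegrable (homotopyIntegrand G θ (e.symm y)) MeasureTheory.volume 0 1 :=
    h3.intervalIntegrable 0 1
  refine ((ContinuousAlternatingMap.compContinuousLinearMapCLM D).intervalIntegral_comp_comm
      h4).symm.trans ?_
  exact intervalIntegral.integral_congr fun t _ =>
    (contractTime_pullTimeChart he hy (hG t) θ).symm

end Poincare

/-- The Poincaré lemma for contractible open sets. -/
theorem exists_extD_eq {W : Set M} (hW : IsOpen W) [ContractibleSpace W] {n : ℕ}
    {θ : FormField E M (n + 1)} (hθ : θ ∈ formsOn E W (n + 1)) (hd : ∀ x ∈ W, extD θ x = 0) :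
    ∃ κ ∈ formsOn E W n, ∀ x ∈ W, extD κ x = θ x := by
  obtain ⟨G, p, hG, hGW, hG1, hG0⟩ := exists_smooth_contraction (E := E) hW
  let O : OpenPartialHomeomorph M E → Set E := fun e => e.target ∩ e.symm ⁻¹' W
  have hO : ∀ e, IsOpen (O e) := fun e => e.isOpen_inter_preimage_symm hW
  have hΓ : ∀ e ∈ atlas E M, ∀ z ∈ O e ×ˢ (univ : Set ℝ),
      ∀ᶠ z' in 𝓝 z, ContMDiffAt 𝓘(ℝ, E × ℝ) 𝓘(ℝ, E) ∞ (timeChart e G) z' := by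
    intro e he z hz
    filter_upwards [((hO e).prod isOpen_univ).mem_nhds hz] with z' hz'
    exact contMDiffAt_timeChart he hz'.1.1 (hG _ hz'.1.2 _)
  have hs : ∀ e ∈ atlas E M, ContDiffOn ℝ ∞ (pullTimeChart e G θ) (O e ×ˢ univ) := by
    intro e he z hz
    refine (smoothFormAt_iff_contDiffAt.1 ?_).contDiffWithinAt
    exact SmoothFormAt.pull (hΓ e he z hz) (hθ.1 _ (hGW _ hz.1.2 _))
  have hclosed : ∀ e ∈ atlas E M, ∀ z ∈ O e ×ˢ (univ : Set ℝ),
      extDeriv (pullTimeChart e G θ) z = 0 := by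
    intro e he z hz
    rw [← extD_eq_extDeriv]
    have h1 := hGW _ hz.1.2 z.2
    refine (pull_extD_of_contMDiffAt (hΓ e he z hz) (hθ.1 _ h1)).symm.trans ?_
    have h2 : extD θ (timeChart e G z) = 0 := hd _ h1
    ext v
    simp only [pull, h2]
    rfl
  have hκ : ∀ e ∈ atlas E M, ∀ y ∈ O e,
      inChart (homotopyOperator W G θ) e y = fibreIntegral (pullTimeChart e G θ) y := by
    intro e he y hy
    refine inChart_homotopyOperator he hy.1 hy.2 (hG _ hy.2) ?_
    rw [continuous_iff_continuousAt]
    intro t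
    exact ContinuousAt.comp (g := pullTimeChart e G θ) (f := fun t : ℝ => (y, t))
      ((hs e he).contDiffAt (((hO e).prod isOpen_univ).mem_nhds
        (show (y, t) ∈ O e ×ˢ univ from ⟨hy, mem_univ t⟩))).continuousAt (by fun_prop)
  have hxO : ∀ x ∈ W, chartAt E x x ∈ O (chartAt E x) := fun x hx =>
    ⟨(chartAt E x).map_source (mem_chart_source E x), by
      rw [mem_preimage, (chartAt E x).left_inv (mem_chart_source E x)]
      exact hx⟩
  have hsm : ∀ x ∈ W, SmoothFormAt (homotopyOperator W G θ) x := by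
    intro x hx
    have he := chart_mem_atlas E x
    refine ContDiffAt.congr_of_eventuallyEq
      ((contDiffOn_fibreIntegral (hO _) (hs _ he)).contDiffAt ((hO _).mem_nhds (hxO x hx))) ?_
    filter_upwards [(hO _).mem_nhds (hxO x hx)] with y hy
    exact hκ _ he y hy
  refine ⟨homotopyOperator W G θ, ⟨hsm, fun x hx => if_neg hx⟩, fun x hx => ?_⟩
  have he := chart_mem_atlas E x
  have hx' := mem_chart_source E x
  have hOx := hxO x hx
  set e := chartAt E x with he_def
  refine eq_of_inChart_eq he hx' ?_
  rw [inChart_extD_of_smoothFormAt he hOx.1 (hsm _ hOx.2)]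
  have h1 : inChart (homotopyOperator W G θ) e =ᶠ[𝓝 (e x)] fibreIntegral (pullTimeChart e G θ) := by
    filter_upwards [(hO _).mem_nhds hOx] with y hy
    exact hκ _ he y hy
  rw [h1.extDeriv_eq]
  ext v
  rw [extDeriv_fibreIntegral (hO e) (hs e he) (hclosed e he) hOx v]
  -- On vectors tangent to the slice at time `t`, the derivative of the homotopy is the derivative
  -- of the slice map.
  have hev : ∀ t : ℝ, ∀ (f : E → M), (∀ y ∈ O e, timeChart e G (y, t) = f y) → ∀ w : E,
      (mfderiv 𝓘(ℝ, E × ℝ) 𝓘(ℝ, E) (timeChart e G) (e x, t) : E × ℝ →L[ℝ] E) (w, 0) =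
        (mfderiv 𝓘(ℝ, E) 𝓘(ℝ, E) f (e x) : E →L[ℝ] E) w := by
    intro t f hf w
    have h2 : MDifferentiableAt 𝓘(ℝ, E) 𝓘(ℝ, E × ℝ) (fun y : E => (y, t)) (e x) :=
      (contDiff_prodMk_left t).contMDiff.contMDiffAt.mdifferentiableAt (n := ∞) (by simp)
    have h3 := mfderiv_comp (e x) (g := timeChart e G) (f := fun y : E => (y, t))
      ((hΓ e he (e x, t) ⟨hOx, mem_univ t⟩).self_of_nhds.mdifferentiableAt
        (n := ∞) (by simp)) h2
    have h4 : mfderiv 𝓘(ℝ, E) 𝓘(ℝ, E × ℝ) (fun y : E => (y, t)) (e x) =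
        ContinuousLinearMap.inl ℝ E ℝ := by
      rw [mfderiv_eq_fderiv]
      exact (hasFDerivAt_prodMk_left (e x) t).fderiv
    have h5 : mfderiv 𝓘(ℝ, E) 𝓘(ℝ, E) (timeChart e G ∘ fun y : E => (y, t)) (e x) =
        mfderiv 𝓘(ℝ, E) 𝓘(ℝ, E) f (e x) := by
      refine Filter.EventuallyEq.mfderiv_eq ?_
      filter_upwards [(hO _).mem_nhds hOx] with y hy
      exact hf y hy
    rw [← h5, h3, h4]
    rfl
  have hpt : ∀ (a b : M) (_ : a = b) (w : Fin (n + 1) → E),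
      (θ a : E [⋀^Fin (n + 1)]→L[ℝ] ℝ) w = θ b w := by
    rintro a _ rfl w
    rfl
  have h6 : pullTimeChart e G θ (e x, 1) (fun i => (v i, 0)) = inChart θ e (e x) v := by
    have h7 : ∀ y ∈ O e, timeChart e G (y, 1) = e.symm y := fun y hy => hG1 _ hy.2
    refine Eq.trans ?_ (hpt _ _ (h7 _ hOx) _)
    exact congrArg (θ (timeChart e G (e x, 1)) : E [⋀^Fin (n + 1)]→L[ℝ] ℝ)
      (funext fun i => hev 1 e.symm h7 (v i))
  have h8 : pullTimeChart e G θ (e x, 0) (fun i => (v i, 0)) = 0 := by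
    have h7 : ∀ y ∈ O e, timeChart e G (y, 0) = (fun _ => p) y := fun y hy => hG0 _ hy.2
    -- The slice at time `0` is constant, so its derivative kills every argument. There is a first
    -- argument because the degree is `n + 1`.
    refine ContinuousAlternatingMap.map_coord_zero
      (θ (timeChart e G (e x, 0)) : E [⋀^Fin (n + 1)]→L[ℝ] ℝ) 0 ?_
    refine (hev 0 (fun _ => p) h7 (v 0)).trans ?_
    rw [mfderiv_const]
    rfl
  rw [h6, h8, sub_zero]

end Forms

/-! ### Closed forms of degree zero -/

namespace Forms

section DegreeZero

variable {E : Type*} [NormedAddCommGroup E] [NormedSpace ℝ E]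
  {M : Type*} [TopologicalSpace M] [ChartedSpace E M]

variable (E) in
/-- A function, considered as a form of degree `0`. -/
def constForm (f : M → ℝ) : FormField E M 0 := fun x =>
  (ContinuousAlternatingMap.constOfIsEmpty ℝ E (Fin 0) (f x) : E [⋀^Fin 0]→L[ℝ] ℝ)

theorem smoothFormAt_constForm_const (c : ℝ) (x : M) : SmoothFormAt (constForm E fun _ => c) x :=
  contDiffAt_const (c := ContinuousAlternatingMap.constOfIsEmpty ℝ E (Fin 0) c)

theorem extD_constForm_const (c : ℝ) (x : M) : extD (constForm E fun _ : M => c) x = 0 := by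
  have h : extDeriv (inChart (constForm E fun _ : M => c) (chartAt E x)) (chartAt E x x) = 0 := by
    change extDeriv (fun _ => ContinuousAlternatingMap.constOfIsEmpty ℝ E (Fin 0) c) _ = 0
    ext v
    rw [extDeriv_apply (differentiableAt_const _)]
    simp
  ext v
  simp only [extD, h]
  rfl

theorem smoothFormAt_constForm {f : M → ℝ} {x : M} (h : ∀ᶠ z in 𝓝 x, f z = f x) :
    SmoothFormAt (constForm E f) x := by
  refine (smoothFormAt_constForm_const (f x) x).congr ?_
  filter_upwards [h] with z hz
  simp only [constForm, hz]
  rfl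

theorem extD_constForm {f : M → ℝ} {x : M} (h : ∀ᶠ z in 𝓝 x, f z = f x) :
    extD (constForm E f) x = 0 := by
  rw [← extD_constForm_const (f x) x]
  refine extD_congr ?_
  filter_upwards [h] with z hz
  simp only [constForm, hz]
  rfl

/-- In a chart the hypothesis says that an ordinary derivative vanishes, so the function is constant
on a ball. -/
theorem eventually_eq_of_extD_eq_zero [IsManifold 𝓘(ℝ, E) ∞ M] {W : Set M} (hW : IsOpen W)
    {θ : FormField E M 0} (hθ : θ ∈ formsOn E W 0) (hd : ∀ x ∈ W, extD θ x = 0) {x : M}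
    (hx : x ∈ W) : ∀ᶠ z in 𝓝 x, (θ z : E [⋀^Fin 0]→L[ℝ] ℝ) 0 = (θ x : E [⋀^Fin 0]→L[ℝ] ℝ) 0 := by
  have he := chart_mem_atlas E x
  have hx' := mem_chart_source E x
  set e := chartAt E x
  have hO : IsOpen (e.target ∩ e.symm ⁻¹' W) := e.isOpen_inter_preimage_symm hW
  have hxO : e x ∈ e.target ∩ e.symm ⁻¹' W := ⟨e.map_source hx', by
    rw [mem_preimage, e.left_inv hx']
    exact hx⟩
  obtain ⟨r, hr, hball⟩ := Metric.isOpen_iff.1 hO _ hxO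
  have hs : ∀ y ∈ e.target ∩ e.symm ⁻¹' W, ContDiffAt ℝ ∞ (inChart θ e) y := fun y hy =>
    (hθ.1 _ hy.2).contDiffAt he hy.1
  have hg : ∀ y ∈ e.target ∩ e.symm ⁻¹' W, DifferentiableAt ℝ (fun z => inChart θ e z 0) y :=
    fun y hy => (ContinuousAlternatingMap.apply ℝ E ℝ (0 : Fin 0 → E)).differentiableAt.comp y
      ((hs y hy).differentiableAt (by simp))
  have h0 : ∀ y ∈ e.target ∩ e.symm ⁻¹' W, fderiv ℝ (fun z => inChart θ e z 0) y = 0 := by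
    intro y hy
    have h1 : extDeriv (inChart θ e) y = 0 := by
      rw [← inChart_extD_of_smoothFormAt he hy.1 (hθ.1 _ hy.2)]
      have := hd _ hy.2
      ext v
      simp only [inChart, this]
      rfl
    ext w
    have h2 := congrArg (fun L => L fun _ => w) h1
    simp only [extDeriv_apply ((hs y hy).differentiableAt (by simp))] at h2
    rw [Fin.sum_univ_one] at h2
    simp only [Fin.val_zero, pow_zero, one_smul] at h2
    have h3 : (0 : Fin 1).removeNth (fun _ : Fin 1 => w) = 0 := Subsingleton.elim _ _
    rw [h3] at h2
    exact h2
  have hconst : ∀ y ∈ Metric.ball (e x) r, inChart θ e y 0 = inChart θ e (e x) 0 := by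
    intro y hy
    refine Metric.isOpen_ball.is_const_of_fderiv_eq_zero (𝕜 := ℝ)
      (convex_ball (e x) r).isPreconnected
      (fun z hz => (hg z (hball hz)).differentiableWithinAt) (fun z hz => ?_) hy
      (Metric.mem_ball_self hr)
    exact h0 z (hball hz)
  have hval : ∀ z ∈ e.source, inChart θ e (e z) 0 = (θ z : E [⋀^Fin 0]→L[ℝ] ℝ) 0 := by
    intro z hz
    have h4 : ∀ (a b : M) (_ : a = b) (v : Fin 0 → E), (θ a : E [⋀^Fin 0]→L[ℝ] ℝ) v =
        (θ b : E [⋀^Fin 0]→L[ℝ] ℝ) 0 := by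
      rintro a _ rfl v
      exact congrArg (θ a : E [⋀^Fin 0]→L[ℝ] ℝ) (Subsingleton.elim v 0)
    exact h4 _ _ (e.left_inv hz) _
  filter_upwards [e.open_source.mem_nhds hx', (e.continuousAt hx').eventually
    (Metric.ball_mem_nhds _ hr)] with z hz hz'
  rw [← hval z hz, ← hval x hx', hconst _ hz']

end DegreeZero

/-! ### Restriction of forms to subsets -/

section Restrict

variable {E : Type*} [NormedAddCommGroup E] [NormedSpace ℝ E]
  {M : Type*} [TopologicalSpace M] [ChartedSpace E M]

open Classical in
/-- The form which agrees with `θ` on `W` and vanishes elsewhere. -/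
def restr (W : Set M) (n : ℕ) : FormField E M n →ₗ[ℝ] FormField E M n where
  toFun θ x := if x ∈ W then θ x else 0
  map_add' θ η := by
    funext x
    by_cases h : x ∈ W <;> simp [h]
  map_smul' c θ := by
    funext x
    by_cases h : x ∈ W <;> simp [h]

variable {W W' : Set M} {n : ℕ} {θ η : FormField E M n}

theorem restr_of_mem {x : M} (hx : x ∈ W) : restr W n θ x = θ x := if_pos hx

theorem restr_of_notMem {x : M} (hx : x ∉ W) : restr W n θ x = 0 := if_neg hx

theorem restr_eq_restr (h : ∀ x ∈ W, θ x = η x) : restr W n θ = restr W n η := by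
  funext x
  by_cases hx : x ∈ W
  · rw [restr_of_mem hx, restr_of_mem hx, h x hx]
  · rw [restr_of_notMem hx, restr_of_notMem hx]

theorem restr_eq_self (h : θ ∈ formsOn E W n) : restr W n θ = θ := by
  funext x
  by_cases hx : x ∈ W
  · rw [restr_of_mem hx]
  · rw [restr_of_notMem hx, h.2 x hx]

theorem restr_eventuallyEq (hW : IsOpen W) {x : M} (hx : x ∈ W) :
    ∀ᶠ z in 𝓝 x, restr W n θ z = θ z := by
  filter_upwards [hW.mem_nhds hx] with z hz
  exact restr_of_mem hz

theorem restr_mem (hW : IsOpen W) (h : ∀ x ∈ W, SmoothFormAt θ x) : restr W n θ ∈ formsOn E W n :=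
  ⟨fun x hx => (h x hx).congr (restr_eventuallyEq hW hx), fun _ hx => restr_of_notMem hx⟩

variable (E) in
/-- The exterior derivative of forms on `W`. -/
def dOn (W : Set M) (n : ℕ) (θ : FormField E M n) : FormField E M (n + 1) :=
  restr W (n + 1) (extD θ)

theorem dOn_of_mem {x : M} (hx : x ∈ W) : dOn E W n θ x = extD θ x := restr_of_mem hx

theorem dOn_congr (h : ∀ x ∈ W, ∀ᶠ z in 𝓝 x, θ z = η z) : dOn E W n θ = dOn E W n η :=
  restr_eq_restr fun x hx => extD_congr (h x hx)

theorem dOn_mem [IsManifold 𝓘(ℝ, E) ∞ M] (hW : IsOpen W) (h : ∀ x ∈ W, SmoothFormAt θ x) :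
    dOn E W n θ ∈ formsOn E W (n + 1) :=
  restr_mem hW fun x hx => SmoothFormAt.extD (by
    filter_upwards [hW.mem_nhds hx] with z hz using h z hz)

theorem dOn_dOn [IsManifold 𝓘(ℝ, E) ∞ M] (hW : IsOpen W) (h : ∀ x ∈ W, SmoothFormAt θ x) :
    dOn E W (n + 1) (dOn E W n θ) = 0 := by
  refine (dOn_congr (θ := dOn E W n θ) (η := extD θ)
    fun x hx => restr_eventuallyEq hW hx).trans ?_
  refine (restr_eq_restr (η := 0) fun x hx => ?_).trans (map_zero _)
  exact extD_extD_of_smoothFormAt (by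
    filter_upwards [hW.mem_nhds hx] with z hz using h z hz)

theorem dOn_add (hθ : ∀ x ∈ W, SmoothFormAt θ x) (hη : ∀ x ∈ W, SmoothFormAt η x) :
    dOn E W n (θ + η) = dOn E W n θ + dOn E W n η := by
  rw [dOn, dOn, dOn, ← map_add]
  exact restr_eq_restr fun x hx => extD_add_of_smoothFormAt (hθ x hx) (hη x hx)

theorem dOn_smul (c : ℝ) : dOn E W n (c • θ) = c • dOn E W n θ := by
  rw [dOn, dOn, ← map_smul]
  exact restr_eq_restr fun x _ => extD_const_smul c θ x

end Restrict

end Forms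

/-! ### Families indexed by tuples -/

namespace Cech

section Families

variable {I : Type*} {A : Type*} [AddCommGroup A] [Module ℝ A] {p : ℕ}

/-- The alternating sum `∑ i, (-1)^i f_{α 0 ⋯ (omit α i) ⋯ α (p+1)}`. -/
def famD (f : (Fin (p + 1) → I) → A) (α : Fin (p + 2) → I) : A :=
  ∑ i : Fin (p + 2), (-1 : ℝ) ^ (i : ℕ) • f (α ∘ i.succAbove)

/-- A family of elements as a family of constant functions on the one-point space. -/
def constFam (f : (Fin (p + 1) → I) → A) (α : Fin (p + 1) → I) :
    LocallyConstant (inter (fun _ : I => (⊤ : Opens PUnit.{1})) α) A :=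
  LocallyConstant.const _ (f α)

/-- Arbitrary families are Čech cochains of the one-point space covered by copies of itself. The
identity `δ² = 0` and the preservation of antisymmetry are thus inherited from `dAux`. -/
theorem dAux_constFam (f : (Fin (p + 1) → I) → A) :
    dAux (fun _ : I => (⊤ : Opens PUnit.{1})) ℝ A p (constFam f) = constFam (famD f) := by
  funext α
  ext x
  rw [dAux_apply]
  rfl

omit [AddCommGroup A] [Module ℝ A] in
theorem constFam_injective :
    Function.Injective (constFam : ((Fin (p + 1) → I) → A) → _) := fun f g h => by
  funext α
  exact congrArg (fun g => g α ⟨PUnit.unit, fun _ => trivial⟩) h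

theorem famD_famD (f : (Fin (p + 1) → I) → A) : famD (famD f) = 0 := by
  refine constFam_injective ?_
  rw [← dAux_constFam, ← dAux_constFam, dAux_dAux]
  rfl

variable (I A p) in
/-- Antisymmetric families. -/
def antisymm : Submodule ℝ ((Fin (p + 1) → I) → A) where
  carrier := {f | ∀ (σ : Equiv.Perm (Fin (p + 1))) (α : Fin (p + 1) → I),
    f (α ∘ σ) = (Equiv.Perm.sign σ : ℤ) • f α}
  add_mem' {f g} hf hg σ α := by
    simp only [Pi.add_apply, hf σ α, hg σ α, smul_add]
  zero_mem' σ α := by simp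
  smul_mem' c f hf σ α := by
    simp only [Pi.smul_apply, hf σ α]
    exact smul_comm _ _ _

theorem famD_mem {f : (Fin (p + 1) → I) → A} (hf : f ∈ antisymm I A p) :
    famD f ∈ antisymm I A (p + 1) := by
  have h := dAux_mem (fun _ : I => (⊤ : Opens PUnit.{1})) ℝ A p (f := constFam f)
    fun σ α _ => hf σ α
  rw [dAux_constFam] at h
  exact fun σ α => h σ α ⟨PUnit.unit, fun _ => trivial⟩

/-- The identity behind the contracting homotopy of the rows: inserting an index in front
anticommutes with `δ` up to the identity. -/
theorem famD_cons (f : (Fin (p + 1) → I) → A) (i : I) (α : Fin (p + 1) → I) :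
    famD f (Fin.cons i α) = f α -
      ∑ k : Fin (p + 1), (-1 : ℝ) ^ (k : ℕ) • f (Fin.cons i (α ∘ k.succAbove)) := by
  have h0 : (Fin.cons i α : Fin (p + 2) → I) ∘ (0 : Fin (p + 2)).succAbove = α := by
    funext j
    simp
  have h1 : ∀ k : Fin (p + 1), (Fin.cons i α : Fin (p + 2) → I) ∘ k.succ.succAbove =
      (Fin.cons i (α ∘ k.succAbove) : Fin (p + 1) → I) := by
    intro k
    funext j
    refine Fin.cases ?_ (fun j => ?_) j <;> simp
  rw [famD, Fin.sum_univ_succ, h0, sub_eq_add_neg, ← Finset.sum_neg_distrib]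
  simp only [h1, Fin.val_zero, pow_zero, one_smul, Fin.val_succ, pow_succ, mul_neg, mul_one,
    neg_smul]

theorem exists_perm_cons {n : ℕ} (σ : Equiv.Perm (Fin n)) :
    ∃ τ : Equiv.Perm (Fin (n + 1)), Equiv.Perm.sign τ = Equiv.Perm.sign σ ∧
      ∀ (i : I) (α : Fin n → I),
        (Fin.cons i α : Fin (n + 1) → I) ∘ τ = (Fin.cons i (α ∘ σ) : Fin (n + 1) → I) := by
  refine ⟨Equiv.Perm.decomposeFin.symm (0, σ), by simp, fun i α => ?_⟩
  funext j
  refine Fin.cases ?_ (fun j => ?_) j <;> simp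

/-- The antisymmetrization of a family. -/
def antisymmetrize (f : (Fin (p + 1) → I) → A) (α : Fin (p + 1) → I) : A :=
  ((p + 1).factorial : ℝ)⁻¹ •
    ∑ σ : Equiv.Perm (Fin (p + 1)), ((Equiv.Perm.sign σ : ℤ) : ℝ) • f (α ∘ σ)

theorem antisymmetrize_mem (f : (Fin (p + 1) → I) → A) : antisymmetrize f ∈ antisymm I A p := by
  intro τ α
  rw [antisymmetrize, antisymmetrize, smul_comm (Equiv.Perm.sign τ : ℤ)]
  refine congrArg (fun a : A => ((p + 1).factorial : ℝ)⁻¹ • a) ?_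
  rw [Finset.smul_sum]
  refine Fintype.sum_equiv (Equiv.mulLeft τ) _ _ fun σ => ?_
  rw [← Int.cast_smul_eq_zsmul ℝ, smul_smul]
  congr 1
  simp only [Equiv.coe_mulLeft, Equiv.Perm.sign_mul, Units.val_mul, Int.cast_mul, ← mul_assoc]
  rw [← Int.cast_mul, ← Units.val_mul, Int.units_mul_self]
  simp

end Families

section inter

variable {M I : Type*} [TopologicalSpace M] (U : I → Opens M) {p q : ℕ} (α : Fin (p + 1) → I)

theorem isOpen_inter : IsOpen (inter U α) := by
  rw [show inter U α = ⋂ k, (U (α k) : Set M) by ext x; simp [inter]]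
  exact isOpen_iInter_of_finite fun k => (U (α k)).isOpen

theorem inter_subset (s : Fin (q + 1) → Fin (p + 1)) : inter U α ⊆ inter U (α ∘ s) :=
  fun _ hx k => hx (s k)

/-- Equality of sets lets components with permuted indices be compared as forms cut off to the same
set. -/
theorem inter_comp_perm (σ : Equiv.Perm (Fin (p + 1))) : inter U (α ∘ σ) = inter U α :=
  Subset.antisymm (fun _ hx k => by simpa using hx (σ.symm k)) (inter_subset U α σ)

theorem mem_inter_cons {i : I} {x : M} : x ∈ inter U (Fin.cons i α : Fin (p + 2) → I) ↔
    x ∈ U i ∧ x ∈ inter U α := by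
  simp only [inter, mem_ofPred_eq, Fin.forall_fin_succ (n := p + 1), Fin.cons_zero, Fin.cons_succ]

end inter

end Cech

/-! ### The Čech–de Rham double complex -/

namespace Forms

open Cech

section CechDeRham

variable (E : Type*) [NormedAddCommGroup E] [NormedSpace ℝ E]
  {M : Type*} [TopologicalSpace M] [ChartedSpace E M]
  {I : Type*} (U : I → Opens M)

/-- Antisymmetric families of smooth forms on the intersections of the members of a cover. -/
def cechForms (p q : ℕ) : Submodule ℝ ((Fin (p + 1) → I) → FormField E M q) :=
  Submodule.pi univ (fun α => formsOn E (inter U α) q) ⊓ antisymm I (FormField E M q) p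

variable {E U} {p q : ℕ}

theorem mem_cechForms {f : (Fin (p + 1) → I) → FormField E M q} : f ∈ cechForms E U p q ↔
    (∀ α, f α ∈ formsOn E (inter U α) q) ∧ f ∈ antisymm I (FormField E M q) p := by
  simp [cechForms]

theorem cechForms_mem (f : cechForms E U p q) (α : Fin (p + 1) → I) :
    f.1 α ∈ formsOn E (inter U α) q := (mem_cechForms.1 f.2).1 α

theorem cechForms_perm (f : cechForms E U p q) (σ : Equiv.Perm (Fin (p + 1)))
    (α : Fin (p + 1) → I) : f.1 (α ∘ σ) = (Equiv.Perm.sign σ : ℤ) • f.1 α :=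
  (mem_cechForms.1 f.2).2 σ α

theorem smoothFormAt_famD (f : cechForms E U p q) {α : Fin (p + 2) → I} {x : M}
    (hx : x ∈ inter U α) : SmoothFormAt (famD f.1 α) x :=
  SmoothFormAt.sum fun i _ =>
    ((cechForms_mem f _).1 x (inter_subset U α i.succAbove hx)).const_smul _

theorem cechForms_ext {f g : cechForms E U p q} (h : ∀ α, ∀ x ∈ inter U α, f.1 α x = g.1 α x) :
    f = g := by
  refine Subtype.ext (funext fun α => ?_)
  rw [← restr_eq_self (cechForms_mem f α), ← restr_eq_self (cechForms_mem g α)]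
  exact restr_eq_restr (h α)

theorem restr_family_antisymm {f : (Fin (p + 1) → I) → FormField E M q}
    (hf : f ∈ antisymm I (FormField E M q) p) :
    (fun α => restr (inter U α) q (f α)) ∈ antisymm I (FormField E M q) p := by
  intro σ α
  change restr (inter U (α ∘ σ)) q (f (α ∘ σ)) = _ • restr (inter U α) q (f α)
  rw [inter_comp_perm, hf σ α, map_zsmul]

variable (E U p q) in
/-- The Čech differential of the Čech–de Rham complex. -/
def cechD : cechForms E U p q →ₗ[ℝ] cechForms E U (p + 1) q where
  toFun f := ⟨fun α => restr (inter U α) q (famD f.1 α), mem_cechForms.2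
    ⟨fun α => restr_mem (isOpen_inter U α) fun _ hx => smoothFormAt_famD f hx,
      restr_family_antisymm (famD_mem (mem_cechForms.1 f.2).2)⟩⟩
  map_add' f g := Subtype.ext <| funext fun α => by
    refine Eq.trans ?_ (map_add (restr (inter U α) q) _ _)
    simp only [famD, ← Finset.sum_add_distrib, ← smul_add]
    rfl
  map_smul' c f := Subtype.ext <| funext fun α => by
    refine Eq.trans ?_ (map_smul (restr (inter U α) q) c _)
    simp only [famD, Finset.smul_sum, smul_comm c]
    rfl

theorem cechD_apply (f : cechForms E U p q) {α : Fin (p + 2) → I} {x : M} (hx : x ∈ inter U α) :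
    (cechD E U p q f).1 α x = famD f.1 α x := restr_of_mem hx

theorem famD_apply (f : (Fin (p + 1) → I) → FormField E M q) (α : Fin (p + 2) → I) (x : M) :
    famD f α x = ∑ i : Fin (p + 2), (-1 : ℝ) ^ (i : ℕ) • f (α ∘ i.succAbove) x := by
  simp [famD, Finset.sum_apply]

theorem cechD_cechD (f : cechForms E U p q) : cechD E U (p + 1) q (cechD E U p q f) = 0 := by
  refine cechForms_ext fun α x hx => ?_
  rw [cechD_apply _ hx, famD_apply]
  have h : ∀ i : Fin (p + 3), (cechD E U p q f).1 (α ∘ i.succAbove) x =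
      famD f.1 (α ∘ i.succAbove) x := fun i => cechD_apply _ (inter_subset U α i.succAbove hx)
  simp only [h]
  rw [← famD_apply, famD_famD]
  rfl

variable [IsManifold 𝓘(ℝ, E) ∞ M]

/-- The family of exterior derivatives of the members of a family. -/
def derFam (f : cechForms E U p q) : cechForms E U p (q + 1) :=
  ⟨fun α => dOn E (inter U α) q (f.1 α), mem_cechForms.2
    ⟨fun α => dOn_mem (isOpen_inter U α) (cechForms_mem f α).1, fun σ α => by
      change dOn E (inter U (α ∘ σ)) q (f.1 (α ∘ σ)) = _
      rw [inter_comp_perm, cechForms_perm f, ← Int.cast_smul_eq_zsmul ℝ, dOn_smul]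
      exact Int.cast_smul_eq_zsmul ℝ (Equiv.Perm.sign σ : ℤ) (dOn E (inter U α) q (f.1 α))⟩⟩

variable (E U) in
/-- The exterior derivative of the Čech–de Rham complex, with the sign `(-1)^p`. -/
def derD (p q : ℕ) : cechForms E U p q →ₗ[ℝ] cechForms E U p (q + 1) where
  toFun f := (-1 : ℝ) ^ p • derFam f
  map_add' f g := by
    rw [← smul_add]
    refine congrArg _ (Subtype.ext <| funext fun α => ?_)
    exact dOn_add (cechForms_mem f α).1 (cechForms_mem g α).1
  map_smul' c f := by
    rw [RingHom.id_apply, smul_comm c]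
    refine congrArg _ (Subtype.ext <| funext fun α => ?_)
    exact dOn_smul c

theorem derD_apply (f : cechForms E U p q) {α : Fin (p + 1) → I} {x : M} (hx : x ∈ inter U α) :
    (derD E U p q f).1 α x = (-1 : ℝ) ^ p • extD (f.1 α) x :=
  congrArg (fun v => (-1 : ℝ) ^ p • v) (dOn_of_mem (θ := f.1 α) hx)

theorem derD_derD (f : cechForms E U p q) : derD E U p (q + 1) (derD E U p q f) = 0 := by
  refine cechForms_ext fun α x hx => ?_
  have h : (derD E U p q f).1 α = (-1 : ℝ) ^ p • dOn E (inter U α) q (f.1 α) := rfl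
  rw [derD_apply _ hx, h, extD_const_smul, ← dOn_of_mem (W := inter U α) hx,
    dOn_dOn (isOpen_inter U α) (cechForms_mem f α).1]
  simp

/-- The exterior derivative commutes with the alternating sum; the signs `(-1)^p` and `(-1)^(p+1)`
make the two composites cancel. -/
theorem cechD_derD (f : cechForms E U p q) :
    cechD E U p (q + 1) (derD E U p q f) + derD E U (p + 1) q (cechD E U p q f) = 0 := by
  refine cechForms_ext fun α x hx => ?_
  change (cechD E U p (q + 1) (derD E U p q f)).1 α x +
    (derD E U (p + 1) q (cechD E U p q f)).1 α x = 0
  have h1 : extD ((cechD E U p q f).1 α) x = extD (famD f.1 α) x :=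
    extD_congr (restr_eventuallyEq (isOpen_inter U α) hx)
  have h2 : ∀ i : Fin (p + 2), (derD E U p q f).1 (α ∘ i.succAbove) x =
      (-1 : ℝ) ^ p • extD (f.1 (α ∘ i.succAbove)) x := fun i =>
    derD_apply _ (inter_subset U α i.succAbove hx)
  rw [cechD_apply _ hx, derD_apply _ hx, h1, famD_apply, famD, extD_sum_of_smoothFormAt
    fun i _ => ((cechForms_mem f _).1 x (inter_subset U α i.succAbove hx)).const_smul _]
  simp only [h2, extD_const_smul, Finset.smul_sum, ← Finset.sum_add_distrib]
  refine Finset.sum_eq_zero fun i _ => ?_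
  rw [pow_succ, mul_neg_one, neg_smul, smul_comm, add_neg_cancel]

end CechDeRham

end Forms

/-! ### Exactness of the rows and the columns of the Čech–de Rham double complex -/

namespace Cech

variable {I : Type*} {A : Type*} [AddCommGroup A] [Module ℝ A] {p : ℕ}

theorem antisymmetrize_eq_self {f : (Fin (p + 1) → I) → A} (hf : f ∈ antisymm I A p) :
    antisymmetrize f = f := by
  funext α
  have h : ∀ σ : Equiv.Perm (Fin (p + 1)),
      ((Equiv.Perm.sign σ : ℤ) : ℝ) • f (α ∘ σ) = f α := by
    intro σ
    rw [hf σ α, ← Int.cast_smul_eq_zsmul ℝ, smul_smul, ← Int.cast_mul, ← Units.val_mul,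
      Int.units_mul_self]
    simp
  have h0 : ((p + 1).factorial : ℝ) ≠ 0 := Nat.cast_ne_zero.2 (Nat.factorial_ne_zero _)
  rw [antisymmetrize, Finset.sum_congr rfl fun σ _ => h σ, Finset.sum_const, Finset.card_univ,
    Fintype.card_perm, Fintype.card_fin, ← Nat.cast_smul_eq_nsmul ℝ, smul_smul,
    inv_mul_cancel₀ h0, one_smul]

end Cech

namespace Forms

open Cech

variable {E : Type*} [NormedAddCommGroup E] [NormedSpace ℝ E]
  {M : Type*} [TopologicalSpace M] [ChartedSpace E M]
  {I : Type*} {U : I → Opens M} {p q : ℕ}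

section Glue

/-- The combination of a family of forms by means of a partition of unity. -/
def glue (ρ : SmoothPartitionOfUnity I 𝓘(ℝ, E) M univ) (φ : I → FormField E M q) :
    FormField E M q := fun x => ∑ i ∈ ρ.finsupport x, ρ i x • φ i x

variable {ρ : SmoothPartitionOfUnity I 𝓘(ℝ, E) M univ} {φ : I → FormField E M q}

theorem glue_eq_sum {s : Finset I} {x : M} (hs : ρ.finsupport x ⊆ s) :
    glue ρ φ x = ∑ i ∈ s, ρ i x • φ i x := by
  refine Finset.sum_subset hs fun i _ hi => ?_
  rw [ρ.mem_finsupport, Function.mem_support, not_not] at hi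
  rw [hi, zero_smul]

theorem glue_eq {x : M} {v : TangentSpace 𝓘(ℝ, E) x [⋀^Fin q]→L[ℝ] ℝ}
    (h : ∀ i, ρ i x ≠ 0 → φ i x = v) : glue ρ φ x = v := by
  rw [glue, Finset.sum_congr rfl fun i hi => by rw [h i ((ρ.mem_finsupport x).1 hi)],
    ← Finset.sum_smul, ρ.sum_finsupport x (mem_univ x), one_smul]

/-- Near `x` the sum reduces to the finitely many indices whose support closure contains `x`, so a
term need not be smooth where its weight vanishes nearby. -/
theorem smoothFormAt_glue [IsManifold 𝓘(ℝ, E) ∞ M] {x : M}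
    (h : ∀ i, x ∈ tsupport (ρ i) → SmoothFormAt (φ i) x) : SmoothFormAt (glue ρ φ) x := by
  refine SmoothFormAt.congr (θ := ∑ i ∈ ρ.fintsupport x, mulForm (ρ i) (φ i)) ?_ ?_
  · exact SmoothFormAt.sum fun i hi => SmoothFormAt.mulForm (ρ i).contMDiff.contMDiffAt
      (h i ((ρ.mem_fintsupport_iff x i).1 hi))
  · filter_upwards [ρ.eventually_finsupport_subset x] with z hz
    rw [glue_eq_sum hz, Finset.sum_apply]
    rfl

theorem subordinate_ne_zero (hρ : ρ.IsSubordinate fun i => (U i : Set M)) {i : I} {x : M}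
    (h : ρ i x ≠ 0) : x ∈ U i := hρ i (subset_tsupport _ h)

end Glue

section Restriction

variable [IsManifold 𝓘(ℝ, E) ∞ M]

variable (E U q) in
/-- The restrictions of a form to the members of a cover. -/
def cechRestr : smoothForms E M q →ₗ[ℝ] cechForms E U 0 q where
  toFun θ := ⟨fun α => restr (inter U α) q θ.1, mem_cechForms.2
    ⟨fun α => restr_mem (isOpen_inter U α) fun x _ => mem_smoothForms_iff.1 θ.2 x,
      restr_family_antisymm (f := fun _ => θ.1) fun σ _ => by
        rw [Subsingleton.elim (α := Equiv.Perm (Fin 1)) σ 1]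
        simp⟩⟩
  map_add' _ _ := Subtype.ext (funext fun _ => map_add _ _ _)
  map_smul' _ _ := Subtype.ext (funext fun _ => map_smul _ _ _)

theorem cechRestr_apply (θ : smoothForms E M q) {α : Fin 1 → I} {x : M} (hx : x ∈ inter U α) :
    (cechRestr E U q θ).1 α x = θ.1 x := restr_of_mem hx

theorem derD_cechRestr (θ : smoothForms E M q) :
    cechRestr E U (q + 1) (d E M q θ) = derD E U 0 q (cechRestr E U q θ) := by
  refine cechForms_ext fun α x hx => ?_
  rw [cechRestr_apply _ hx, derD_apply _ hx, pow_zero, one_smul]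
  exact (extD_congr (restr_eventuallyEq (isOpen_inter U α) hx)).symm

theorem cechD_cechRestr (θ : smoothForms E M q) : cechD E U 0 q (cechRestr E U q θ) = 0 := by
  refine cechForms_ext fun α x hx => ?_
  rw [cechD_apply _ hx, famD_apply, Fin.sum_univ_two, cechRestr_apply _ (inter_subset U α _ hx),
    cechRestr_apply _ (inter_subset U α _ hx)]
  simp only [Fin.val_zero, Fin.val_one, pow_zero, pow_one, one_smul]
  exact (congrArg _ (neg_one_smul ℝ (θ.1 x))).trans (add_neg_cancel _)

theorem cechRestr_injective (hU : ∀ x, ∃ i, x ∈ U i) :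
    Function.Injective (cechRestr E U q : smoothForms E M q → cechForms E U 0 q) := by
  intro θ η h
  refine Subtype.ext (funext fun x => ?_)
  obtain ⟨i, hi⟩ := hU x
  have hx : x ∈ inter U (fun _ : Fin 1 => i) := fun _ => hi
  rw [← cechRestr_apply (U := U) θ hx, h, cechRestr_apply η hx]

end Restriction

/-! ### Exactness of the rows by partitions of unity. -/

section Rows

variable [FiniteDimensional ℝ E] [IsManifold 𝓘(ℝ, E) ∞ M] [T2Space M] [SecondCountableTopology M]

variable (E) in
theorem exists_partition (hU : ∀ x, ∃ i, x ∈ U i) :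
    ∃ ρ : SmoothPartitionOfUnity I 𝓘(ℝ, E) M univ, ρ.IsSubordinate fun i => (U i : Set M) := by
  have : LocallyCompactSpace M := Manifold.locallyCompact_of_finiteDimensional 𝓘(ℝ, E)
  exact SmoothPartitionOfUnity.exists_isSubordinate 𝓘(ℝ, E) isClosed_univ _
    (fun i => (U i).isOpen) fun x _ => mem_iUnion.2 (hU x)

/-- The primitive is `g_β = ∑ ρ_i f_{iβ}`. The summand with index `i` is smooth on all of `U_β`,
because `ρ_i` is supported in `U_i`. -/
theorem exists_cechD_eq (hU : ∀ x, ∃ i, x ∈ U i) (f : cechForms E U (p + 1) q)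
    (hf : cechD E U (p + 1) q f = 0) : ∃ g, cechD E U p q g = f := by
  obtain ⟨ρ, hρ⟩ := exists_partition E hU
  let g : (Fin (p + 1) → I) → FormField E M q := fun β =>
    restr (inter U β) q (glue ρ fun i => f.1 (Fin.cons i β : Fin (p + 2) → I))
  have hg : g ∈ cechForms E U p q := by
    refine mem_cechForms.2 ⟨fun β => restr_mem (isOpen_inter U β) fun x hx => ?_,
      restr_family_antisymm fun σ β => ?_⟩
    · exact smoothFormAt_glue fun i hi =>
        (cechForms_mem f _).1 x ((mem_inter_cons U β).2 ⟨hρ i hi, hx⟩)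
    · obtain ⟨τ, hτ, h⟩ := exists_perm_cons (I := I) σ
      funext x
      simp only [glue, ← h, cechForms_perm f, hτ]
      rw [Pi.smul_apply, glue, Finset.smul_sum]
      refine Finset.sum_congr rfl fun i _ => ?_
      rw [Pi.smul_apply]
      exact smul_comm _ _ _
  refine ⟨⟨g, hg⟩, cechForms_ext fun α x hx => ?_⟩
  have h1 : ∀ k : Fin (p + 2), g (α ∘ k.succAbove) x =
      glue ρ (fun i => f.1 (Fin.cons i (α ∘ k.succAbove) : Fin (p + 2) → I)) x := fun k =>
    restr_of_mem (inter_subset U α k.succAbove hx)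
  rw [cechD_apply _ hx, famD_apply]
  simp only [h1]
  refine Eq.trans ?_ (glue_eq (ρ := ρ) (φ := fun i => ∑ k : Fin (p + 2), (-1 : ℝ) ^ (k : ℕ) •
    f.1 (Fin.cons i (α ∘ k.succAbove) : Fin (p + 2) → I)) fun i hi => ?_)
  · simp only [glue, Finset.sum_apply, Pi.smul_apply, Finset.smul_sum]
    rw [Finset.sum_comm]
    exact Finset.sum_congr rfl fun i _ => Finset.sum_congr rfl fun k _ => smul_comm _ _ _
  -- By `famD_cons`, `(δ f)_{iα} = 0` says that the alternating sum of the `f_{i, α omit k}` is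
  -- `f_α`, for every `i` with `ρ i x ≠ 0`. The weights add up to one.
  · have h2 := congrArg (fun f : cechForms E U (p + 2) q =>
      f.1 (Fin.cons i α : Fin (p + 3) → I) x) hf
    simp only [cechD_apply f ((mem_inter_cons U α).2 ⟨subordinate_ne_zero hρ hi, hx⟩),
      famD_cons] at h2
    exact (sub_eq_zero.1 h2).symm

/-- Closedness means that the local forms agree on overlaps, so their weighted average is a global
form restricting to each of them. -/
theorem exists_cechRestr_eq (hU : ∀ x, ∃ i, x ∈ U i) (f : cechForms E U 0 q)
    (hf : cechD E U 0 q f = 0) : ∃ θ, cechRestr E U q θ = f := by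
  obtain ⟨ρ, hρ⟩ := exists_partition E hU
  refine ⟨⟨glue ρ fun i => f.1 fun _ => i, mem_smoothForms_iff.2 fun x => ?_⟩, ?_⟩
  · exact smoothFormAt_glue fun i hi => (cechForms_mem f _).1 x fun _ => hρ i hi
  · refine cechForms_ext fun α x hx => ?_
    rw [cechRestr_apply _ hx]
    refine glue_eq fun i hi => ?_
    have h2 := congrArg (fun f : cechForms E U 1 q =>
      f.1 (Fin.cons i α : Fin 2 → I) x) hf
    simp only [cechD_apply f ((mem_inter_cons U α).2 ⟨subordinate_ne_zero hρ hi, hx⟩),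
      famD_cons, Fin.sum_univ_succ, Fin.sum_univ_zero, add_zero] at h2
    have h3 : (Fin.cons i (α ∘ (0 : Fin 1).succAbove) : Fin 1 → I) = fun _ => i := by
      funext j
      rw [Subsingleton.elim (α := Fin 1) j 0]
      rfl
    rw [h3] at h2
    simp only [Fin.val_zero, pow_zero, one_smul] at h2
    exact (sub_eq_zero.1 h2).symm

variable (E U) in
/-- `cechRestr` as a map on the terms of the de Rham complex. -/
def deRhamAugmentation (q : ℕ) : (complex E M).X q →ₗ[ℝ] cechForms E U 0 q := cechRestr E U q

/-- The inclusion of the de Rham complex into the Čech–de Rham complex is a quasi-isomorphism. -/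
def deRhamQuasiIso (hU : ∀ x, ∃ i, x ∈ U i) :
    RelCone.QuasiIsoTo (Z := ∀ p q, cechForms E U p q) (complex E M)
      (DoubleComplex.totD (A := fun p q => cechForms E U p q) (cechD E U) (derD E U))
      (DoubleComplex.totDeg ℝ fun p q => cechForms E U p q) :=
  DoubleComplex.augmentationQuasiIso (A := fun p q => cechForms E U p q)
    (deRhamAugmentation E U)
    (fun _ _ x => cechD_cechD x) (fun _ _ x => derD_derD x) (fun _ _ x => cechD_derD x)
    (fun _ _ => exists_cechD_eq hU)
    (fun q θ => by
      rw [complex_d]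
      exact derD_cechRestr θ)
    (fun _ θ => cechD_cechRestr θ) (fun _ => cechRestr_injective hU)
    (fun _ x hx => exists_cechRestr_eq hU x hx)

end Rows

/-! ### Exactness of the columns by the Poincaré lemma. -/

section Columns

theorem antisymmetrize_mem_cechForms {κ : (Fin (p + 1) → I) → FormField E M q}
    (hκ : ∀ α, κ α ∈ formsOn E (inter U α) q) : antisymmetrize κ ∈ cechForms E U p q := by
  refine mem_cechForms.2 ⟨fun α => ?_, antisymmetrize_mem κ⟩
  refine Submodule.smul_mem _ _ (Submodule.sum_mem _ fun σ _ => Submodule.smul_mem _ _ ?_)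
  rw [← inter_comp_perm U α σ]
  exact hκ _

variable [IsManifold 𝓘(ℝ, E) ∞ M]

theorem extD_eq_zero_of_derD_eq_zero {f : cechForms E U p q} (hf : derD E U p q f = 0)
    (α : Fin (p + 1) → I) : ∀ x ∈ inter U α, extD (f.1 α) x = 0 := by
  intro x hx
  have h := derD_apply f hx
  rw [hf] at h
  exact (smul_eq_zero.1 h.symm).resolve_left (pow_ne_zero _ (by norm_num))

/-- The Poincaré lemma gives a primitive on each nonempty intersection. Primitives for tuples
differing by a permutation are chosen independently, so the family is antisymmetrized; this commutes
with `extD` and fixes `f`, hence the result is still a primitive. -/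
theorem exists_derD_eq [FiniteDimensional ℝ E] [T2Space M] [SecondCountableTopology M]
    (hU : IsGoodCover U) (f : cechForms E U p (q + 1)) (hf : derD E U p (q + 1) f = 0) :
    ∃ g, derD E U p q g = f := by
  have hd := extD_eq_zero_of_derD_eq_zero hf
  have h1 : ∀ α, ∃ κ ∈ formsOn E (inter U α) q, ∀ x ∈ inter U α, extD κ x = f.1 α x := by
    intro α
    rcases (inter U α).eq_empty_or_nonempty with h | h
    · exact ⟨0, Submodule.zero_mem _, fun x hx => absurd hx (by simp [h])⟩
    · have := hU.contractible p α h
      exact exists_extD_eq (isOpen_inter U α) (cechForms_mem f α) (hd α)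
  choose κ hκ hκf using h1
  -- The factor `(-1)^p` compensates for the sign in `derD`.
  refine ⟨(-1 : ℝ) ^ p • ⟨antisymmetrize κ, antisymmetrize_mem_cechForms hκ⟩,
    cechForms_ext fun α x hx => ?_⟩
  have hx' : ∀ σ : Equiv.Perm (Fin (p + 1)), x ∈ inter U (α ∘ σ) := fun σ => inter_subset U α σ hx
  rw [map_smul]
  refine (congrArg (fun v => (-1 : ℝ) ^ p • v) (derD_apply _ hx)).trans ?_
  rw [smul_smul, ← mul_pow, neg_one_mul, neg_neg, one_pow, one_smul]
  change extD (antisymmetrize κ α) x = _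
  rw [antisymmetrize, extD_const_smul, extD_sum_of_smoothFormAt
    fun (σ : Equiv.Perm (Fin (p + 1))) _ =>
      ((hκ (α ∘ σ)).1 x (hx' σ)).const_smul _]
  simp only [extD_const_smul, hκf _ x (hx' _)]
  have h2 := congrFun (congrFun (antisymmetrize_eq_self (mem_cechForms.1 f.2).2) α) x
  rw [← h2]
  simp only [antisymmetrize, Pi.smul_apply, Finset.sum_apply]

end Columns

end Forms

/-! ### Locally constant functions in the Čech–de Rham double complex -/

namespace Forms

open Cech

section Constants

variable {E : Type*} [NormedAddCommGroup E] [NormedSpace ℝ E]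
  {M : Type*} [TopologicalSpace M] [ChartedSpace E M]
  {I : Type*} {U : I → Opens M} {p : ℕ}

variable (E) in
/-- The value of a form of degree `0` at a point. -/
def value (x : M) : (TangentSpace 𝓘(ℝ, E) x [⋀^Fin 0]→L[ℝ] ℝ) →ₗ[ℝ] ℝ where
  toFun ξ := (ξ : E [⋀^Fin 0]→L[ℝ] ℝ) 0
  map_add' _ _ := rfl
  map_smul' _ _ := rfl

/-- A `0`-form at a point is determined by its value on the empty tuple, which reduces identities in
row `0` to identities of real numbers. -/
theorem value_injective (x : M) : Function.Injective (value E x) := by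
  intro ξ η h
  ext v
  rw [Subsingleton.elim v 0]
  exact h

open Classical in
/-- The extension of a component of a Čech cochain by zero. -/
def cochainFun (c : cochains U ℝ ℝ p) (α : Fin (p + 1) → I) (x : M) : ℝ :=
  if h : x ∈ inter U α then c.1 α ⟨x, h⟩ else 0

theorem cochainFun_of_mem (c : cochains U ℝ ℝ p) {α : Fin (p + 1) → I} {x : M}
    (hx : x ∈ inter U α) : cochainFun c α x = c.1 α ⟨x, hx⟩ := dif_pos hx

theorem cochainFun_eventually_eq (c : cochains U ℝ ℝ p) {α : Fin (p + 1) → I} {x : M}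
    (hx : x ∈ inter U α) : ∀ᶠ z in 𝓝 x, cochainFun c α z = cochainFun c α x := by
  rw [← map_nhds_subtype_coe_eq_nhds hx ((isOpen_inter U α).mem_nhds hx), Filter.eventually_map]
  filter_upwards [(c.1 α).isLocallyConstant.eventually_eq ⟨x, hx⟩] with z hz
  rw [cochainFun_of_mem c z.2, cochainFun_of_mem c hx]
  exact hz

variable (E U p) in
/-- The Čech cochains as families of forms of degree `0`. -/
def cechConst : cochains U ℝ ℝ p →ₗ[ℝ] cechForms E U p 0 where
  toFun c := ⟨fun α => restr (inter U α) 0 (constForm E (cochainFun c α)), mem_cechForms.2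
    ⟨fun α => restr_mem (isOpen_inter U α) fun x hx =>
      smoothFormAt_constForm (cochainFun_eventually_eq c hx), fun σ α => by
      change restr (inter U (α ∘ σ)) 0 (constForm E (cochainFun c (α ∘ σ))) =
        _ • restr (inter U α) 0 (constForm E (cochainFun c α))
      rw [inter_comp_perm, ← map_zsmul]
      refine restr_eq_restr fun x hx => value_injective x ?_
      rw [Pi.smul_apply, map_zsmul]
      change cochainFun c (α ∘ σ) x = _ • cochainFun c α x
      rw [cochainFun_of_mem c hx, cochainFun_of_mem c (inter_subset U α σ hx)]
      exact c.2 σ α ⟨x, hx⟩⟩⟩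
  map_add' b c := cechForms_ext fun α x hx => value_injective x <| by
    refine (congrArg _ (restr_of_mem hx)).trans (Eq.trans ?_ (map_add _ _ _).symm)
    simp only [restr_of_mem hx]
    change cochainFun (b + c) α x = cochainFun b α x + cochainFun c α x
    simp only [cochainFun_of_mem _ hx]
    rfl
  map_smul' a c := cechForms_ext fun α x hx => value_injective x <| by
    refine (congrArg _ (restr_of_mem hx)).trans (Eq.trans ?_ (map_smul (value E x) a _).symm)
    simp only [restr_of_mem hx]
    change cochainFun (a • c) α x = a • cochainFun c α x
    simp only [cochainFun_of_mem _ hx]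
    rfl

theorem value_cechConst (c : cochains U ℝ ℝ p) {α : Fin (p + 1) → I} {x : M}
    (hx : x ∈ inter U α) : value E x ((cechConst E U p c).1 α x) = c.1 α ⟨x, hx⟩ :=
  (congrArg _ (restr_of_mem hx)).trans (cochainFun_of_mem c hx)

theorem cechConst_injective : Function.Injective (cechConst E U p) := by
  intro b c h
  refine Subtype.ext (funext fun α => LocallyConstant.ext fun x => ?_)
  rw [← value_cechConst (E := E) b x.2, h, value_cechConst c x.2]

theorem cechD_cechConst (c : cochains U ℝ ℝ p) :
    cechConst E U (p + 1) ⟨dAux U ℝ ℝ p c.1, dAux_mem U ℝ ℝ p c.2⟩ =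
      cechD E U p 0 (cechConst E U p c) := by
  refine cechForms_ext fun α x hx => value_injective x ?_
  rw [value_cechConst _ hx, cechD_apply _ hx, famD_apply, map_sum]
  refine (dAux_apply U ℝ ℝ p c.1 α ⟨x, hx⟩).trans (Finset.sum_congr rfl fun i _ => ?_)
  rw [map_smul, value_cechConst _ (inter_subset U α i.succAbove hx)]
  rfl

variable [IsManifold 𝓘(ℝ, E) ∞ M]

theorem derD_cechConst (c : cochains U ℝ ℝ p) : derD E U p 0 (cechConst E U p c) = 0 := by
  refine cechForms_ext fun α x hx => ?_
  rw [derD_apply _ hx]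
  have h : extD ((cechConst E U p c).1 α) x = 0 :=
    (extD_congr (restr_eventuallyEq (isOpen_inter U α) hx)).trans
      (extD_constForm (cochainFun_eventually_eq c hx))
  rw [h]
  exact smul_zero _

/-- Closed `0`-forms on an open set are locally constant functions, so the kernel of `d` in row `0`
is exactly the Čech complex. -/
theorem exists_cechConst_eq (f : cechForms E U p 0) (hf : derD E U p 0 f = 0) :
    ∃ c, cechConst E U p c = f := by
  have hd := extD_eq_zero_of_derD_eq_zero hf
  refine ⟨⟨fun α => ⟨fun x => value E x.1 (f.1 α x.1), ?_⟩, fun σ α x => ?_⟩, ?_⟩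
  · exact (IsLocallyConstant.iff_eventually_eq _).2 fun x =>
      continuous_subtype_val.continuousAt.eventually
        (eventually_eq_of_extD_eq_zero (isOpen_inter U α) (cechForms_mem f α) (hd α) x.2)
  · change value E x.1 (f.1 (α ∘ σ) x.1) = _ • value E x.1 (f.1 α x.1)
    rw [cechForms_perm, ← map_zsmul]
    rfl
  · refine cechForms_ext fun α x hx => value_injective x ?_
    rw [value_cechConst _ hx]
    rfl

variable (E U) in
omit [IsManifold 𝓘(ℝ, E) ∞ M] in
/-- `cechConst` as a map on the terms of the Čech complex. -/
def cechAugmentation (p : ℕ) : (Cech.complex U ℝ ℝ).X p →ₗ[ℝ] cechForms E U p 0 :=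
  cechConst E U p

/-- For a good cover, the inclusion of the Čech complex into the Čech–de Rham complex is a
quasi-isomorphism. -/
def cechQuasiIso [FiniteDimensional ℝ E] [T2Space M] [SecondCountableTopology M]
    (hU : IsGoodCover U) :
    RelCone.QuasiIsoTo (Z := ∀ p q, cechForms E U p q) (Cech.complex U ℝ ℝ)
      (DoubleComplex.totD (A := fun p q => cechForms E U p q) (cechD E U) (derD E U))
      (DoubleComplex.totDeg ℝ fun p q => cechForms E U p q) :=
  DoubleComplex.ofSwap (A := fun p q => cechForms E U p q) <|
    -- After the exchange, the rows are the de Rham complexes of the intersections, and the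
    -- augmentation is by locally constant functions.
    DoubleComplex.augmentationQuasiIso (A := fun q p => cechForms E U p q)
      (cechAugmentation E U)
      (fun _ _ x => derD_derD x) (fun _ _ x => cechD_cechD x)
      (fun _ _ x => (add_comm _ _).trans (cechD_derD x))
      (fun _ _ x hx => exists_derD_eq hU x hx)
      (fun p c => by
        rw [Cech.complex_d]
        exact cechD_cechConst c) (fun _ c => derD_cechConst c)
      (fun _ => cechConst_injective) (fun _ x hx => exists_cechConst_eq x hx)

end Constants

end Forms

/-! ### Pull-back -/

namespace DoubleComplex

universe v w v' w'

variable {R : Type*} [CommRing R]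
  {A : ℕ → ℕ → Type w} [∀ p q, AddCommGroup (A p q)] [∀ p q, Module R (A p q)]
  {B : ℕ → ℕ → Type w'} [∀ p q, AddCommGroup (B p q)] [∀ p q, Module R (B p q)]

/-- The map of products induced by a family of maps. -/
def mapTot (g : ∀ p q, A p q →ₗ[R] B p q) : (∀ p q, A p q) →ₗ[R] (∀ p q, B p q) where
  toFun x p q := g p q (x p q)
  map_add' _ _ := funext fun _ => funext fun _ => map_add _ _ _
  map_smul' _ _ := funext fun _ => funext fun _ => map_smul _ _ _

variable (g : ∀ p q, A p q →ₗ[R] B p q)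

theorem mapTot_mem {m : ℕ} {x : ∀ p q, A p q} (hx : x ∈ totDeg R A m) :
    mapTot g x ∈ totDeg R B m := fun p q h => (congrArg (g p q) (hx p q h)).trans (map_zero _)

theorem mapTot_totD {δ : ∀ p q, A p q →ₗ[R] A (p + 1) q} {d : ∀ p q, A p q →ₗ[R] A p (q + 1)}
    {δ' : ∀ p q, B p q →ₗ[R] B (p + 1) q} {d' : ∀ p q, B p q →ₗ[R] B p (q + 1)}
    (hδ : ∀ p q x, g (p + 1) q (δ p q x) = δ' p q (g p q x))
    (hd : ∀ p q x, g p (q + 1) (d p q x) = d' p q (g p q x)) (x : ∀ p q, A p q) :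
    mapTot g (totD δ d x) = totD δ' d' (mapTot g x) := by
  funext p q
  change g p q (horD δ x p q + verD d x p q) =
    horD δ' (mapTot g x) p q + verD d' (mapTot g x) p q
  rw [map_add]
  congr 1
  · cases p with
    | zero => exact map_zero _
    | succ p => exact hδ _ _ _
  · cases q with
    | zero => exact map_zero _
    | succ q => exact hd _ _ _

/-- An augmented element is determined by its one possible nonzero entry, so compatibility needs
checking only there. -/
theorem mapTot_augmentation {X : CochainComplex (ModuleCat.{v} R) ℕ}
    {Y : CochainComplex (ModuleCat.{v'} R) ℕ} {ε : ∀ q, X.X q →ₗ[R] A 0 q}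
    {ε' : ∀ q, Y.X q →ₗ[R] B 0 q} {m : ℕ} {x : X.X m} {y : Y.X m}
    (h : g 0 m (ε m x) = ε' m y) :
    mapTot g (augmentation ε (m + 1) x) = augmentation ε' (m + 1) y := by
  refine augmentation_unique ε' m y _ (mapTot_mem g (augmentation_mem ε (m + 1) x)) ?_ ?_
  · exact (congrArg (g 0 m) (augmentation_same ε m x)).trans h
  · intro p q
    exact (congrArg (g (p + 1) q) (augmentation_succ ε m x p q)).trans (map_zero _)

end DoubleComplex

namespace Forms

open Cech

section Pullback

variable {E : Type*} [NormedAddCommGroup E] [NormedSpace ℝ E]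
  {M : Type*} [TopologicalSpace M] [ChartedSpace E M] [IsManifold 𝓘(ℝ, E) ∞ M]
  {F : Type*} [NormedAddCommGroup F] [NormedSpace ℝ F]
  {N : Type*} [TopologicalSpace N] [ChartedSpace F N] [IsManifold 𝓘(ℝ, F) ∞ N]
  {I J : Type*} {U : I → Opens M} {V : J → Opens N} {p q : ℕ}

omit [IsManifold 𝓘(ℝ, E) ∞ M] [IsManifold 𝓘(ℝ, F) ∞ N] in
theorem pull_congr {φ : M → N} {θ η : FormField F N q} {x : M} (h : θ (φ x) = η (φ x)) :
    (pull φ θ : FormField E M q) x = pull φ η x := by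
  simp only [pull, h]

variable (E F q) in
/-- The pull-back of families of forms as a linear map. -/
def pullLinear (φ : M → N) : FormField F N q →ₗ[ℝ] FormField E M q where
  toFun := pull φ
  map_add' _ _ := rfl
  map_smul' _ _ := rfl

variable (Φ : C^∞⟮𝓘(ℝ, E), M; 𝓘(ℝ, F), N⟯) (r : I → J) (hr : ∀ i, MapsTo Φ (U i) (V (r i)))

/-- The pull-back of Čech–de Rham cochains. -/
def cechPull (p q : ℕ) : cechForms F V p q →ₗ[ℝ] cechForms E U p q where
  toFun g := ⟨fun α => restr (inter U α) q (pullLinear E F q Φ (g.1 (r ∘ α))), mem_cechForms.2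
    ⟨fun α => restr_mem (isOpen_inter U α) fun x hx =>
      SmoothFormAt.pull (Filter.Eventually.of_forall fun _ => Φ.contMDiff.contMDiffAt)
        ((cechForms_mem g (r ∘ α)).1 _ fun k => hr _ (hx k)),
    restr_family_antisymm (f := fun α => pullLinear E F q Φ (g.1 (r ∘ α))) fun σ α => by
      change pullLinear E F q Φ (g.1 ((r ∘ α) ∘ σ)) = _
      rw [cechForms_perm, map_zsmul]⟩⟩
  map_add' f g := Subtype.ext (funext fun α =>
    map_add (restr (inter U α) q) (pullLinear E F q Φ (f.1 (r ∘ α)))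
      (pullLinear E F q Φ (g.1 (r ∘ α))))
  map_smul' c g := Subtype.ext (funext fun α =>
    map_smul (restr (inter U α) q) c (pullLinear E F q Φ (g.1 (r ∘ α))))

variable {Φ r}

theorem cechPull_apply (g : cechForms F V p q) {α : Fin (p + 1) → I} {x : M}
    (hx : x ∈ inter U α) : (cechPull Φ r hr p q g).1 α x = pull Φ (g.1 (r ∘ α)) x :=
  restr_of_mem hx

/-- Omitting an index commutes with applying `r`, and pull-back is linear. The cut-offs are harmless
because `Φ` maps `U_α` into `V_{r ∘ α}`. -/
theorem cechPull_cechD (g : cechForms F V p q) :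
    cechPull Φ r hr (p + 1) q (cechD F V p q g) = cechD E U p q (cechPull Φ r hr p q g) := by
  refine cechForms_ext fun α x hx => ?_
  have hx' : Φ x ∈ inter V (r ∘ α) := fun k => hr _ (hx k)
  rw [cechPull_apply hr _ hx, cechD_apply _ hx, famD_apply, pull_congr (cechD_apply g hx')]
  change pullLinear E F q Φ (famD g.1 (r ∘ α)) x = _
  rw [famD, map_sum, Finset.sum_apply]
  refine Finset.sum_congr rfl fun i _ => ?_
  rw [cechPull_apply hr _ (inter_subset U α i.succAbove hx)]
  rfl

theorem cechPull_derD (g : cechForms F V p q) :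
    cechPull Φ r hr p (q + 1) (derD F V p q g) = derD E U p q (cechPull Φ r hr p q g) := by
  refine cechForms_ext fun α x hx => ?_
  have hx' : Φ x ∈ inter V (r ∘ α) := fun k => hr _ (hx k)
  have h1 : extD ((cechPull Φ r hr p q g).1 α) x =
      extD (pull Φ (g.1 (r ∘ α)) : FormField E M q) x :=
    extD_congr (restr_eventuallyEq (isOpen_inter U α) hx)
  rw [cechPull_apply hr _ hx, derD_apply _ hx, h1, ← pull_extD_of_contMDiffAt
    (Filter.Eventually.of_forall fun _ => Φ.contMDiff.contMDiffAt)
    ((cechForms_mem g (r ∘ α)).1 _ hx')]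
  exact pull_congr (η := (-1 : ℝ) ^ p • extD (g.1 (r ∘ α))) (derD_apply g hx')

theorem cechPull_cechRestr (θ : smoothForms F N q) :
    cechPull Φ r hr 0 q (cechRestr F V q θ) = cechRestr E U q (pullback Φ q θ) := by
  refine cechForms_ext fun α x hx => ?_
  have hx' : Φ x ∈ inter V (r ∘ α) := fun k => hr _ (hx k)
  rw [cechPull_apply hr _ hx, cechRestr_apply _ hx, pull_congr (cechRestr_apply θ hx')]
  rfl

theorem cechPull_cechConst (c : cochains V ℝ ℝ p) :
    cechPull Φ r hr p 0 (cechConst F V p c) =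
      cechConst E U p (Cech.pullback ℝ ℝ ⟨Φ, Φ.contMDiff.continuous⟩ r hr p c) := by
  refine cechForms_ext fun α x hx => value_injective x ?_
  have hx' : Φ x ∈ inter V (r ∘ α) := fun k => hr _ (hx k)
  rw [cechPull_apply hr _ hx, value_cechConst _ hx]
  refine Eq.trans ?_ (value_cechConst (E := F) c hx')
  exact congrArg ((cechConst F V p c).1 (r ∘ α) (Φ x) : F [⋀^Fin 0]→L[ℝ] ℝ)
    (Subsingleton.elim _ _)

end Pullback

end Forms

/-! ### Comparison of two cones through a morphism of double complexes. -/

namespace DoubleComplex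

open RelCone

/-- A morphism of double complexes which is compatible with two cochain maps `f` and `f'`, whose
sources and targets are quasi-isomorphic to the total complexes, identifies the cohomology of the
mapping cones of `f` and `f'`. -/
theorem nonempty_cone_homology_equiv {R : Type*} [CommRing R]
    {A : ℕ → ℕ → Type*} [∀ p q, AddCommGroup (A p q)] [∀ p q, Module R (A p q)]
    {B : ℕ → ℕ → Type*} [∀ p q, AddCommGroup (B p q)] [∀ p q, Module R (B p q)]
    {δ : ∀ p q, A p q →ₗ[R] A (p + 1) q} {d : ∀ p q, A p q →ₗ[R] A p (q + 1)}
    {δ' : ∀ p q, B p q →ₗ[R] B (p + 1) q} {d' : ∀ p q, B p q →ₗ[R] B p (q + 1)}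
    (g : ∀ p q, A p q →ₗ[R] B p q)
    (hδ : ∀ p q x, g (p + 1) q (δ p q x) = δ' p q (g p q x))
    (hd : ∀ p q x, g p (q + 1) (d p q x) = d' p q (g p q x))
    {X Y : CochainComplex (ModuleCat R) ℕ} {f : ∀ n, X.X n →ₗ[R] Y.X n}
    (hf : ∀ n x, f (n + 1) ((X.d n (n + 1)).hom x) = (Y.d n (n + 1)).hom (f n x))
    {X' Y' : CochainComplex (ModuleCat R) ℕ} {f' : ∀ n, X'.X n →ₗ[R] Y'.X n}
    (hf' : ∀ n x, f' (n + 1) ((X'.d n (n + 1)).hom x) = (Y'.d n (n + 1)).hom (f' n x))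
    (a : QuasiIsoTo X (totD δ d) (totDeg R A)) (b : QuasiIsoTo Y (totD δ' d') (totDeg R B))
    (a' : QuasiIsoTo X' (totD δ d) (totDeg R A)) (b' : QuasiIsoTo Y' (totD δ' d') (totDeg R B))
    (hab : ∀ n x, mapTot g (a.toFun (n + 1) x) = b.toFun (n + 1) (f n x))
    (hab' : ∀ n x, mapTot g (a'.toFun (n + 1) x) = b'.toFun (n + 1) (f' n x)) (q : ℕ) :
    Nonempty ((cone X Y f hf).homology q ≃ₗ[R] (cone X' Y' f' hf').homology q) := by
  obtain ⟨e⟩ := RelCone.nonempty_cone_homology_equiv f hf a b totDeg_zero totDeg_zero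
    (mapTot_totD g hδ hd) (fun _ _ hx => mapTot_mem g hx) hab q
  obtain ⟨e'⟩ := RelCone.nonempty_cone_homology_equiv f' hf' a' b' totDeg_zero totDeg_zero
    (mapTot_totD g hδ hd) (fun _ _ hx => mapTot_mem g hx) hab' q
  exact ⟨e.trans e'.symm⟩

end DoubleComplex

/-! ### Pull-back and the two inclusions commute strictly. -/

namespace Forms

open Cech

variable {E : Type*} [NormedAddCommGroup E] [NormedSpace ℝ E] [FiniteDimensional ℝ E]
  {M : Type*} [TopologicalSpace M] [ChartedSpace E M] [IsManifold 𝓘(ℝ, E) ∞ M]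
  [T2Space M] [SecondCountableTopology M]
  {F : Type*} [NormedAddCommGroup F] [NormedSpace ℝ F] [FiniteDimensional ℝ F]
  {N : Type*} [TopologicalSpace N] [ChartedSpace F N] [IsManifold 𝓘(ℝ, F) ∞ N]
  [T2Space N] [SecondCountableTopology N]
  {I J : Type*} {U : I → Opens M} {V : J → Opens N}
  {Φ : C^∞⟮𝓘(ℝ, E), M; 𝓘(ℝ, F), N⟯} {r : I → J} (hr : ∀ i, MapsTo Φ (U i) (V (r i)))

theorem mapTot_deRhamQuasiIso (hU : ∀ x, ∃ i, x ∈ U i) (hV : ∀ x, ∃ j, x ∈ V j) (n : ℕ)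
    (θ : smoothForms F N n) :
    DoubleComplex.mapTot (A := fun p q => cechForms F V p q) (B := fun p q => cechForms E U p q)
      (cechPull Φ r hr) ((deRhamQuasiIso hV).toFun (n + 1) θ) =
      (deRhamQuasiIso hU).toFun (n + 1) (pullback Φ n θ) :=
  DoubleComplex.mapTot_augmentation (A := fun p q => cechForms F V p q)
    (B := fun p q => cechForms E U p q)
    (ε := deRhamAugmentation F V) (ε' := deRhamAugmentation E U)
    (cechPull Φ r hr) (cechPull_cechRestr hr θ)

theorem mapTot_cechQuasiIso (hU : IsGoodCover U) (hV : IsGoodCover V) (n : ℕ)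
    (c : cochains V ℝ ℝ n) :
    DoubleComplex.mapTot (A := fun p q => cechForms F V p q) (B := fun p q => cechForms E U p q)
      (cechPull Φ r hr) ((cechQuasiIso hV).toFun (n + 1) c) =
      (cechQuasiIso hU).toFun (n + 1)
        (Cech.pullback ℝ ℝ ⟨Φ, Φ.contMDiff.continuous⟩ r hr n c) :=
  -- The Čech inclusion is an augmentation only after exchanging the directions, so the comparison
  -- is made there and transported back.
  congrArg (DoubleComplex.swap ℝ fun p q => cechForms E U p q)
    (DoubleComplex.mapTot_augmentation (A := fun q p => cechForms F V p q)
      (B := fun q p => cechForms E U p q)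
      (ε := cechAugmentation F V) (ε' := cechAugmentation E U)
      (fun q p => cechPull Φ r hr p q) (cechPull_cechConst hr c))

end Forms

end

theorem mainTheorem6
    {E : Type*} [NormedAddCommGroup E] [NormedSpace ℝ E] [FiniteDimensional ℝ E]
    {F : Type*} [NormedAddCommGroup F] [NormedSpace ℝ F] [FiniteDimensional ℝ F]
    {M : Type*} [TopologicalSpace M] [ChartedSpace E M] [IsManifold 𝓘(ℝ, E) ∞ M]
    [T2Space M] [SecondCountableTopology M]
    {N : Type*} [TopologicalSpace N] [ChartedSpace F N] [IsManifold 𝓘(ℝ, F) ∞ N]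
    [T2Space N] [SecondCountableTopology N]
    (Φ : C^∞⟮𝓘(ℝ, E), M; 𝓘(ℝ, F), N⟯)
    {I J : Type*} (U : I → Opens M) (V : J → Opens N)
    (hU : Cech.IsGoodCover U) (hV : Cech.IsGoodCover V)
    (r : I → J) (hr : ∀ i, MapsTo Φ (U i) (V (r i))) (q : ℕ) :
    Nonempty (Forms.relCohomology Φ q ≃ₗ[ℝ]
      Cech.relCohomology ℝ ℝ ⟨Φ, Φ.contMDiff.continuous⟩ r hr q) := by
  have hab := Forms.mapTot_deRhamQuasiIso hr hU.covers hV.covers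
  have hab' := Forms.mapTot_cechQuasiIso hr hU hV
  have key := DoubleComplex.nonempty_cone_homology_equiv (A := fun p q => Forms.cechForms F V p q)
    (B := fun p q => Forms.cechForms E U p q) (Forms.cechPull Φ r hr)
    (fun _ _ => Forms.cechPull_cechD hr) (fun _ _ => Forms.cechPull_derD hr)
    (Forms.pullback_d Φ) (Cech.pullback_d ℝ ℝ ⟨Φ, Φ.contMDiff.continuous⟩ r hr)
    (Forms.deRhamQuasiIso hV.covers) (Forms.deRhamQuasiIso hU.covers)
    (Forms.cechQuasiIso hV) (Forms.cechQuasiIso hU)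
  exact key hab hab' q
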